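/- A double-well potential is a function $W \in C^\infty(\mathbf{R};\mathbf{R})$ such that: $W \ge 0$, with $W(x) = 0$ if and only if $x = \pm 1$; $W(x) = W(-x)$ for all $x$; $W''(\pm 1) > 0$; and $W'(x)/x$ is nondecreasing on $(0,1)$ and nonincreasing on $(-1,0)$. Let $(M, g_M)$ be a nonempty closed Riemannian manifold (not necessarily connected) and let $(N, g_N) = \mathbf{S}^1 \times (M, g_M)$ be its Riemannian product with the unit circle. For $\varepsilon > 0$, a double-well phase transition for $W$ with parameter $\varepsilon$ is a function $u \in C^\infty(N; [-1,1])$ that is a critical point of $$E_\varepsilon(u) = \int_N \Big( \tfrac12 \varepsilon |\nabla_{g_N} u|^2 + \varepsilon^{-1} W(u) \Big) \, d\mu_{g_N},$$ i.e. $\tfrac{d}{dt}\big|_{t=0} E_\varepsilon(u + t\varphi) = 0$ for every $\varphi \in C^\infty(N)$. Theorem. Let $W$ be a double-well potential, let $\varepsilon_i > 0$ with $\varepsilon_i \to 0$, let $u_i : N \to [-1,1]$ be double-well phase transitions for $W$ with parameters $\varepsilon_i$, and suppose that the nodal sets $\{u_i = 0\}$ converge in the Hausdorff sense to $\Sigma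 := \{\theta_1, \ldots, \theta_m\} \times M$, where $\theta_1, \ldots, \theta_m \in \mathbf{S}^1$ are distinct. Then: (a) $u_i \to \pm 1$ locally uniformly on $N \setminus \Sigma$ up to an overall sign for each $i$ and each component of $M$, and the $\pm$ sign alternates across each component of $\Sigma$. Precisely, there are locally constant functions $s_i : M \to \{-1, 1\}$ and a function $\sigma$ on $\mathbf{S}^1$ that is locally constant with values $\pm 1$ on $\mathbf{S}^1 \setminus \{\theta_1, \ldots, \theta_m\}$ and takes opposite values on the two sides of each $\theta_k$, such that $s_i(x)\, u_i(\theta, x) \to \sigma(\theta)$ locally uniformly on $N \setminus \Sigma$. In particular, $m$ is even. (b) $\Sigma$ is invariant under the rotation by $2\pi/m$ radians along the $\mathbf{S}^1$ fiber. -/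

import Mathlib

open Set Filter Topology MeasureTheory Bundle
open scoped Manifold ContDiff ENNReal

noncomputable section

/-- Double-well potentials. -/
structure IsDoubleWell (W : ℝ → ℝ) : Prop where
  smooth : ContDiff ℝ ∞ W
  nonneg : ∀ x, 0 ≤ W x
  eq_zero_iff : ∀ x, W x = 0 ↔ x = 1 ∨ x = -1
  even : ∀ x, W x = W (-x)
  deriv2_one_pos : 0 < iteratedDeriv 2 W 1
  deriv2_neg_one_pos : 0 < iteratedDeriv 2 W (-1)
  monotone : MonotoneOn (fun x => deriv W x / x) (Ioo 0 1)
  antitone : AntitoneOn (fun x => deriv W x / x) (Ioo (-1) 0)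

section Riemannian

variable (n : ℕ) {M : Type*} [TopologicalSpace M] [ChartedSpace (EuclideanSpace ℝ (Fin n)) M]
  [RiemannianBundle (fun x : M => TangentSpace (𝓡 n) x)]

/-- The differential of a real function, as a linear form on the tangent space. -/
def differential (f : M → ℝ) (x : M) : TangentSpace (𝓡 n) x →L[ℝ] ℝ :=
  mfderiv (𝓡 n) 𝓘(ℝ, ℝ) f x

/-- The squared Riemannian length of the gradient of `f` at `x`, that is, the square of the
operator norm of the differential of `f` at `x` with respect to the inner product of the tangent
space at `x`. -/
def gradNormSq (f : M → ℝ) (x : M) : ℝ := ‖differential n f x‖ ^ 2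

/-- The `i`-th coordinate vector field of the preferred chart at `c`, at the point with
coordinates `y`. -/
def coordVector (c : M) (y : EuclideanSpace ℝ (Fin n)) (i : Fin n) :
    TangentSpace (𝓡 n) ((extChartAt (𝓡 n) c).symm y) :=
  mfderiv 𝓘(ℝ, EuclideanSpace ℝ (Fin n)) (𝓡 n) (extChartAt (𝓡 n) c).symm y
    (EuclideanSpace.single i (1 : ℝ))

/-- The matrix `g_{ij}` of the metric in the preferred chart at `c`, at the coordinates `y`. -/
def metricMatrix (c : M) (y : EuclideanSpace ℝ (Fin n)) : Matrix (Fin n) (Fin n) ℝ :=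
  Matrix.of fun i j => inner ℝ (coordVector n c y i) (coordVector n c y j)

/-- The measure `√(det g_{ij}) dy` of the preferred chart at `c`, transported to `M`
(it is carried by the domain of that chart). -/
def chartVolume [MeasurableSpace M] (c : M) : Measure M :=
  ((volume.restrict (extChartAt (𝓡 n) c).target).withDensity
    (fun y => ENNReal.ofReal √(metricMatrix n c y).det)).map (extChartAt (𝓡 n) c).symm

/-- The Riemannian volume measure: the least measure that dominates the coordinate volume of each
chart, hence the one that agrees with it on the domain of each chart. -/
def riemannianVolume (M : Type*) [TopologicalSpace M] [MeasurableSpace M]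
    [ChartedSpace (EuclideanSpace ℝ (Fin n)) M]
    [RiemannianBundle (fun x : M => TangentSpace (𝓡 n) x)] : Measure M :=
  ⨆ c : M, chartVolume n c

end Riemannian

/-! The Riemannian product of the unit circle with `M`. -/

instance Circle.instMeasurableSpaceBorel : MeasurableSpace Circle := borel Circle

instance Circle.instBorelSpaceBorel : BorelSpace Circle := ⟨rfl⟩

/-- Arc length on the unit circle, of total mass `2π`. -/
def circleLength : Measure Circle :=
  (volume.restrict (Ioc (-Real.pi) Real.pi)).map Circle.exp

/-- The length of the shortest arc between two points of the unit circle. -/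
def circleDist (z w : Circle) : ℝ := |Complex.arg ((z / w : Circle) : ℂ)|

/-- The Riemannian distance of the product, `√(d_{S¹}² + d_M²)`. -/
def prodEDist {M : Type*} [EMetricSpace M] (p q : Circle × M) : ℝ≥0∞ :=
  (ENNReal.ofReal (circleDist p.1 q.1) ^ 2 + edist p.2 q.2 ^ 2) ^ (1 / 2 : ℝ)

/-- Hausdorff convergence of a sequence of subsets of the product to a subset. -/
def HausdorffTendsto {M : Type*} [EMetricSpace M] (A : ℕ → Set (Circle × M))
    (B : Set (Circle × M)) : Prop :=
  ∀ δ : ℝ≥0∞, 0 < δ → ∀ᶠ i in atTop,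
    (∀ p ∈ A i, ∃ q ∈ B, prodEDist p q < δ) ∧ (∀ q ∈ B, ∃ p ∈ A i, prodEDist p q < δ)

section Energy

variable (n : ℕ) {M : Type*} [EMetricSpace M] [MeasurableSpace M]
  [ChartedSpace (EuclideanSpace ℝ (Fin n)) M]
  [RiemannianBundle (fun x : M => TangentSpace (𝓡 n) x)]

/-- The squared length of the gradient for the product metric: the two factors are orthogonal. -/
def prodGradNormSq (u : Circle × M → ℝ) (p : Circle × M) : ℝ :=
  (deriv (fun t : ℝ => u (Circle.exp t * p.1, p.2)) 0) ^ 2 +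
    gradNormSq n (fun x => u (p.1, x)) p.2

/-- The energy `E_ε` of the van der Waals-Cahn-Hilliard theory on the product. -/
def energy (W : ℝ → ℝ) (ε : ℝ) (u : Circle × M → ℝ) : ℝ :=
  ∫ p, (1 / 2 * ε * prodGradNormSq n u p + ε⁻¹ * W (u p))
    ∂(circleLength.prod (riemannianVolume n M))

/-- `u` is a double-well phase transition with parameter `ε` on the product: a smooth function
with values in `[-1, 1]` that is a critical point of the energy. -/
structure IsPhaseTransition (W : ℝ → ℝ) (ε : ℝ) (u : Circle × M → ℝ) : Prop where
  smooth : ContMDiff ((𝓡 1).prod (𝓡 n)) 𝓘(ℝ, ℝ) ∞ u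
  mem_Icc : ∀ p, u p ∈ Icc (-1 : ℝ) 1
  critical : ∀ φ : Circle × M → ℝ, ContMDiff ((𝓡 1).prod (𝓡 n)) 𝓘(ℝ, ℝ) ∞ φ →
    HasDerivAt (fun t : ℝ => energy n W ε (fun p => u p + t * φ p)) 0 0

end Energy

/-- The union `{θ_1, …, θ_m} × M` of slices of the product. -/
def slices {m : ℕ} (θ : Fin m → Circle) (M : Type*) : Set (Circle × M) := range θ ×ˢ univ

end

/-!
The argument compares the solutions with one-dimensional ones, and needs neither elliptic
regularity nor the Euler-Lagrange equation in coordinates. Lift the circle to the line and write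
`u (exp t, x)`.

*Touching.* A function `g` of the angle alone that lies below a phase transition `u` on a slab
`[a, b] × K`, with `K` clopen in `M` and strictly so at the two ends, cannot touch it if
`W' (g) < ε² g''` wherever they meet (`IsPhaseTransition.not_touch`). One tests criticality with
`χ (u - g)`, for a nonincreasing cutoff `χ` supported near `(-∞, 0]`: the differential of this function
along `M` is a multiple of that of `u`, which gives a term of one sign, and the rest is an
integration by parts in the angle. The measure theory this takes is that the Riemannian volume is
finite and charges open sets.

*Comparison.* For each `μ ∈ (0, 1)` the equation `V'' = W' (V)` has an even solution with maximum
`μ`, positive on an interval `(-T, T)` and vanishing at its ends with slopes `±p`, where `p` grows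
with `μ` (`IsDoubleWell.exists_isProfile`). As `W' (x) / x` is monotone, multiples of `V` are sub-
and supersolutions, so a slightly stretched profile supported where `u > 0` stays below `u`
(`IsPhaseTransition.profile_le`) and a slightly shrunk one stays above `-u` on intervals with
`u ≥ 0` at the ends (`IsPhaseTransition.neg_le_profile`). Lower comparison shows that `|u|` tends to
`1` away from the nodal set. Both together bound the angular derivative of `u` at a zero: if the
interval to the left, with `u ≥ 0` at both ends, is shorter than an interval of positivity to the
right, the slope at their common end is at most that of one profile and at least that of a steeper
one, which is absurd (`IsPhaseTransition.exists_forall_slope_obstruction`; the two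
profiles come from `IsDoubleWell.exists_isProfile_pair`, by connectedness, so
that no monotonicity of the length in `μ` has to be known).

*Conclusion.* If `u` had the same sign on both sides of a limit slice, the interval around the last
zero near it would be very short, which contradicts the obstruction; so signs alternate
(`NodalSetNear.mul_neg`). Given alternation, a gap between limit angles cannot be followed by a
longer one (`NodalSetNear.false_of_gap_lt`). Going around the circle, all gaps are equal
(`IsSeparatedAngleSet.eq_progression`), the limit angles form a coset of the `m`-th roots of unity,
and `m` is even because the sign returns to itself after one turn.
-/

open Set Filter Topology MeasureTheory Bundle
open scoped Manifold ContDiff ENNReal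

noncomputable section

/-! ### The Riemannian measure is finite and charges open sets -/

section RiemannianVolume

variable {n : ℕ} {M : Type*} [TopologicalSpace M] [ChartedSpace (EuclideanSpace ℝ (Fin n)) M]

/-- The inner product of the tangent space at `x`, as a bilinear form on the model space, which is
definitionally the tangent space. In this form the point `x` can be rewritten. -/
def innerAt (n : ℕ) {M : Type*} [TopologicalSpace M] [ChartedSpace (EuclideanSpace ℝ (Fin n)) M]
    [RiemannianBundle (fun x : M => TangentSpace (𝓡 n) x)] (x : M) :
    LinearMap.BilinForm ℝ (EuclideanSpace ℝ (Fin n)) :=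
  innerₗ (TangentSpace (𝓡 n) x)

/-- The derivative of the inverse of the preferred chart at `c`, read in the model space. -/
def chartDeriv (n : ℕ) {M : Type*} [TopologicalSpace M] [ChartedSpace (EuclideanSpace ℝ (Fin n)) M]
    (c : M) (y : EuclideanSpace ℝ (Fin n)) :
    EuclideanSpace ℝ (Fin n) →L[ℝ] EuclideanSpace ℝ (Fin n) :=
  mfderiv 𝓘(ℝ, EuclideanSpace ℝ (Fin n)) (𝓡 n) (extChartAt (𝓡 n) c).symm y

/-- The density of the Riemannian volume in the preferred chart at `c`. -/
def volumeDensity (n : ℕ) {M : Type*} [TopologicalSpace M]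
    [ChartedSpace (EuclideanSpace ℝ (Fin n)) M]
    [RiemannianBundle (fun x : M => TangentSpace (𝓡 n) x)] (c : M)
    (y : EuclideanSpace ℝ (Fin n)) : ℝ := √(metricMatrix n c y).det

theorem metricMatrix_eq_toMatrix [RiemannianBundle (fun x : M => TangentSpace (𝓡 n) x)] (c : M)
    (y : EuclideanSpace ℝ (Fin n)) :
    metricMatrix n c y = LinearMap.BilinForm.toMatrix (EuclideanSpace.basisFun (Fin n) ℝ).toBasis
      ((innerAt n ((extChartAt (𝓡 n) c).symm y)).comp
        (chartDeriv n c y).toLinearMap (chartDeriv n c y).toLinearMap) := by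
  ext i j
  simp only [LinearMap.BilinForm.toMatrix_apply, LinearMap.BilinForm.comp_apply,
    OrthonormalBasis.coe_toBasis, EuclideanSpace.basisFun_apply]
  rfl

section

variable [RiemannianBundle (fun x : M => TangentSpace (𝓡 n) x)] [MeasurableSpace M] [BorelSpace M]

theorem chartVolume_apply (c : M) {s : Set M} (hs : MeasurableSet s) :
    chartVolume n c s = ∫⁻ y in (extChartAt (𝓡 n) c).symm ⁻¹' s ∩ (extChartAt (𝓡 n) c).target,
      ENNReal.ofReal (volumeDensity n c y) := by
  have ht : MeasurableSet (extChartAt (𝓡 n) c).target := (isOpen_extChartAt_target c).measurableSet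
  have hm : AEMeasurable (extChartAt (𝓡 n) c).symm
      ((volume.restrict (extChartAt (𝓡 n) c).target).withDensity
        (fun y => ENNReal.ofReal √(metricMatrix n c y).det)) :=
    ((continuousOn_extChartAt_symm c).aemeasurable ht).mono_ac
      (withDensity_absolutelyContinuous _ _)
  unfold chartVolume
  rw [Measure.map_apply_of_aemeasurable hm hs, withDensity_apply', Measure.restrict_restrict' ht]
  rfl

theorem chartVolume_inter_source (c : M) {s : Set M} (hs : MeasurableSet s) :
    chartVolume n c s = chartVolume n c (s ∩ (extChartAt (𝓡 n) c).source) := by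
  rw [chartVolume_apply c hs,
    chartVolume_apply c (hs.inter (isOpen_extChartAt_source c).measurableSet)]
  congr 2
  ext y
  constructor
  · exact fun h => ⟨⟨h.1, (extChartAt (𝓡 n) c).map_target h.2⟩, h.2⟩
  · exact fun h => ⟨h.1.1, h.2⟩

end

variable [IsManifold (𝓡 n) 1 M]

theorem chartDeriv_eq_comp {c k : M} {y : EuclideanSpace ℝ (Fin n)}
    (hy : y ∈ (extChartAt (𝓡 n) c).target)
    (hk : (extChartAt (𝓡 n) c).symm y ∈ (extChartAt (𝓡 n) k).source) :
    chartDeriv n c y = (chartDeriv n k (extChartAt (𝓡 n) k ((extChartAt (𝓡 n) c).symm y))).comp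
      (fderiv ℝ (extChartAt (𝓡 n) k ∘ (extChartAt (𝓡 n) c).symm) y) := by
  have h1 : MDifferentiableAt 𝓘(ℝ, EuclideanSpace ℝ (Fin n)) (𝓡 n)
      (extChartAt (𝓡 n) k).symm (extChartAt (𝓡 n) k ((extChartAt (𝓡 n) c).symm y)) := by
    have := mdifferentiableWithinAt_extChartAt_symm (I := 𝓡 n)
      ((extChartAt (𝓡 n) k).map_source hk)
    simpa [mdifferentiableWithinAt_univ] using this
  have h2 : MDifferentiableAt 𝓘(ℝ, EuclideanSpace ℝ (Fin n)) (𝓡 n)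
      (extChartAt (𝓡 n) c).symm y := by
    have := mdifferentiableWithinAt_extChartAt_symm (I := 𝓡 n) hy
    simpa [mdifferentiableWithinAt_univ] using this
  have h3 : MDifferentiableAt (𝓡 n) 𝓘(ℝ, EuclideanSpace ℝ (Fin n)) (extChartAt (𝓡 n) k)
      ((extChartAt (𝓡 n) c).symm y) :=
    mdifferentiableAt_extChartAt (by rwa [extChartAt_source] at hk)
  have h4 := mfderiv_comp y h1 (h3.comp y h2)
  have h5 : (extChartAt (𝓡 n) k).symm ∘ (extChartAt (𝓡 n) k ∘ (extChartAt (𝓡 n) c).symm)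
      =ᶠ[𝓝 y] (extChartAt (𝓡 n) c).symm := by
    have hc : ContinuousAt (extChartAt (𝓡 n) c).symm y := h2.continuousAt
    filter_upwards [hc ((isOpen_extChartAt_source k).mem_nhds hk)] with z hz
    exact (extChartAt (𝓡 n) k).left_inv hz
  rw [← mfderiv_eq_fderiv]
  exact h5.mfderiv_eq.symm.trans h4

theorem contDiffAt_coord_change {c k : M} {y : EuclideanSpace ℝ (Fin n)}
    (hy : y ∈ (extChartAt (𝓡 n) c).target)
    (hk : (extChartAt (𝓡 n) c).symm y ∈ (extChartAt (𝓡 n) k).source) :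
    ContDiffAt ℝ 1 (extChartAt (𝓡 n) k ∘ (extChartAt (𝓡 n) c).symm) y := by
  have := contDiffWithinAt_ext_coord_change (n := 1) (I := 𝓡 n) k c (y := y)
    (by simp only [PartialEquiv.trans_source, PartialEquiv.symm_source]; exact ⟨hy, hk⟩)
  simpa [contDiffWithinAt_univ] using this

theorem continuousOn_coordVector (c : M) (i : Fin n) :
    ContinuousOn (fun y => (⟨(extChartAt (𝓡 n) c).symm y, coordVector n c y i⟩ :
      TangentBundle (𝓡 n) M)) (extChartAt (𝓡 n) c).target := by
  set e := trivializationAt (EuclideanSpace ℝ (Fin n)) (TangentSpace (𝓡 n)) c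
  have h1 : ContinuousOn (fun y => e.toOpenPartialHomeomorph.symm
      ((extChartAt (𝓡 n) c).symm y, EuclideanSpace.single i (1 : ℝ)))
      (extChartAt (𝓡 n) c).target := by
    refine e.continuousOn_invFun.comp
      ((continuousOn_extChartAt_symm c).prodMk continuousOn_const) fun y hy => ?_
    rw [e.target_eq]
    refine ⟨?_, mem_univ _⟩
    have := (extChartAt (𝓡 n) c).map_target hy
    rw [extChartAt_source] at this
    simpa [e] using this
  refine h1.congr fun y hy => ?_
  have hs := (extChartAt (𝓡 n) c).map_target hy
  rw [extChartAt_source] at hs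
  have hb : (extChartAt (𝓡 n) c).symm y ∈ e.baseSet := by simpa [e] using hs
  have h2 := e.mk_symm hb (EuclideanSpace.single i (1 : ℝ))
  refine Eq.trans ?_ h2
  congr 1
  have h3 := TangentBundle.symmL_trivializationAt (I := 𝓡 n) (𝕜 := ℝ) hs
  have h4 := DFunLike.congr_fun h3 (EuclideanSpace.single i (1 : ℝ))
  rw [Trivialization.symmL_apply _ hb] at h4
  refine Eq.trans ?_ h4.symm
  rw [(extChartAt (𝓡 n) c).right_inv hy]
  simp only [ModelWithCorners.range_eq_univ, mfderivWithin_univ]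
  rfl

variable [RiemannianBundle (fun x : M => TangentSpace (𝓡 n) x)]

/-- The volume densities of two charts differ by the Jacobian of the change of coordinates. -/
theorem volumeDensity_eq_mul {c k : M} {y : EuclideanSpace ℝ (Fin n)}
    (hy : y ∈ (extChartAt (𝓡 n) c).target)
    (hk : (extChartAt (𝓡 n) c).symm y ∈ (extChartAt (𝓡 n) k).source) :
    volumeDensity n c y =
      |(fderiv ℝ (extChartAt (𝓡 n) k ∘ (extChartAt (𝓡 n) c).symm) y).det| *
        volumeDensity n k (extChartAt (𝓡 n) k ((extChartAt (𝓡 n) c).symm y)) := by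
  set A := fderiv ℝ (extChartAt (𝓡 n) k ∘ (extChartAt (𝓡 n) c).symm) y with hA
  set b := (EuclideanSpace.basisFun (Fin n) ℝ).toBasis
  have h : metricMatrix n c y = (LinearMap.toMatrix b b A.toLinearMap).transpose *
      metricMatrix n k (extChartAt (𝓡 n) k ((extChartAt (𝓡 n) c).symm y)) *
      LinearMap.toMatrix b b A.toLinearMap := by
    rw [metricMatrix_eq_toMatrix, metricMatrix_eq_toMatrix, ← LinearMap.BilinForm.toMatrix_comp,
      chartDeriv_eq_comp hy hk, (extChartAt (𝓡 n) k).left_inv hk]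
    rfl
  unfold volumeDensity
  rw [h, Matrix.det_mul, Matrix.det_mul, Matrix.det_transpose, LinearMap.det_toMatrix]
  rw [mul_right_comm, Real.sqrt_mul (mul_self_nonneg _), Real.sqrt_mul_self_eq_abs]

theorem metricMatrix_posDef {c : M} {y : EuclideanSpace ℝ (Fin n)}
    (hy : y ∈ (extChartAt (𝓡 n) c).target) : (metricMatrix n c y).PosDef := by
  have h : metricMatrix n c y = Matrix.gram ℝ (coordVector n c y) := rfl
  rw [h, Matrix.posDef_gram_iff_linearIndependent]
  have h1 : (mfderiv 𝓘(ℝ, EuclideanSpace ℝ (Fin n)) (𝓡 n)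
      (extChartAt (𝓡 n) c).symm y).IsInvertible := by
    have := isInvertible_mfderivWithin_extChartAt_symm (I := 𝓡 n) hy
    simpa [mfderivWithin_univ] using this
  have h2 : LinearIndependent ℝ fun i => (EuclideanSpace.single i (1 : ℝ) :
      EuclideanSpace ℝ (Fin n)) := by
    have h3 := (EuclideanSpace.basisFun (Fin n) ℝ).orthonormal.linearIndependent
    rwa [funext (EuclideanSpace.basisFun_apply (Fin n) ℝ)] at h3
  exact h2.map' (mfderiv 𝓘(ℝ, EuclideanSpace ℝ (Fin n)) (𝓡 n)
      (extChartAt (𝓡 n) c).symm y).toLinearMap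
    (LinearMap.ker_eq_bot.2 h1.injective)

theorem volumeDensity_pos {c : M} {y : EuclideanSpace ℝ (Fin n)}
    (hy : y ∈ (extChartAt (𝓡 n) c).target) : 0 < volumeDensity n c y :=
  Real.sqrt_pos.2 (metricMatrix_posDef hy).det_pos

/-- The coordinate volumes of two charts agree where both charts are defined, by the change of
variables formula. -/
theorem chartVolume_eq_of_subset [MeasurableSpace M] [BorelSpace M] (c k : M) {s : Set M}
    (hs : MeasurableSet s) (hc : s ⊆ (extChartAt (𝓡 n) c).source)
    (hk : s ⊆ (extChartAt (𝓡 n) k).source) :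
    chartVolume n c s = chartVolume n k s := by
  set f := extChartAt (𝓡 n) k ∘ (extChartAt (𝓡 n) c).symm with hf
  set A := (extChartAt (𝓡 n) c).symm ⁻¹' s ∩ (extChartAt (𝓡 n) c).target with hA
  have hAm : MeasurableSet A := by
    classical
    have := (continuousOn_extChartAt_symm (I := 𝓡 n) c).measurable_piecewise
      (g := fun _ => c) continuousOn_const (isOpen_extChartAt_target c).measurableSet
    convert (this hs).inter (isOpen_extChartAt_target (I := 𝓡 n) c).measurableSet using 1
    ext y
    simp only [hA, mem_inter_iff, mem_preimage]
    exact and_congr_left fun h => by rw [piecewise_eq_of_mem _ _ _ h]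
  have himage : f '' A = (extChartAt (𝓡 n) k).symm ⁻¹' s ∩ (extChartAt (𝓡 n) k).target := by
    ext z
    constructor
    · rintro ⟨y, ⟨hy, hyt⟩, rfl⟩
      have h1 : (extChartAt (𝓡 n) c).symm y ∈ (extChartAt (𝓡 n) k).source := hk hy
      refine ⟨?_, (extChartAt (𝓡 n) k).map_source h1⟩
      simp only [hf, Function.comp_apply, mem_preimage, (extChartAt (𝓡 n) k).left_inv h1]
      exact hy
    · rintro ⟨hz, hzt⟩
      have h1 : (extChartAt (𝓡 n) k).symm z ∈ (extChartAt (𝓡 n) c).source := hc hz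
      refine ⟨extChartAt (𝓡 n) c ((extChartAt (𝓡 n) k).symm z),
        ⟨?_, (extChartAt (𝓡 n) c).map_source h1⟩, ?_⟩
      · simp only [mem_preimage, (extChartAt (𝓡 n) c).left_inv h1]
        exact hz
      · simp only [hf, Function.comp_apply, (extChartAt (𝓡 n) c).left_inv h1,
          (extChartAt (𝓡 n) k).right_inv hzt]
  have hinj : InjOn f A := by
    intro y hy z hz h
    have h1 := (extChartAt (𝓡 n) k).injOn (hk hy.1) (hk hz.1) h
    exact (extChartAt (𝓡 n) c).symm.injOn hy.2 hz.2 h1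
  rw [chartVolume_apply c hs, chartVolume_apply k hs, ← himage,
    lintegral_image_eq_lintegral_abs_det_fderiv_mul volume hAm
      (fun y hy => ((contDiffAt_coord_change hy.2 (hk hy.1)).differentiableAt
        one_ne_zero).hasFDerivAt.hasFDerivWithinAt) hinj]
  refine setLIntegral_congr_fun hAm fun y hy => ?_
  rw [volumeDensity_eq_mul hy.2 (hk hy.1), ENNReal.ofReal_mul (abs_nonneg _)]
  rfl

variable [IsContinuousRiemannianBundle (EuclideanSpace ℝ (Fin n))
  (fun x : M => TangentSpace (𝓡 n) x)]

theorem continuousOn_volumeDensity (c : M) :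
    ContinuousOn (volumeDensity n c) (extChartAt (𝓡 n) c).target := by
  refine Real.continuous_sqrt.comp_continuousOn ?_
  have : ContinuousOn (metricMatrix n c) (extChartAt (𝓡 n) c).target := by
    refine continuousOn_pi.2 fun i => continuousOn_pi.2 fun j => ?_
    exact (continuousOn_coordVector c i).inner_bundle (F := EuclideanSpace ℝ (Fin n))
      (E := fun x : M => TangentSpace (𝓡 n) x) (continuousOn_coordVector c j)
  exact Continuous.comp_continuousOn (Continuous.matrix_det continuous_id) this

variable [MeasurableSpace M] [BorelSpace M]

theorem exists_isOpen_chartVolume_lt_top (k : M) :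
    ∃ U : Set M, IsOpen U ∧ k ∈ U ∧ U ⊆ (extChartAt (𝓡 n) k).source ∧ chartVolume n k U < ⊤ := by
  set e := extChartAt (𝓡 n) k with he
  have hke : e k ∈ e.target := mem_extChartAt_target k
  have hc : ContinuousAt (volumeDensity n k) (e k) :=
    (continuousOn_volumeDensity k).continuousAt ((isOpen_extChartAt_target k).mem_nhds hke)
  have hev : ∀ᶠ y in 𝓝 (e k), volumeDensity n k y < volumeDensity n k (e k) + 1 ∧
      y ∈ Metric.ball (e k) 1 :=
    (hc.eventually_lt continuousAt_const (by linarith)).and (Metric.ball_mem_nhds _ one_pos)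
  obtain ⟨V, hV, hVo, hkV⟩ := eventually_nhds_iff.1 hev
  have hUo : IsOpen (e.source ∩ e ⁻¹' V) :=
    (continuousOn_extChartAt (I := 𝓡 n) k).isOpen_inter_preimage (isOpen_extChartAt_source k) hVo
  refine ⟨e.source ∩ e ⁻¹' V, hUo, ⟨mem_extChartAt_source k, hkV⟩, inter_subset_left, ?_⟩
  rw [chartVolume_apply k hUo.measurableSet]
  calc _ ≤ ∫⁻ y in Metric.ball (e k) 1, ENNReal.ofReal (volumeDensity n k (e k) + 1) := by
        refine (setLIntegral_mono' ?_ ?_).trans (lintegral_mono_set (s := e.symm ⁻¹'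
          (e.source ∩ e ⁻¹' V) ∩ e.target) ?_)
        · have := (continuousOn_extChartAt_symm (I := 𝓡 n) k).isOpen_inter_preimage
            (isOpen_extChartAt_target k) hUo
          rw [inter_comm] at this
          exact this.measurableSet
        · rintro y ⟨⟨_, hy⟩, hyt⟩
          rw [mem_preimage, e.right_inv hyt] at hy
          exact ENNReal.ofReal_le_ofReal (hV y hy).1.le
        · rintro y ⟨⟨_, hy⟩, hyt⟩
          rw [mem_preimage, e.right_inv hyt] at hy
          exact (hV y hy).2
    _ < ⊤ := by
        rw [setLIntegral_const]
        exact ENNReal.mul_lt_top ENNReal.ofReal_lt_top measure_ball_lt_top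

instance riemannianVolume.instIsFiniteMeasure [CompactSpace M] :
    IsFiniteMeasure (riemannianVolume n M) := by
  choose U hUo hkU hUs hU using exists_isOpen_chartVolume_lt_top (n := n) (M := M)
  obtain ⟨t, ht⟩ := isCompact_univ.elim_finite_subcover U hUo
    fun x _ => mem_iUnion.2 ⟨x, hkU x⟩
  set ν : Measure M := ∑ k ∈ t, (chartVolume n k).restrict (U k) with hν
  have hle : riemannianVolume n M ≤ ν := by
    refine iSup_le fun c => Measure.le_iff.2 fun s hs => ?_
    have hcover : s ⊆ ⋃ k ∈ t, s ∩ U k := by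
      intro x hx
      obtain ⟨k, hk⟩ := mem_iUnion.1 (ht (mem_univ x))
      obtain ⟨hkt, hxk⟩ := mem_iUnion.1 hk
      exact mem_iUnion₂.2 ⟨k, hkt, hx, hxk⟩
    calc chartVolume n c s ≤ chartVolume n c (⋃ k ∈ t, s ∩ U k) := measure_mono hcover
      _ ≤ ∑ k ∈ t, chartVolume n c (s ∩ U k) := measure_biUnion_finset_le _ _
      _ ≤ ∑ k ∈ t, chartVolume n k (s ∩ U k) := by
          refine Finset.sum_le_sum fun k _ => ?_
          have hm := hs.inter (hUo k).measurableSet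
          rw [chartVolume_inter_source c hm, chartVolume_eq_of_subset c k
            (hm.inter (isOpen_extChartAt_source c).measurableSet) inter_subset_right
            fun x hx => hUs k hx.1.2]
          exact measure_mono inter_subset_left
      _ = ν s := by
          rw [hν, Measure.finsetSum_apply]
          exact Finset.sum_congr rfl fun k _ => (Measure.restrict_apply hs).symm
  refine ⟨(hle univ).trans_lt ?_⟩
  rw [hν, Measure.finsetSum_apply]
  refine ENNReal.sum_lt_top.2 fun k _ => ?_
  rw [Measure.restrict_apply_univ]
  exact hU k

instance riemannianVolume.instIsOpenPosMeasure :
    (riemannianVolume n M).IsOpenPosMeasure := by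
  refine ⟨fun O hO ⟨c, hc⟩ => ?_⟩
  set e := extChartAt (𝓡 n) c with he
  have hle : chartVolume n c O ≤ riemannianVolume n M O :=
    (le_iSup (fun c : M => chartVolume n c) c) O
  refine ((pos_iff_ne_zero.2 ?_).trans_le hle).ne'
  rw [chartVolume_apply c hO.measurableSet, inter_comm]
  have hop : IsOpen (e.target ∩ e.symm ⁻¹' O) :=
    (continuousOn_extChartAt_symm (I := 𝓡 n) c).isOpen_inter_preimage
      (isOpen_extChartAt_target c) hO
  have hm : AEMeasurable (fun y => ENNReal.ofReal (volumeDensity n c y))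
      (volume.restrict (e.target ∩ e.symm ⁻¹' O)) :=
    (((continuousOn_volumeDensity c).mono inter_subset_left).aemeasurable
      hop.measurableSet).ennreal_ofReal
  rw [Ne, lintegral_eq_zero_iff' hm]
  intro h
  have h1 := (ae_restrict_iff' hop.measurableSet).1 h
  refine (hop.measure_pos volume ⟨e c, mem_extChartAt_target c, ?_⟩).ne'
    (measure_mono_null (fun y hy => ?_) h1)
  · rw [mem_preimage, he, extChartAt_to_inv]
    exact hc
  · exact fun h2 => (ENNReal.ofReal_pos.2 (volumeDensity_pos hy.1)).ne' (h2 hy)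

end RiemannianVolume

/-! ### The angular derivative and the continuity of the gradient -/

section DualNorm

variable {B F T : Type*} [TopologicalSpace B] [TopologicalSpace T] [NormedAddCommGroup F]
  [NormedSpace ℝ F] {E : B → Type*} [TopologicalSpace (TotalSpace F E)]
  [∀ x, NormedAddCommGroup (E x)] [∀ x, InnerProductSpace ℝ (E x)]
  [FiberBundle F E] [VectorBundle ℝ F E] [IsContinuousRiemannianBundle F E]

/-- The dual norm of a family of linear forms on the fibres of a Riemannian bundle is continuous
if the family is continuous in a local trivialization. -/
theorem continuousAt_norm_dual {b : T → B} {L : ∀ t, E (b t) →L[ℝ] ℝ} {t₀ : T}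
    (hb : ContinuousAt b t₀)
    (hL : ContinuousAt (fun t => (L t).comp ((trivializationAt F E (b t₀)).symmL ℝ (b t))) t₀) :
    ContinuousAt (fun t => ‖L t‖) t₀ := by
  set e := trivializationAt F E (b t₀) with he
  have hmem : b t₀ ∈ e.baseSet := mem_baseSet_trivializationAt F E (b t₀)
  obtain ⟨K, hK, hKev⟩ := eventually_norm_trivializationAt_lt F E (b t₀)
  rw [Metric.continuousAt_iff']
  intro ε hε
  set a := ‖L t₀‖ with ha
  have ha0 : 0 ≤ a := norm_nonneg _
  set η := min 1 (ε / (4 * (a + 1))) with hη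
  have hη0 : 0 < η := lt_min one_pos (by positivity)
  have hη1 : η ≤ 1 := min_le_left _ _
  have haη : a * η ≤ ε / 4 := by
    have h1 : η ≤ ε / (4 * (a + 1)) := min_le_right _ _
    have h2 : η * (4 * (a + 1)) ≤ ε := by rwa [le_div_iff₀ (by positivity)] at h1
    nlinarith
  have h1 := hb (eventually_norm_symmL_trivializationAt_self_comp_lt F E (b t₀)
    (show (1 : ℝ) < 1 + η by linarith))
  have h2 := hb (eventually_norm_symmL_trivializationAt_comp_self_lt F E (b t₀)
    (show (1 : ℝ) < 1 + η by linarith))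
  have h3 := Metric.continuousAt_iff'.1 hL (ε / (6 * (K + 1))) (by positivity)
  filter_upwards [h1, h2, h3, hb hKev, hb (e.open_baseSet.mem_nhds hmem)] with t h1 h2 h3 h4 h5
  simp only [mem_preimage, mem_ofPred_eq] at h1 h2 h4 h5
  set S := e.symmL ℝ (b t)
  set C := e.continuousLinearMapAt ℝ (b t)
  set S₀ := e.symmL ℝ (b t₀)
  set C₀ := e.continuousLinearMapAt ℝ (b t₀)
  have hSC : ∀ v, S (C v) = v := fun v => e.symmL_continuousLinearMapAt h5 v
  have hSC₀ : ∀ v, S₀ (C₀ v) = v := fun v => e.symmL_continuousLinearMapAt hmem v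
  have hCS : ∀ v, C (S v) = v := fun v => e.continuousLinearMapAt_symmL h5 v
  set D := (L t).comp S
  set D₀ := (L t₀).comp S₀
  have hd : ‖D - D₀‖ * K ≤ ε / 6 := by
    rw [dist_eq_norm] at h3
    calc ‖D - D₀‖ * K ≤ ε / (6 * (K + 1)) * K := by gcongr
      _ ≤ ε / 6 := by
        rw [div_mul_eq_mul_div, div_le_div_iff₀ (by positivity) (by positivity)]
        nlinarith
  have hdC : ‖(D - D₀).comp C‖ ≤ ε / 6 :=
    ((D - D₀).opNorm_comp_le C).trans ((mul_le_mul_of_nonneg_left h4.le (norm_nonneg _)).trans hd)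
  have hLt : L t = (D - D₀).comp C + (L t₀).comp (S₀.comp C) := by
    ext v
    simp [D, D₀, hSC]
  have hL0 : L t₀ = (L t - (D - D₀).comp C).comp (S.comp C₀) := by
    ext v
    simp [D, D₀, hSC₀, hCS]
  have hup : ‖L t‖ ≤ ε / 6 + a * (1 + η) := by
    rw [hLt]
    refine (norm_add_le _ _).trans (add_le_add hdC ?_)
    exact ((L t₀).opNorm_comp_le _).trans (mul_le_mul_of_nonneg_left h1.le ha0)
  have hlow : a ≤ (‖L t‖ + ε / 6) * (1 + η) := by
    rw [ha, hL0]
    refine (ContinuousLinearMap.opNorm_comp_le _ _).trans ?_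
    have h6 : ‖L t - (D - D₀).comp C‖ ≤ ‖L t‖ + ε / 6 :=
      (norm_sub_le _ _).trans (add_le_add le_rfl hdC)
    exact mul_le_mul h6 h2.le (norm_nonneg _) (by positivity)
  rw [Real.dist_eq, abs_lt]
  constructor <;> nlinarith [norm_nonneg (L t)]

end DualNorm

section Circle

theorem circleLength_integral (f : Circle → ℝ) (hf : Continuous f) :
    ∫ z, f z ∂circleLength = ∫ t in (-Real.pi)..Real.pi, f (Circle.exp t) := by
  rw [circleLength, integral_map Circle.exp.continuous.aemeasurable
    hf.aestronglyMeasurable, intervalIntegral.integral_of_le (by linarith [Real.pi_pos])]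

instance circleLength.instIsFiniteMeasure : IsFiniteMeasure circleLength := by
  unfold circleLength
  infer_instance

instance circleLength.instIsOpenPosMeasure : circleLength.IsOpenPosMeasure := by
  refine ⟨fun U hU ⟨z, hz⟩ => ?_⟩
  rw [circleLength, Measure.map_apply Circle.exp.continuous.measurable hU.measurableSet,
    Measure.restrict_apply' measurableSet_Ioc]
  have hU' : IsOpen (Circle.exp ⁻¹' U) := hU.preimage Circle.exp.continuous
  have hmem : Complex.arg z ∈ closure (Ioo (-Real.pi) Real.pi) := by
    rw [closure_Ioo (by linarith [Real.pi_pos])]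
    exact ⟨(Complex.neg_pi_lt_arg _).le, Complex.arg_le_pi _⟩
  have hz' : Complex.arg z ∈ Circle.exp ⁻¹' U := by simpa using hz
  have hne := mem_closure_iff.1 hmem _ hU' hz'
  exact ((hU'.inter isOpen_Ioo).measure_pos volume hne |>.trans_le
    (measure_mono (inter_subset_inter_right _ Ioo_subset_Ioc_self))).ne'

end Circle

section Product

variable {n : ℕ} {M : Type*} [TopologicalSpace M] [ChartedSpace (EuclideanSpace ℝ (Fin n)) M]

/-- The derivative of a function on `S¹ × M` along the unit rotation field of the circle. -/
def angDeriv (F : Circle × M → ℝ) (p : Circle × M) : ℝ :=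
  deriv (fun t : ℝ => F (Circle.exp t * p.1, p.2)) 0

theorem contMDiff_rotate {F : Circle × M → ℝ}
    (hF : ContMDiff ((𝓡 1).prod (𝓡 n)) 𝓘(ℝ, ℝ) ∞ F) :
    ContMDiff (((𝓡 1).prod (𝓡 n)).prod 𝓘(ℝ, ℝ)) 𝓘(ℝ, ℝ) ∞
      (fun q : (Circle × M) × ℝ => F (Circle.exp q.2 * q.1.1, q.1.2)) := by
  refine hF.comp (ContMDiff.prodMk ?_ (contMDiff_snd.comp contMDiff_fst))
  exact (contMDiff_circleExp.comp contMDiff_snd).mul (contMDiff_fst.comp contMDiff_fst)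

theorem hasDerivAt_angDeriv {F : Circle × M → ℝ}
    (hF : ContMDiff ((𝓡 1).prod (𝓡 n)) 𝓘(ℝ, ℝ) ∞ F) (t : ℝ) (x : M) :
    HasDerivAt (fun s : ℝ => F (Circle.exp s, x)) (angDeriv F (Circle.exp t, x)) t := by
  have h1 : ContDiff ℝ ∞ (fun s : ℝ => F (Circle.exp s, x)) := by
    rw [← contMDiff_iff_contDiff]
    exact hF.comp (contMDiff_circleExp.prodMk contMDiff_const)
  have h2 := (h1.differentiable (by simp) t).hasDerivAt
  have h3 : angDeriv F (Circle.exp t, x) = deriv (fun s : ℝ => F (Circle.exp s, x)) t := by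
    unfold angDeriv
    simp only [← Circle.exp_add]
    rw [deriv_comp_add_const (f := fun s : ℝ => F (Circle.exp s, x)), zero_add]
  rwa [h3]

theorem continuous_angDeriv {F : Circle × M → ℝ} [IsManifold (𝓡 n) 1 M]
    (hF : ContMDiff ((𝓡 1).prod (𝓡 n)) 𝓘(ℝ, ℝ) ∞ F) : Continuous (angDeriv F) := by
  rw [continuous_iff_continuousAt]
  intro p
  have h := ContMDiffAt.mfderiv (n := ∞) (m := 0)
    (fun (q : Circle × M) (t : ℝ) => F (Circle.exp t * q.1, q.2)) (fun _ => (0 : ℝ))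
    (x₀ := p) (contMDiff_rotate hF).contMDiffAt contMDiffAt_const (by simp)
  set D : Circle × M → ℝ →L[ℝ] ℝ := fun q =>
    fderiv ℝ (fun t : ℝ => F (Circle.exp t * q.1, q.2)) 0
  have h1 : ContinuousAt D p := by
    have e := inTangentCoordinates_model_space (I := 𝓘(ℝ, ℝ)) (I' := 𝓘(ℝ, ℝ))
      (fun _ : Circle × M => (0 : ℝ)) (fun q => F (Circle.exp 0 * q.1, q.2)) D p
    rw [← e]
    simp only [mfderiv_eq_fderiv] at h
    exact h.continuousAt
  have h2 := h1.clm_apply (continuousAt_const (y := (1 : ℝ)))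
  refine h2.congr (Eventually.of_forall fun q => ?_)
  exact fderiv_apply_one_eq_deriv

variable [IsManifold (𝓡 n) 1 M] [RiemannianBundle (fun x : M => TangentSpace (𝓡 n) x)]
  [IsContinuousRiemannianBundle (EuclideanSpace ℝ (Fin n)) (fun x : M => TangentSpace (𝓡 n) x)]

theorem continuous_gradNormSq_slice {F : Circle × M → ℝ}
    (hF : ContMDiff ((𝓡 1).prod (𝓡 n)) 𝓘(ℝ, ℝ) ∞ F) :
    Continuous fun p : Circle × M => gradNormSq n (fun x => F (p.1, x)) p.2 := by
  unfold gradNormSq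
  refine Continuous.pow ?_ 2
  rw [continuous_iff_continuousAt]
  intro p
  refine continuousAt_norm_dual (F := EuclideanSpace ℝ (Fin n))
    (E := fun x : M => TangentSpace (𝓡 n) x) (b := Prod.snd) continuousAt_snd ?_
  have h := ContMDiffAt.mfderiv (n := ∞) (m := 0)
    (fun (q : Circle × M) (x : M) => F (q.1, x)) Prod.snd (x₀ := p)
    (hF.comp ((contMDiff_fst.comp contMDiff_fst).prodMk contMDiff_snd)).contMDiffAt
    (contMDiffAt_snd (I := 𝓡 1) (J := 𝓡 n)) (by simp)
  refine h.continuousAt.congr ?_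
  have hs : Prod.snd ⁻¹' (chartAt (EuclideanSpace ℝ (Fin n)) p.2).source ∈ 𝓝 p :=
    continuousAt_snd (chart_source_mem_nhds _ _)
  filter_upwards [hs] with q hq
  have hq' : F (q.1, q.2) ∈ (chartAt ℝ (F (p.1, p.2))).source := by
    rw [chartAt_self_eq]
    exact mem_univ _
  rw [inTangentCoordinates_eq_mfderiv_comp hq hq', TangentBundle.symmL_trivializationAt hq]
  have hid : mfderiv 𝓘(ℝ, ℝ) 𝓘(ℝ, ℝ) (extChartAt 𝓘(ℝ, ℝ) (F (p.1, p.2))) (F (q.1, q.2)) =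
      ContinuousLinearMap.id ℝ ℝ := by
    rw [extChartAt_model_space_eq_id]
    exact mfderiv_id
  exact congrArg (fun A : ℝ →L[ℝ] ℝ => A.comp ((differential n (fun x => F (q.1, x)) q.2).comp
    (mfderivWithin 𝓘(ℝ, EuclideanSpace ℝ (Fin n)) (𝓡 n) (extChartAt (𝓡 n) p.2).symm
      (range (𝓡 n)) (extChartAt (𝓡 n) p.2 q.2)))) hid

end Product

/-! ### Extension of functions from a slab of the product -/

section Branch

/-- The branch of the angle on the unit circle with values in `(c - π, c + π]`. -/
def angleBranch (c : ℝ) (z : Circle) : ℝ := c + Complex.arg ((z * Circle.exp (-c) : Circle) : ℂ)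

theorem exp_angleBranch (c : ℝ) (z : Circle) : Circle.exp (angleBranch c z) = z := by
  rw [angleBranch, Circle.exp_add, Circle.exp_arg, mul_comm, mul_assoc, ← Circle.exp_add]
  simp

theorem angleBranch_exp {c t : ℝ} (h₁ : c - Real.pi < t) (h₂ : t ≤ c + Real.pi) :
    angleBranch c (Circle.exp t) = t := by
  rw [angleBranch, ← Circle.exp_add, Circle.arg_exp (by linarith) (by linarith)]
  ring

theorem contMDiffAt_angleBranch {c t : ℝ} (h₁ : c - Real.pi < t) (h₂ : t < c + Real.pi) :
    ContMDiffAt (𝓡 1) 𝓘(ℝ, ℝ) ∞ (angleBranch c) (Circle.exp t) := by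
  have : Fact (Module.finrank ℝ ℂ = 1 + 1) := finrank_real_complex_fact'
  have hcoe : ContMDiff (𝓡 1) 𝓘(ℝ, ℂ) ∞ (fun z : Circle => (z : ℂ)) := contMDiff_coe_sphere
  have hmul : ContMDiff (𝓡 1) 𝓘(ℝ, ℂ) ∞
      (fun z : Circle => ((z * Circle.exp (-c) : Circle) : ℂ)) := by
    have : ContMDiff (𝓡 1) (𝓡 1) ∞ (fun z : Circle => z * Circle.exp (-c)) :=
      contMDiff_id.mul contMDiff_const
    exact hcoe.comp this
  have harg : Complex.arg ((Circle.exp t * Circle.exp (-c) : Circle) : ℂ) = t - c := by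
    rw [← Circle.exp_add, Circle.arg_exp (by linarith) (by linarith)]
    ring
  have hslit : ((Circle.exp t * Circle.exp (-c) : Circle) : ℂ) ∈ Complex.slitPlane := by
    rw [Complex.mem_slitPlane_iff_arg, harg]
    exact ⟨by linarith, Circle.coe_ne_zero _⟩
  have hlog : ContDiffAt ℝ ∞ (fun w : ℂ => c + (Complex.log w).im)
      ((Circle.exp t * Circle.exp (-c) : Circle) : ℂ) :=
    contDiffAt_const.add (Complex.imCLM.contDiff.contDiffAt.comp _
      ((Complex.contDiffAt_log hslit).restrict_scalars ℝ))
  have h := ContMDiffAt.comp (I' := 𝓘(ℝ, ℂ)) (g := fun w : ℂ => c + (Complex.log w).im)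
    (Circle.exp t) hlog.contMDiffAt hmul.contMDiffAt
  exact h.congr_of_eventuallyEq (Eventually.of_forall fun z => by
    simp [angleBranch, Complex.log_im])

end Branch

section SlabExtension

variable {n : ℕ} {M : Type*}

open Classical in
/-- The function on `S¹ × M` that is given by `Φ` in the angle coordinate over the slab
`[a, b] × K` and vanishes elsewhere. It is meant for slabs of angular width less than `2π`. -/
def slabExtension (a b : ℝ) (K : Set M) (Φ : ℝ × M → ℝ) (p : Circle × M) : ℝ :=
  if p.1 ∈ Circle.exp '' Icc a b ∧ p.2 ∈ K then Φ (angleBranch ((a + b) / 2) p.1, p.2) else 0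

variable {a b : ℝ} {K : Set M} {Φ : ℝ × M → ℝ}

theorem slabExtension_exp (hab : b - a < 2 * Real.pi) {t : ℝ} (ht : t ∈ Icc a b) {x : M}
    (hx : x ∈ K) : slabExtension a b K Φ (Circle.exp t, x) = Φ (t, x) := by
  rw [slabExtension, if_pos ⟨mem_image_of_mem _ ht, hx⟩,
    angleBranch_exp (by linarith [ht.1, ht.2]) (by linarith [ht.1, ht.2])]

variable [TopologicalSpace M]

theorem slabExtension_eventuallyEq (hab : b - a < 2 * Real.pi) (hK : IsClopen K) {t : ℝ}
    (ht : t ∈ Ioo a b) {x : M} (hx : x ∈ K) :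
    slabExtension a b K Φ =ᶠ[𝓝 (Circle.exp t, x)]
      fun p => Φ (angleBranch ((a + b) / 2) p.1, p.2) := by
  have h1 : ContinuousAt (angleBranch ((a + b) / 2)) (Circle.exp t) :=
    (contMDiffAt_angleBranch (by linarith [ht.1, ht.2]) (by linarith [ht.1, ht.2])).continuousAt
  have h2 : angleBranch ((a + b) / 2) (Circle.exp t) = t :=
    angleBranch_exp (by linarith [ht.1, ht.2]) (by linarith [ht.1, ht.2])
  have h3 : ∀ᶠ z in 𝓝 (Circle.exp t), angleBranch ((a + b) / 2) z ∈ Ioo a b :=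
    h1 (by rw [h2]; exact Ioo_mem_nhds ht.1 ht.2)
  filter_upwards [h3.prod_inl_nhds x, (hK.isOpen.eventually_mem hx).prod_inr_nhds (Circle.exp t)]
    with p hp hpK
  exact if_pos ⟨⟨_, Ioo_subset_Icc_self hp, exp_angleBranch _ _⟩, hpK⟩

/-- Each point lies in the open slab, or near it all extensions of functions vanishing near both
ends of the slab are zero. -/
theorem mem_slab_or_slabExtension_eventuallyEq_zero (hab : b - a < 2 * Real.pi) (hK : IsClopen K)
    (p : Circle × M) :
    (∃ t ∈ Ioo a b, ∃ x ∈ K, p = (Circle.exp t, x)) ∨ ∀ Φ : ℝ × M → ℝ,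
      (∀ x ∈ K, ∀ᶠ q in 𝓝 (a, x), Φ q = 0) → (∀ x ∈ K, ∀ᶠ q in 𝓝 (b, x), Φ q = 0) →
      slabExtension a b K Φ =ᶠ[𝓝 p] 0 := by
  obtain ⟨z, x⟩ := p
  by_cases hx : x ∈ K
  swap
  · refine Or.inr fun Φ _ _ => ?_
    filter_upwards [(hK.compl.isOpen.eventually_mem hx).prod_inr_nhds z] with p hp
    exact if_neg fun h => hp h.2
  by_cases hz : z ∈ Circle.exp '' Icc a b
  swap
  · refine Or.inr fun Φ _ _ => ?_
    have hcl : IsClosed (Circle.exp '' Icc a b) :=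
      (isCompact_Icc.image Circle.exp.continuous).isClosed
    filter_upwards [(hcl.isOpen_compl.eventually_mem hz).prod_inl_nhds x] with p hp
    exact if_neg fun h => hp h.1
  obtain ⟨t, ht, rfl⟩ := hz
  by_cases htab : t ∈ Ioo a b
  · exact Or.inl ⟨t, htab, x, hx, rfl⟩
  refine Or.inr fun Φ ha hb => ?_
  have h0 : ∀ᶠ q in 𝓝 (t, x), Φ q = 0 := by
    rcases eq_or_lt_of_le ht.1 with h | h
    · exact h ▸ ha x hx
    · rcases eq_or_lt_of_le ht.2 with h' | h'
      · exact h' ▸ hb x hx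
      · exact absurd ⟨h, h'⟩ htab
  have h1 : ContinuousAt (angleBranch ((a + b) / 2)) (Circle.exp t) :=
    (contMDiffAt_angleBranch (by linarith [ht.1, ht.2]) (by linarith [ht.1, ht.2])).continuousAt
  have h2 : angleBranch ((a + b) / 2) (Circle.exp t) = t :=
    angleBranch_exp (by linarith [ht.1, ht.2]) (by linarith [ht.1, ht.2])
  have h3 : Tendsto (fun p : Circle × M => (angleBranch ((a + b) / 2) p.1, p.2))
      (𝓝 (Circle.exp t, x)) (𝓝 (t, x)) := by
    rw [nhds_prod_eq, nhds_prod_eq]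
    refine Tendsto.prodMap ?_ tendsto_id
    have := h1.tendsto
    rwa [h2] at this
  filter_upwards [h3.eventually h0] with p hp
  unfold slabExtension
  split_ifs
  · exact hp
  · rfl

theorem contMDiff_slabExtension [ChartedSpace (EuclideanSpace ℝ (Fin n)) M]
    (hab : b - a < 2 * Real.pi) (hK : IsClopen K)
    (hΦ : ContMDiff (𝓘(ℝ, ℝ).prod (𝓡 n)) 𝓘(ℝ, ℝ) ∞ Φ)
    (ha : ∀ x ∈ K, ∀ᶠ q in 𝓝 (a, x), Φ q = 0) (hb : ∀ x ∈ K, ∀ᶠ q in 𝓝 (b, x), Φ q = 0) :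
    ContMDiff ((𝓡 1).prod (𝓡 n)) 𝓘(ℝ, ℝ) ∞ (slabExtension a b K Φ) := by
  intro p
  rcases mem_slab_or_slabExtension_eventuallyEq_zero hab hK p with ⟨t, ht, x, hx, rfl⟩ | h
  · refine ContMDiffAt.congr_of_eventuallyEq ?_ (slabExtension_eventuallyEq hab hK ht hx)
    have h1 : ContMDiffAt (𝓡 1) 𝓘(ℝ, ℝ) ∞ (angleBranch ((a + b) / 2)) (Circle.exp t) :=
      contMDiffAt_angleBranch (by linarith [ht.1, ht.2]) (by linarith [ht.1, ht.2])
    exact hΦ.contMDiffAt.comp (Circle.exp t, x)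
      ((h1.comp (Circle.exp t, x) contMDiffAt_fst).prodMk contMDiffAt_snd)
  · exact contMDiffAt_const.congr_of_eventuallyEq (h Φ ha hb)

end SlabExtension

section Integrals

/-- Differentiation under the integral sign at `0` over a compact space of finite measure. -/
theorem hasDerivAt_integral_of_continuous {X : Type*} [TopologicalSpace X] [CompactSpace X]
    [MeasurableSpace X] [OpensMeasurableSpace X] {μ : Measure X} [IsFiniteMeasure μ]
    {f f' : ℝ → X → ℝ} (hf : ∀ s, Continuous (f s)) (hf' : Continuous (Function.uncurry f'))
    (hd : ∀ s x, HasDerivAt (fun s => f s x) (f' s x) s) :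
    HasDerivAt (fun s => ∫ x, f s x ∂μ) (∫ x, f' 0 x ∂μ) 0 := by
  obtain ⟨C, hC⟩ := ((isCompact_Icc (a := (-1 : ℝ)) (b := 1)).prod
    (isCompact_univ (X := X))).exists_bound_of_continuousOn hf'.continuousOn
  have hint : ∀ g : X → ℝ, Continuous g → Integrable g μ := fun g hg =>
    hg.integrable_of_hasCompactSupport (HasCompactSupport.of_compactSpace g)
  refine (hasDerivAt_integral_of_dominated_loc_of_deriv_le (μ := μ) (F := f) (F' := f')
    (x₀ := (0 : ℝ)) (s := Icc (-1) 1) (bound := fun _ => C)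
    (Icc_mem_nhds (by norm_num) (by norm_num)) ?_ (hint _ (hf 0)) ?_ ?_ ?_ ?_).2
  · exact Eventually.of_forall fun s => (hint _ (hf s)).aestronglyMeasurable
  · exact (hint _ (hf'.comp (continuous_const.prodMk continuous_id))).aestronglyMeasurable
  · exact Eventually.of_forall fun x s hs => hC (s, x) ⟨hs, mem_univ _⟩
  · exact integrable_const C
  · exact Eventually.of_forall fun x s _ => hd s x

end Integrals

/-! ### The touching principle -/

section Touching

theorem norm_smul_dual_sq {V : Type*} [NormedAddCommGroup V] [InnerProductSpace ℝ V] (c : ℝ)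
    (L : V →L[ℝ] ℝ) : ‖c • L‖ ^ 2 = c ^ 2 * ‖L‖ ^ 2 := by
  rw [norm_smul, mul_pow, Real.norm_eq_abs, sq_abs]

variable {n : ℕ} {M : Type*} [EMetricSpace M] [ChartedSpace (EuclideanSpace ℝ (Fin n)) M]
  [RiemannianBundle (fun x : M => TangentSpace (𝓡 n) x)]

/-- If near each point of the slice the restriction of `φ` to the slice is a function of `u`, then
the energy density of `u + s φ` splits without any mixed term in the directions of `M`. -/
theorem prodGradNormSq_add_smul {u φ : Circle × M → ℝ}
    (hu : ContMDiff ((𝓡 1).prod (𝓡 n)) 𝓘(ℝ, ℝ) ∞ u)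
    (hφ : ContMDiff ((𝓡 1).prod (𝓡 n)) 𝓘(ℝ, ℝ) ∞ φ) {p : Circle × M} {η : ℝ → ℝ} {k : ℝ}
    (hη : HasDerivAt η k (u p)) (h : ∀ᶠ y in 𝓝 p.2, φ (p.1, y) = η (u (p.1, y))) (s : ℝ) :
    prodGradNormSq n (fun q => u q + s * φ q) p =
      (angDeriv u p + s * angDeriv φ p) ^ 2 +
        (1 + s * k) ^ 2 * gradNormSq n (fun x => u (p.1, x)) p.2 := by
  have hrot : ∀ F : Circle × M → ℝ, ContMDiff ((𝓡 1).prod (𝓡 n)) 𝓘(ℝ, ℝ) ∞ F →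
      HasDerivAt (fun t : ℝ => F (Circle.exp t * p.1, p.2)) (angDeriv F p) 0 := by
    intro F hF
    have h1 : ContDiff ℝ ∞ (fun t : ℝ => F (Circle.exp t * p.1, p.2)) := by
      rw [← contMDiff_iff_contDiff]
      exact (contMDiff_rotate hF).comp (contMDiff_const (c := p) |>.prodMk contMDiff_id)
    exact (h1.differentiable (by simp) 0).hasDerivAt
  unfold prodGradNormSq
  congr 1
  · have h1 := ((hrot u hu).add ((hrot φ hφ).const_mul s)).deriv
    exact congrArg (· ^ 2) h1
  · have hup : MDifferentiableAt (𝓡 n) 𝓘(ℝ, ℝ) (fun x => u (p.1, x)) p.2 :=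
      (hu.comp (contMDiff_const.prodMk contMDiff_id)).mdifferentiableAt (by simp)
    have hcomp : HasMFDerivAt (𝓡 n) 𝓘(ℝ, ℝ) (fun y => u (p.1, y) + s * η (u (p.1, y))) p.2
        ((1 + s * k) • mfderiv (𝓡 n) 𝓘(ℝ, ℝ) (fun x => u (p.1, x)) p.2) := by
      have h1 : HasDerivAt (fun v => v + s * η v) (1 + s * k) (u (p.1, p.2)) :=
        (hasDerivAt_id _).add (hη.const_mul s)
      have h2 := (h1.hasFDerivAt.hasMFDerivAt).comp p.2 hup.hasMFDerivAt
      refine h2.congr_mfderiv ?_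
      ext v
      exact (mul_comm (1 + s * k) (differential n (fun y => u (p.1, y)) p.2 v)).symm
    have heq : (fun y => u (p.1, y) + s * φ (p.1, y)) =ᶠ[𝓝 p.2]
        fun y => u (p.1, y) + s * η (u (p.1, y)) := h.mono fun y hy => by simp only [hy]
    have h3 : differential n (fun y => u (p.1, y) + s * φ (p.1, y)) p.2 =
        (1 + s * k) • differential n (fun y => u (p.1, y)) p.2 :=
      (hcomp.congr_of_eventuallyEq heq).mfderiv
    unfold gradNormSq
    rw [h3]
    exact norm_smul_dual_sq (V := TangentSpace (𝓡 n) p.2) _ _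

variable [CompactSpace M] [MeasurableSpace M] [BorelSpace M] [IsManifold (𝓡 n) ∞ M]
  [IsContinuousRiemannianBundle (EuclideanSpace ℝ (Fin n)) (fun x : M => TangentSpace (𝓡 n) x)]

theorem integral_angDeriv {F : Circle × M → ℝ}
    (hF : ContMDiff ((𝓡 1).prod (𝓡 n)) 𝓘(ℝ, ℝ) ∞ F) :
    ∫ p, angDeriv F p ∂(circleLength.prod (riemannianVolume n M)) = 0 := by
  have := EMetric.secondCountable_of_sigmaCompact M
  have hc : Continuous (angDeriv F) := continuous_angDeriv hF
  have hint : Integrable (angDeriv F) (circleLength.prod (riemannianVolume n M)) :=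
    hc.integrable_of_hasCompactSupport (HasCompactSupport.of_compactSpace _)
  rw [integral_prod_symm _ hint]
  refine integral_eq_zero_of_ae (Eventually.of_forall fun x => ?_)
  simp only [Pi.zero_apply]
  rw [circleLength_integral (fun z => angDeriv F (z, x)) (hc.comp (Continuous.prodMk_left x)),
    intervalIntegral.integral_eq_sub_of_hasDerivAt (fun t _ => hasDerivAt_angDeriv hF t x)]
  · have : Circle.exp (-Real.pi) = Circle.exp Real.pi :=
      Circle.exp_eq_exp.2 ⟨-1, by push_cast; ring⟩
    rw [this, sub_self]
  · exact (hc.comp (Circle.exp.continuous.prodMk continuous_const)).intervalIntegrable _ _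

/-- A phase transition cannot touch from above, over a slab and away from the ends of the slab, a
strict subsolution `g` that depends only on the angle: the test function `χ (u - g)`, with `χ`
nonincreasing and supported near `(-∞, 0]`, violates the Euler-Lagrange equation. -/
theorem IsPhaseTransition.not_touch {W : ℝ → ℝ} (hW : ContDiff ℝ ∞ W) {ε : ℝ} (hε : 0 < ε)
    {u : Circle × M → ℝ} (hu : IsPhaseTransition n W ε u) {K : Set M} (hK : IsClopen K)
    {a b : ℝ} (hab : b - a < 2 * Real.pi) {g : ℝ → ℝ} (hg : ContDiff ℝ ∞ g)
    (hle : ∀ t ∈ Icc a b, ∀ x ∈ K, g t ≤ u (Circle.exp t, x))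
    (ha : ∀ x ∈ K, g a < u (Circle.exp a, x)) (hb : ∀ x ∈ K, g b < u (Circle.exp b, x))
    (hstrict : ∀ t ∈ Icc a b, ∀ x ∈ K, u (Circle.exp t, x) = g t →
      deriv W (g t) < ε ^ 2 * deriv (deriv g) t)
    {t₀ : ℝ} (ht₀ : t₀ ∈ Icc a b) {x₀ : M} (hx₀ : x₀ ∈ K) : u (Circle.exp t₀, x₀) ≠ g t₀ := by
  intro heq
  have := EMetric.secondCountable_of_sigmaCompact M
  set Z : ℝ × M → ℝ := fun q => u (Circle.exp q.1, q.2) - g q.1 with hZ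
  have hue : ContMDiff (𝓘(ℝ, ℝ).prod (𝓡 n)) 𝓘(ℝ, ℝ) ∞
      (fun q : ℝ × M => u (Circle.exp q.1, q.2)) :=
    hu.smooth.comp ((contMDiff_circleExp.comp contMDiff_fst).prodMk contMDiff_snd)
  have hZs : ContMDiff (𝓘(ℝ, ℝ).prod (𝓡 n)) 𝓘(ℝ, ℝ) ∞ Z :=
    hue.sub (hg.contMDiff.comp contMDiff_fst)
  have hg' : ContDiff ℝ ∞ (deriv g) := hg.iterate_deriv 1
  have hg'' : ContDiff ℝ ∞ (deriv (deriv g)) := hg.iterate_deriv 2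
  have hW' : ContDiff ℝ ∞ (deriv W) := hW.iterate_deriv 1
  set h : ℝ × M → ℝ := fun q =>
    ε ^ 2 * deriv (deriv g) q.1 - deriv W (u (Circle.exp q.1, q.2)) with hh
  have hhc : Continuous h := ((hg''.continuous.comp continuous_fst).const_mul _).sub
    (hW'.continuous.comp hue.continuous)
  -- The part of the closed slab where the test function has to vanish.
  set bad : Set (ℝ × M) := (Icc a b ×ˢ K) ∩ {q | q.1 = a ∨ q.1 = b ∨ h q ≤ 0} with hbad
  have hbadc : IsCompact bad := by
    refine (isCompact_Icc.prod hK.isClosed.isCompact).inter_right ?_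
    exact (isClosed_eq continuous_fst continuous_const).union
      ((isClosed_eq continuous_fst continuous_const).union (isClosed_le hhc continuous_const))
  have hZpos : ∀ q ∈ bad, 0 < Z q := by
    rintro ⟨t, x⟩ ⟨⟨ht, hx⟩, h1⟩
    rcases h1 with rfl | rfl | h1
    · exact sub_pos.2 (ha x hx)
    · exact sub_pos.2 (hb x hx)
    · refine lt_of_le_of_ne (sub_nonneg.2 (hle t ht x hx)) fun h2 => ?_
      have h3 : u (Circle.exp t, x) = g t := sub_eq_zero.1 h2.symm
      have h4 := hstrict t ht x hx h3
      simp only [hh, h3] at h1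
      linarith
  obtain ⟨R, hR, hRZ⟩ := hbadc.exists_forall_le' hZs.continuous.continuousOn hZpos
  obtain ⟨r, hr, hrR⟩ := exists_between hR
  set χ : ℝ → ℝ := fun v => Real.smoothTransition (r - v) with hχ
  have hχs : ContDiff ℝ ∞ χ := Real.smoothTransition.contDiff.comp (contDiff_const.sub contDiff_id)
  have hχ's : ContDiff ℝ ∞ (deriv χ) := hχs.iterate_deriv 1
  have hχd : ∀ v, HasDerivAt χ (deriv χ v) v := fun v =>
    (hχs.differentiable (by simp) v).hasDerivAt
  have hχ0 : ∀ v, r ≤ v → χ v = 0 := fun v hv =>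
    Real.smoothTransition.zero_of_nonpos (by linarith)
  have hχnn : ∀ v, 0 ≤ χ v := fun v => Real.smoothTransition.nonneg _
  have hχ'np : ∀ v, deriv χ v ≤ 0 := fun v => by
    have : Antitone χ := fun v w hvw => Real.smoothTransition.monotone (by linarith)
    exact this.deriv_nonpos
  have hχ'0 : ∀ v, r < v → deriv χ v = 0 := fun v hv => by
    have : χ =ᶠ[𝓝 v] fun _ => 0 := by
      filter_upwards [Ioi_mem_nhds hv] with w hw
      exact hχ0 w (le_of_lt hw)
    rw [this.deriv_eq, deriv_const]
  have hbig : ∀ q ∈ bad, ∀ᶠ q' in 𝓝 q, r < Z q' := fun q hq =>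
    hZs.continuous.continuousAt.eventually_const_lt (hrR.trans_le (hRZ q hq))
  have habad : ∀ c ∈ Icc a b, c = a ∨ c = b → ∀ x ∈ K, (c, x) ∈ bad := fun c hc h1 x hx =>
    ⟨⟨hc, hx⟩, h1.imp_right Or.inl⟩
  have hab' : a ≤ b := ht₀.1.trans ht₀.2
  have hza : ∀ x ∈ K, ∀ᶠ q in 𝓝 (a, x), r < Z q := fun x hx =>
    hbig _ (habad a (left_mem_Icc.2 hab') (Or.inl rfl) x hx)
  have hzb : ∀ x ∈ K, ∀ᶠ q in 𝓝 (b, x), r < Z q := fun x hx =>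
    hbig _ (habad b (right_mem_Icc.2 hab') (Or.inr rfl) x hx)
  -- The test function, its derivative in `u`, and the vector field used to integrate by parts.
  set Φ₁ : ℝ × M → ℝ := fun q => χ (Z q) with hΦ₁
  set Φ₂ : ℝ × M → ℝ := fun q => deriv χ (Z q) with hΦ₂
  set Φ₃ : ℝ × M → ℝ := fun q => deriv g q.1 * χ (Z q) with hΦ₃
  have h1a : ∀ x ∈ K, ∀ᶠ q in 𝓝 (a, x), Φ₁ q = 0 := fun x hx =>
    (hza x hx).mono fun q hq => hχ0 _ hq.le
  have h1b : ∀ x ∈ K, ∀ᶠ q in 𝓝 (b, x), Φ₁ q = 0 := fun x hx =>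
    (hzb x hx).mono fun q hq => hχ0 _ hq.le
  have h2a : ∀ x ∈ K, ∀ᶠ q in 𝓝 (a, x), Φ₂ q = 0 := fun x hx =>
    (hza x hx).mono fun q hq => hχ'0 _ hq
  have h2b : ∀ x ∈ K, ∀ᶠ q in 𝓝 (b, x), Φ₂ q = 0 := fun x hx =>
    (hzb x hx).mono fun q hq => hχ'0 _ hq
  have h3a : ∀ x ∈ K, ∀ᶠ q in 𝓝 (a, x), Φ₃ q = 0 := fun x hx =>
    (hza x hx).mono fun q hq => by simp [hΦ₃, hχ0 _ hq.le]
  have h3b : ∀ x ∈ K, ∀ᶠ q in 𝓝 (b, x), Φ₃ q = 0 := fun x hx =>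
    (hzb x hx).mono fun q hq => by simp [hΦ₃, hχ0 _ hq.le]
  have hΦ₁s : ContMDiff (𝓘(ℝ, ℝ).prod (𝓡 n)) 𝓘(ℝ, ℝ) ∞ Φ₁ := hχs.contMDiff.comp hZs
  have hΦ₂s : ContMDiff (𝓘(ℝ, ℝ).prod (𝓡 n)) 𝓘(ℝ, ℝ) ∞ Φ₂ := hχ's.contMDiff.comp hZs
  have hΦ₃s : ContMDiff (𝓘(ℝ, ℝ).prod (𝓡 n)) 𝓘(ℝ, ℝ) ∞ Φ₃ :=
    (hg'.contMDiff.comp contMDiff_fst).mul hΦ₁s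
  set φ := slabExtension a b K Φ₁ with hφ
  set k := slabExtension a b K Φ₂ with hk
  set F := slabExtension a b K Φ₃ with hF
  have hφs : ContMDiff ((𝓡 1).prod (𝓡 n)) 𝓘(ℝ, ℝ) ∞ φ :=
    contMDiff_slabExtension hab hK hΦ₁s h1a h1b
  have hks : ContMDiff ((𝓡 1).prod (𝓡 n)) 𝓘(ℝ, ℝ) ∞ k :=
    contMDiff_slabExtension hab hK hΦ₂s h2a h2b
  have hFs : ContMDiff ((𝓡 1).prod (𝓡 n)) 𝓘(ℝ, ℝ) ∞ F :=
    contMDiff_slabExtension hab hK hΦ₃s h3a h3b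
  set G : Circle × M → ℝ := fun p => gradNormSq n (fun x => u (p.1, x)) p.2 with hG
  have hGc : Continuous G := continuous_gradNormSq_slice hu.smooth
  have hAc : Continuous (angDeriv u) := continuous_angDeriv hu.smooth
  have hBc : Continuous (angDeriv φ) := continuous_angDeriv hφs
  have hFc : Continuous (angDeriv F) := continuous_angDeriv hFs
  have huc : Continuous u := hu.smooth.continuous
  have hφc : Continuous φ := hφs.continuous
  have hkc : Continuous k := hks.continuous
  have hgrad : ∀ s p, prodGradNormSq n (fun q => u q + s * φ q) p =
      (angDeriv u p + s * angDeriv φ p) ^ 2 + (1 + s * k p) ^ 2 * G p := by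
    intro s p
    rcases mem_slab_or_slabExtension_eventuallyEq_zero hab hK p with ⟨t, ht, x, hx, rfl⟩ | h0
    · have hkt : k (Circle.exp t, x) = deriv χ (u (Circle.exp t, x) - g t) :=
        slabExtension_exp hab (Ioo_subset_Icc_self ht) hx
      rw [hkt]
      refine prodGradNormSq_add_smul hu.smooth hφs (η := fun v => χ (v - g t)) ?_ ?_ s
      · exact (hχd _).comp_sub_const _ _
      · filter_upwards [hK.isOpen.eventually_mem hx] with y hy
        exact slabExtension_exp hab (Ioo_subset_Icc_self ht) hy
    · have hk0 : k p = 0 := (h0 Φ₂ h2a h2b).eq_of_nhds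
      rw [hk0]
      refine prodGradNormSq_add_smul hu.smooth hφs (η := fun _ => 0) (hasDerivAt_const _ _) ?_ s
      have hcy : Tendsto (fun y => (p.1, y)) (𝓝 p.2) (𝓝 p) :=
        (Continuous.prodMk_right p.1).tendsto p.2
      exact hcy.eventually (h0 Φ₁ h1a h1b)
  set f' : ℝ → Circle × M → ℝ := fun s p =>
    1 / 2 * ε * (2 * (angDeriv u p + s * angDeriv φ p) * angDeriv φ p +
      2 * (1 + s * k p) * k p * G p) + ε⁻¹ * (deriv W (u p + s * φ p) * φ p) with hf'
  have hderiv : HasDerivAt (fun s : ℝ => energy n W ε (fun p => u p + s * φ p))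
      (∫ p, f' 0 p ∂(circleLength.prod (riemannianVolume n M))) 0 := by
    unfold energy
    simp only [hgrad]
    refine hasDerivAt_integral_of_continuous (f' := f') (fun s => ?_) ?_ fun s p => ?_
    · have := hW.continuous
      fun_prop
    · have := hW'.continuous
      simp only [hf', Function.uncurry_def]
      fun_prop
    · have hl : ∀ c d : ℝ, HasDerivAt (fun s : ℝ => c + s * d) d s := fun c d => by
        simpa using ((hasDerivAt_id s).mul_const d).const_add c
      have hWd : HasDerivAt W (deriv W (u p + s * φ p)) (u p + s * φ p) :=
        (hW.differentiable (by simp) _).hasDerivAt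
      have h1 := ((((hl (angDeriv u p) (angDeriv φ p)).pow 2).add
        (((hl 1 (k p)).pow 2).mul_const (G p))).const_mul (1 / 2 * ε)).add
        ((hWd.comp s (hl (u p) (φ p))).const_mul ε⁻¹)
      refine h1.congr_deriv ?_
      simp only [hf']
      push_cast
      ring
  have hzero : ∫ p, f' 0 p ∂(circleLength.prod (riemannianVolume n M)) = 0 :=
    hderiv.unique (hu.critical φ hφs)
  have hf'c : Continuous (f' 0) := by
    have := hW'.continuous
    simp only [hf']
    fun_prop
  set I : Circle × M → ℝ := fun p => ε * angDeriv F p - f' 0 p with hI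
  have hIc : Continuous I := (hFc.const_mul ε).sub hf'c
  have hint : ∀ q : Circle × M → ℝ, Continuous q →
      Integrable q (circleLength.prod (riemannianVolume n M)) := fun q hq =>
    hq.integrable_of_hasCompactSupport (HasCompactSupport.of_compactSpace q)
  have hI0 : ∫ p, I p ∂(circleLength.prod (riemannianVolume n M)) = 0 := by
    rw [integral_sub (hint _ (hFc.const_mul ε)) (hint _ hf'c), hzero, integral_const_mul,
      integral_angDeriv hFs]
    simp
  have hIslab : ∀ t ∈ Ioo a b, ∀ x ∈ K, I (Circle.exp t, x) =
      ε⁻¹ * (χ (Z (t, x)) * h (t, x)) - ε * deriv χ (Z (t, x)) *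
        ((angDeriv u (Circle.exp t, x) - deriv g t) ^ 2 + G (Circle.exp t, x)) := by
    intro t ht x hx
    have hev : ∀ᶠ s in 𝓝 t, s ∈ Icc a b := Icc_mem_nhds ht.1 ht.2
    have hgd : HasDerivAt g (deriv g t) t := (hg.differentiable (by simp) t).hasDerivAt
    have hg'd : HasDerivAt (deriv g) (deriv (deriv g) t) t :=
      (hg'.differentiable (by simp) t).hasDerivAt
    have hZd : HasDerivAt (fun s => Z (s, x)) (angDeriv u (Circle.exp t, x) - deriv g t) t :=
      (hasDerivAt_angDeriv hu.smooth t x).sub hgd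
    have hΦ₁d : HasDerivAt (fun s => Φ₁ (s, x))
        (deriv χ (Z (t, x)) * (angDeriv u (Circle.exp t, x) - deriv g t)) t :=
      HasDerivAt.comp (h₂ := χ) t (hχd (Z (t, x))) hZd
    have hB : angDeriv φ (Circle.exp t, x) =
        deriv χ (Z (t, x)) * (angDeriv u (Circle.exp t, x) - deriv g t) := by
      refine (hasDerivAt_angDeriv hφs t x).unique (hΦ₁d.congr_of_eventuallyEq ?_)
      exact hev.mono fun s hs => slabExtension_exp hab hs hx
    have hFd : angDeriv F (Circle.exp t, x) = deriv (deriv g) t * χ (Z (t, x)) +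
        deriv g t * (deriv χ (Z (t, x)) * (angDeriv u (Circle.exp t, x) - deriv g t)) := by
      refine (hasDerivAt_angDeriv hFs t x).unique ((hg'd.mul hΦ₁d).congr_of_eventuallyEq ?_)
      exact hev.mono fun s hs => slabExtension_exp hab hs hx
    have hkt : k (Circle.exp t, x) = deriv χ (Z (t, x)) :=
      slabExtension_exp hab (Ioo_subset_Icc_self ht) hx
    have hφt : φ (Circle.exp t, x) = χ (Z (t, x)) :=
      slabExtension_exp hab (Ioo_subset_Icc_self ht) hx
    simp only [hI, hf', hB, hFd, hkt, hφt, hh, zero_mul, add_zero]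
    field_simp
    ring
  have hχh : ∀ t ∈ Icc a b, ∀ x ∈ K, 0 ≤ χ (Z (t, x)) * h (t, x) := by
    intro t ht x hx
    rcases le_or_gt (h (t, x)) 0 with h1 | h1
    · rw [hχ0 _ (hrR.le.trans (hRZ (t, x) ⟨⟨ht, hx⟩, Or.inr (Or.inr h1)⟩)), zero_mul]
    · exact mul_nonneg (hχnn _) h1.le
  have hGnn : ∀ p, 0 ≤ G p := fun p => sq_nonneg _
  have hInn : 0 ≤ I := by
    intro p
    rcases mem_slab_or_slabExtension_eventuallyEq_zero hab hK p with ⟨t, ht, x, hx, rfl⟩ | h0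
    · rw [hIslab t ht x hx, Pi.zero_apply, sub_nonneg]
      refine le_trans ?_ (mul_nonneg (inv_nonneg.2 hε.le)
        (hχh t (Ioo_subset_Icc_self ht) x hx))
      exact mul_nonpos_of_nonpos_of_nonneg
        (mul_nonpos_of_nonneg_of_nonpos hε.le (hχ'np _)) (add_nonneg (sq_nonneg _) (hGnn _))
    · have hrot : Tendsto (fun t : ℝ => (Circle.exp t * p.1, p.2)) (𝓝 0) (𝓝 p) := by
        have : Continuous fun t : ℝ => (Circle.exp t * p.1, p.2) :=
          (Circle.exp.continuous.mul continuous_const).prodMk continuous_const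
        simpa using this.tendsto 0
      have hd0 : ∀ f : Circle × M → ℝ, f =ᶠ[𝓝 p] 0 → angDeriv f p = 0 := fun f hf => by
        have h1 : (fun t : ℝ => f (Circle.exp t * p.1, p.2)) =ᶠ[𝓝 0] fun _ => 0 :=
          hrot.eventually hf
        rw [angDeriv, h1.deriv_eq, deriv_const]
      have hk0 : k p = 0 := (h0 Φ₂ h2a h2b).eq_of_nhds
      have hφ0 : φ p = 0 := (h0 Φ₁ h1a h1b).eq_of_nhds
      simp [hI, hf', hd0 φ (h0 Φ₁ h1a h1b), hd0 F (h0 Φ₃ h3a h3b), hk0, hφ0]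
  have hIpos : I (Circle.exp t₀, x₀) ≠ 0 := by
    have hZ0 : Z (t₀, x₀) = 0 := sub_eq_zero.2 heq
    have hta : a ≠ t₀ := by rintro rfl; exact (ha x₀ hx₀).ne' heq
    have htb : t₀ ≠ b := by rintro rfl; exact (hb x₀ hx₀).ne' heq
    have h1 : 0 < h (t₀, x₀) := by
      have := hstrict t₀ ht₀ x₀ hx₀ heq
      simp only [hh, heq]
      linarith
    have h2 : 0 < χ (Z (t₀, x₀)) := by
      rw [hZ0]
      exact Real.smoothTransition.pos_of_pos (by linarith)
    rw [hIslab t₀ ⟨lt_of_le_of_ne ht₀.1 hta, lt_of_le_of_ne ht₀.2 htb⟩ x₀ hx₀]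
    have h3 : 0 < ε⁻¹ * (χ (Z (t₀, x₀)) * h (t₀, x₀)) := by positivity
    have h4 := mul_nonpos_of_nonpos_of_nonneg
      (mul_nonpos_of_nonneg_of_nonpos hε.le (hχ'np (Z (t₀, x₀))))
      (add_nonneg (sq_nonneg (angDeriv u (Circle.exp t₀, x₀) - deriv g t₀))
        (hGnn (Circle.exp t₀, x₀)))
    linarith
  have hpos := hIc.integral_pos_of_hasCompactSupport_nonneg_nonzero
    (μ := circleLength.prod (riemannianVolume n M))
    (HasCompactSupport.of_compactSpace I) hInn hIpos
  exact hpos.ne' hI0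

end Touching

/-! ### Double-well potentials and one-dimensional profiles -/

section Potential

namespace IsDoubleWell

variable {W : ℝ → ℝ} (hW : IsDoubleWell W)
include hW

theorem differentiable : Differentiable ℝ W := hW.smooth.differentiable (by simp)

theorem contDiff_deriv : ContDiff ℝ ∞ (deriv W) := hW.smooth.iterate_deriv 1

theorem deriv_one : deriv W 1 = 0 := by
  refine IsLocalMin.deriv_eq_zero (Eventually.of_forall fun x => ?_)
  rw [(hW.eq_zero_iff 1).2 (Or.inl rfl)]
  exact hW.nonneg x

theorem deriv_neg (x : ℝ) : deriv W (-x) = -deriv W x := by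
  have h : W = fun x => W (-x) := funext hW.even
  have h1 : deriv W x = -deriv W (-x) := by
    conv_lhs => rw [h]
    exact deriv_comp_neg W x
  rw [h1, neg_neg]

theorem deriv_lt_zero {x : ℝ} (hx : x ∈ Ioo (0 : ℝ) 1) : deriv W x < 0 := by
  have hnp : ∀ y ∈ Ioo (0 : ℝ) 1, deriv W y / y ≤ 0 := by
    intro y hy
    have h1 : Tendsto (fun z => deriv W z / z) (𝓝[<] 1) (𝓝 0) := by
      have h2 : ContinuousAt (fun z => deriv W z / z) 1 :=
        hW.contDiff_deriv.continuous.continuousAt.div continuousAt_id one_ne_zero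
      have h3 := h2.tendsto
      simp only [hW.deriv_one, zero_div] at h3
      exact h3.mono_left nhdsWithin_le_nhds
    refine ge_of_tendsto h1 ?_
    filter_upwards [Ioo_mem_nhdsLT hy.2] with z hz
    exact hW.monotone hy ⟨hy.1.trans hz.1, hz.2⟩ hz.1.le
  rcases lt_or_eq_of_le (hnp x hx) with h | h
  · by_contra h1
    exact absurd h (not_lt.2 (div_nonneg (not_lt.1 h1) hx.1.le))
  exfalso
  -- A zero of `W'` in `(0, 1)` would make `W` constant from there to `1`.
  obtain ⟨c, hc, hcW⟩ := exists_deriv_eq_slope W hx.2 hW.smooth.continuous.continuousOn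
    hW.differentiable.differentiableOn
  have hc1 : c ∈ Ioo (0 : ℝ) 1 := ⟨hx.1.trans hc.1, hc.2⟩
  have h0 : deriv W c / c = 0 := le_antisymm (hnp c hc1) (h ▸ hW.monotone hx hc1 hc.1.le)
  have h2 : deriv W c = 0 := by
    rcases div_eq_zero_iff.1 h0 with h3 | h3
    · exact h3
    · exact absurd h3 hc1.1.ne'
  rw [h2, (hW.eq_zero_iff 1).2 (Or.inl rfl), eq_comm,
    div_eq_zero_iff] at hcW
  rcases hcW with h3 | h3
  · rcases (hW.eq_zero_iff x).1 (by linarith) with h4 | h4 <;> linarith [hx.1, hx.2]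
  · linarith [hx.2]

theorem strictAntiOn : StrictAntiOn W (Icc 0 1) := by
  refine strictAntiOn_of_deriv_neg (convex_Icc 0 1) hW.smooth.continuous.continuousOn ?_
  rw [interior_Icc]
  exact fun x hx => hW.deriv_lt_zero hx

theorem deriv_mul_le {τ v : ℝ} (hτ : τ ∈ Ioc (0 : ℝ) 1) (hv : v ∈ Ioo (0 : ℝ) 1) :
    deriv W (τ * v) ≤ τ * deriv W v := by
  have h1 : τ * v ∈ Ioo (0 : ℝ) 1 :=
    ⟨mul_pos hτ.1 hv.1, (mul_le_of_le_one_left hv.1.le hτ.2).trans_lt hv.2⟩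
  have h2 := hW.monotone h1 hv (mul_le_of_le_one_left hv.1.le hτ.2)
  simp only at h2
  rw [div_le_div_iff₀ h1.1 hv.1] at h2
  have h3 : deriv W (τ * v) * v ≤ (τ * deriv W v) * v := by linarith
  exact le_of_mul_le_mul_right h3 hv.1

theorem mul_deriv_le {τ v : ℝ} (hτ : 1 ≤ τ) (hv : v ∈ Ioo (0 : ℝ) 1) (hτv : τ * v ≤ 1) :
    τ * deriv W v ≤ deriv W (τ * v) := by
  rcases lt_or_eq_of_le hτv with h | h
  · have h1 : τ * v ∈ Ioo (0 : ℝ) 1 := ⟨mul_pos (by linarith) hv.1, h⟩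
    have h2 := hW.monotone hv h1 (le_mul_of_one_le_left hv.1.le hτ)
    simp only at h2
    rw [div_le_div_iff₀ hv.1 h1.1] at h2
    have h3 : (τ * deriv W v) * v ≤ deriv W (τ * v) * v := by linarith
    exact le_of_mul_le_mul_right h3 hv.1
  · rw [h, hW.deriv_one]
    exact mul_nonpos_of_nonneg_of_nonpos (by linarith) (hW.deriv_lt_zero hv).le

end IsDoubleWell

end Potential

section GlobalFlow

variable {E : Type*} [NormedAddCommGroup E] [NormedSpace ℝ E]

theorem exists_hasDerivAt_of_lipschitzWith [CompleteSpace E] {X : E → E}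
    (hX : ContDiff ℝ 1 X) {C : NNReal}
    (hC : LipschitzWith C X) (x : E) : ∃ γ : ℝ → E, γ 0 = x ∧ ∀ t, HasDerivAt γ (X (γ t)) t := by
  set τ : ℝ := 1 / (2 * (C + 1)) with hτ
  have hτ0 : 0 < τ := by positivity
  have hsec : ContMDiff 𝓘(ℝ, E) 𝓘(ℝ, E).tangent 1 (fun x => (⟨x, X x⟩ : TangentBundle 𝓘(ℝ, E) E)) :=
    contMDiff_vectorSpace_iff_contDiff.2 hX
  obtain ⟨γ, h0, hγ⟩ := exists_isMIntegralCurve_of_isMIntegralCurveOn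
    (v := fun x : E => (X x : TangentSpace 𝓘(ℝ, E) x)) hsec hτ0 (fun y => by
      set r : NNReal := ‖X y‖₊
      have hPL : IsPicardLindelof (fun _ : ℝ => X)
          (⟨0, by constructor <;> linarith⟩ : Icc (-τ) τ) y r 0 (r + C * r) C := by
        refine ⟨fun _ _ => hC.lipschitzOnWith, fun _ _ => continuousOn_const, ?_, ?_⟩
        · intro _ _ z hz
          have h1 : ‖X z - X y‖ ≤ C * r := by
            have := hC.dist_le_mul z y
            rw [dist_eq_norm] at this
            exact this.trans (mul_le_mul_of_nonneg_left (Metric.mem_closedBall.1 hz) C.2)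
          calc ‖X z‖ = ‖X y + (X z - X y)‖ := by congr 1; abel
            _ ≤ ‖X y‖ + ‖X z - X y‖ := norm_add_le _ _
            _ ≤ ((r + C * r : NNReal) : ℝ) := by
              push_cast
              exact add_le_add le_rfl h1
        · simp only [sub_zero, zero_sub, neg_neg, max_self, NNReal.coe_zero]
          push_cast
          rw [hτ, mul_one_div, div_le_iff₀ (by positivity)]
          have : (0 : ℝ) ≤ r := r.2
          have : (0 : ℝ) ≤ C := C.2
          nlinarith [mul_nonneg ‹(0 : ℝ) ≤ r› ‹(0 : ℝ) ≤ C›]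
      obtain ⟨α, hα0, hα⟩ := hPL.exists_eq_forall_mem_Icc_hasDerivWithinAt₀
      refine ⟨α, hα0, fun t ht => ?_⟩
      have h1 := (hα t (Ioo_subset_Icc_self ht)).mono Ioo_subset_Icc_self
      exact h1.hasFDerivWithinAt.hasMFDerivWithinAt) x
  exact ⟨γ, h0, fun t => by
    have h1 : HasFDerivAt γ ((1 : ℝ →L[ℝ] ℝ).smulRight (X (γ t))) t := (hγ t).hasFDerivAt
    simpa using h1.hasDerivAt⟩

theorem contDiff_of_hasDerivAt {X : E → E} (hX : ContDiff ℝ ∞ X) {γ : ℝ → E}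
    (hγ : ∀ t, HasDerivAt γ (X (γ t)) t) : ContDiff ℝ ∞ γ := by
  rw [contDiff_infty]
  intro k
  induction k with
  | zero => exact contDiff_zero.2 (continuous_iff_continuousAt.2 fun t => (hγ t).continuousAt)
  | succ k ih =>
    have h1 : deriv γ = fun t => X (γ t) := funext fun t => (hγ t).deriv
    have h2 : ContDiff ℝ k (deriv γ) := h1 ▸ (hX.of_le (by exact_mod_cast le_top)).comp ih
    push_cast
    exact contDiff_succ_iff_deriv.2 ⟨fun t => (hγ t).differentiableAt, by simp, h2⟩

end GlobalFlow

section Profile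

/-- `V` is a positive solution of `V'' = W'(V)` on `(-T, T)` that vanishes at both ends, takes its
values in `[0, 1)`, and has slope `p` at the left end and `-p` at the right end. It is smooth on
the whole line, but the equation is only required where it is used. -/
structure IsProfile (W V : ℝ → ℝ) (T p : ℝ) : Prop where
  smooth : ContDiff ℝ ∞ V
  pos_length : 0 < T
  mem_Ioo : ∀ s ∈ Ioo (-T) T, V s ∈ Ioo (0 : ℝ) 1
  right_end : V T = 0
  left_end : V (-T) = 0
  deriv_right : deriv V T = -p
  deriv_left : deriv V (-T) = p
  equation : ∀ s ∈ Icc (-T) T, deriv (deriv V) s = deriv W (V s)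

variable {W : ℝ → ℝ}

/-- A compactly supported smooth function that agrees with `W'` on `[-1, 1]`. -/
def cutoffForce (W : ℝ → ℝ) (x : ℝ) : ℝ :=
  (⟨1, 2, one_pos, one_lt_two⟩ : ContDiffBump (0 : ℝ)) x * deriv W x

theorem cutoffForce_eq {x : ℝ} (hx : x ∈ Icc (-1 : ℝ) 1) : cutoffForce W x = deriv W x := by
  rw [cutoffForce, ContDiffBump.one_of_mem_closedBall, one_mul]
  rw [Metric.mem_closedBall, Real.dist_eq, sub_zero]
  exact abs_le.2 hx

theorem IsDoubleWell.contDiff_cutoffForce (hW : IsDoubleWell W) :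
    ContDiff ℝ ∞ (cutoffForce W) :=
  (ContDiffBump.contDiff _).mul hW.contDiff_deriv

theorem hasCompactSupport_cutoffForce : HasCompactSupport (cutoffForce W) :=
  (ContDiffBump.hasCompactSupport _).mul_right

/-- The vector field on the phase plane of the equation `V'' = W'(V)`. -/
def phaseField (W : ℝ → ℝ) (y : ℝ × ℝ) : ℝ × ℝ := (y.2, cutoffForce W y.1)

theorem IsDoubleWell.contDiff_phaseField (hW : IsDoubleWell W) :
    ContDiff ℝ ∞ (phaseField W) :=
  contDiff_snd.prodMk (hW.contDiff_cutoffForce.comp contDiff_fst)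

theorem IsDoubleWell.exists_lipschitzWith_phaseField (hW : IsDoubleWell W) :
    ∃ C, LipschitzWith C (phaseField W) := by
  obtain ⟨C, hC⟩ := hW.contDiff_cutoffForce.lipschitzWith_of_hasCompactSupport
    hasCompactSupport_cutoffForce (by simp)
  exact ⟨_, LipschitzWith.prodMk LipschitzWith.prod_snd (hC.comp LipschitzWith.prod_fst)⟩

theorem IsDoubleWell.exists_flow (hW : IsDoubleWell W) :
    ∃ γ : ℝ → ℝ → ℝ × ℝ, ∀ μ, γ μ 0 = (μ, 0) ∧ ∀ t, HasDerivAt (γ μ) (phaseField W (γ μ t)) t := by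
  obtain ⟨C, hC⟩ := hW.exists_lipschitzWith_phaseField
  choose γ hγ using fun μ : ℝ => exists_hasDerivAt_of_lipschitzWith
    (hW.contDiff_phaseField.of_le (by simp)) hC (μ, 0)
  exact ⟨γ, hγ⟩

/-- The solution of `V'' = W'(V)` with `V(0) = μ ∈ (0, 1)` and `V'(0) = 0` decreases to its first
zero. -/
theorem IsDoubleWell.exists_first_zero (hW : IsDoubleWell W) {γ : ℝ → ℝ × ℝ} {μ : ℝ}
    (hμ : μ ∈ Ioo (0 : ℝ) 1) (h0 : γ 0 = (μ, 0))
    (hγ : ∀ t, HasDerivAt γ (phaseField W (γ t)) t) :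
    ∃ T > 0, (∀ t ∈ Ico 0 T, (γ t).1 ∈ Ioc 0 μ) ∧ (γ T).1 = 0 ∧ (γ T).2 = -√(2 * (W 0 - W μ)) := by
  have hv : ∀ t, HasDerivAt (fun t => (γ t).1) (γ t).2 t := fun t => (hγ t).fst
  have hq : ∀ t, HasDerivAt (fun t => (γ t).2) (cutoffForce W (γ t).1) t := fun t => (hγ t).snd
  have hvc : Continuous fun t => (γ t).1 :=
    continuous_iff_continuousAt.2 fun t => (hv t).continuousAt
  have hqc : Continuous fun t => (γ t).2 :=
    continuous_iff_continuousAt.2 fun t => (hq t).continuousAt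
  have hv0 : (γ 0).1 = μ := by rw [h0]
  have hq0 : (γ 0).2 = 0 := by rw [h0]
  have hGc : Continuous fun t => cutoffForce W (γ t).1 :=
    hW.contDiff_cutoffForce.continuous.comp hvc
  have hGneg : ∀ t, 0 < (γ t).1 → (γ t).1 ≤ μ → cutoffForce W (γ t).1 < 0 := by
    intro t h1 h2
    rw [cutoffForce_eq ⟨by linarith, by linarith [hμ.2]⟩]
    exact hW.deriv_lt_zero ⟨h1, by linarith [hμ.2]⟩
  have hanti : ∀ r z, (∀ t ∈ Ioo r z, (γ t).2 ≤ 0) → AntitoneOn (fun t => (γ t).1) (Icc r z) := by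
    intro r z h
    refine antitoneOn_of_deriv_nonpos (convex_Icc r z) hvc.continuousOn
      (fun t _ => (hv t).differentiableAt.differentiableWithinAt) fun t ht => ?_
    rw [interior_Icc] at ht
    rw [(hv t).deriv]
    exact h t ht
  -- As long as `V` is positive, `V''` is negative, so that `V'` and `V` decrease.
  have hstay : ∀ s, 0 ≤ s → (∀ t ∈ Ico 0 s, 0 < (γ t).1) →
      ∀ t ∈ Icc 0 s, (γ t).1 ≤ μ ∧ (γ t).2 ≤ 0 := by
    intro s hs0 hs
    have hcl : IsClosed ({t | (γ t).1 ≤ μ ∧ (γ t).2 ≤ 0} ∩ Icc 0 s) :=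
      ((isClosed_le hvc continuous_const).inter
        (isClosed_le hqc continuous_const)).inter isClosed_Icc
    refine fun t ht => hcl.Icc_subset_of_forall_exists_gt ⟨hv0.le, hq0.le⟩ ?_ ht
    rintro r ⟨⟨hr1, hr2⟩, hr⟩ y hy
    have h1 : ∀ᶠ t in 𝓝 r, cutoffForce W (γ t).1 < 0 :=
      hGc.continuousAt.eventually_lt continuousAt_const (hGneg r (hs r hr) hr1)
    obtain ⟨δ, hδ, hball⟩ := Metric.eventually_nhds_iff.1 h1
    set z := min y (r + δ / 2) with hz
    have hrz : r < z := lt_min hy (by linarith)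
    have hq' : AntitoneOn (fun t => (γ t).2) (Icc r z) := by
      refine antitoneOn_of_deriv_nonpos (convex_Icc r z) hqc.continuousOn
        (fun t _ => (hq t).differentiableAt.differentiableWithinAt) fun t ht => ?_
      rw [interior_Icc] at ht
      rw [(hq t).deriv]
      refine (hball ?_).le
      rw [Real.dist_eq, abs_lt]
      constructor <;> linarith [ht.1, ht.2, min_le_right y (r + δ / 2)]
    have hq'' : ∀ t ∈ Icc r z, (γ t).2 ≤ 0 := fun t ht =>
      (hq' (left_mem_Icc.2 hrz.le) ht ht.1).trans hr2
    refine ⟨z, ⟨?_, hq'' z (right_mem_Icc.2 hrz.le)⟩, hrz, min_le_left _ _⟩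
    exact (hanti r z (fun t ht => hq'' t (Ioo_subset_Icc_self ht)) (left_mem_Icc.2 hrz.le)
      (right_mem_Icc.2 hrz.le) hrz.le).trans hr1
  have hqanti : ∀ s, 0 ≤ s → (∀ t ∈ Ico 0 s, 0 < (γ t).1) →
      StrictAntiOn (fun t => (γ t).2) (Icc 0 s) := by
    intro s hs0 hs
    refine strictAntiOn_of_deriv_neg (convex_Icc 0 s) hqc.continuousOn fun t ht => ?_
    rw [interior_Icc] at ht
    rw [(hq t).deriv]
    exact hGneg t (hs t (Ioo_subset_Ico_self ht)) (hstay s hs0 hs t (Ioo_subset_Icc_self ht)).1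
  -- A concave decreasing function cannot stay positive.
  have hex : ∃ t, 0 ≤ t ∧ (γ t).1 ≤ 0 := by
    by_contra! hcon
    have hq1 : (γ 1).2 < 0 := by
      have := hqanti 1 zero_le_one (fun t ht => hcon t ht.1) (left_mem_Icc.2 zero_le_one)
        (right_mem_Icc.2 zero_le_one) one_pos
      simp only [hq0] at this
      exact this
    set L := 1 + (γ 1).1 / (-(γ 1).2) with hL
    have hL1 : 1 ≤ L := by
      have : 0 ≤ (γ 1).1 / (-(γ 1).2) := div_nonneg (hcon 1 zero_le_one).le (by linarith)
      linarith
    have h1 := (convex_Icc (1 : ℝ) L).image_sub_le_mul_sub_of_deriv_le (f := fun t => (γ t).1)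
      hvc.continuousOn (fun t _ => (hv t).differentiableAt.differentiableWithinAt)
      (C := (γ 1).2) (fun t ht => by
        rw [interior_Icc] at ht
        rw [(hv t).deriv]
        exact (hqanti L (by linarith) (fun t ht => hcon t ht.1)).antitoneOn
          ⟨zero_le_one, hL1⟩ ⟨by linarith [ht.1], ht.2.le⟩ ht.1.le)
      1 (left_mem_Icc.2 hL1) L (right_mem_Icc.2 hL1) hL1
    have h2 : (γ 1).2 * (L - 1) = -(γ 1).1 := by
      have hne : (γ 1).2 ≠ 0 := hq1.ne
      rw [hL, add_sub_cancel_left, div_neg, mul_neg, mul_div_cancel₀ _ hne]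
    have h3 := hcon L (by linarith)
    linarith
  obtain ⟨t₁, ht₁, hvt₁⟩ := hex
  have hAc : IsCompact (Icc 0 t₁ ∩ {t | (γ t).1 ≤ 0}) :=
    isCompact_Icc.inter_right (isClosed_le hvc continuous_const)
  obtain ⟨T, ⟨hT, hvT⟩, hmin⟩ := hAc.exists_isLeast ⟨t₁, ⟨ht₁, le_rfl⟩, hvt₁⟩
  have hpos : ∀ t ∈ Ico 0 T, 0 < (γ t).1 := by
    intro t ht
    by_contra! h
    exact absurd (hmin ⟨⟨ht.1, ht.2.le.trans hT.2⟩, h⟩) (not_le.2 ht.2)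
  have hT0 : 0 < T := by
    refine lt_of_le_of_ne hT.1 fun h => ?_
    rw [← h] at hvT
    simp only [mem_ofPred_eq, hv0] at hvT
    linarith [hμ.1]
  have hT1 := hstay T hT0.le hpos
  have hvT0 : (γ T).1 = 0 := by
    refine le_antisymm hvT ?_
    have h1 : Tendsto (fun t => (γ t).1) (𝓝[<] T) (𝓝 (γ T).1) :=
      hvc.continuousAt.mono_left nhdsWithin_le_nhds
    refine ge_of_tendsto h1 ?_
    filter_upwards [Ioo_mem_nhdsLT hT0] with t ht
    exact (hpos t (Ioo_subset_Ico_self ht)).le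
  refine ⟨T, hT0, fun t ht => ⟨hpos t ht, (hT1 t (Ico_subset_Icc_self ht)).1⟩, hvT0, ?_⟩
  -- Conservation of energy determines the slope at the zero.
  have hen : ∀ t ∈ Icc 0 T, (γ t).2 ^ 2 / 2 - W (γ t).1 = (γ 0).2 ^ 2 / 2 - W (γ 0).1 := by
    refine constant_of_derivWithin_zero (f := fun t => (γ t).2 ^ 2 / 2 - W (γ t).1) ?_ ?_
    · have h1 : Differentiable ℝ fun t => (γ t).2 := fun t => (hq t).differentiableAt
      have h2 : Differentiable ℝ fun t => (γ t).1 := fun t => (hv t).differentiableAt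
      have h3 := hW.differentiable
      exact (((h1.pow 2).div_const 2).sub (h3.comp h2)).differentiableOn
    · intro t ht
      have hWd : HasDerivAt W (deriv W (γ t).1) (γ t).1 := (hW.differentiable _).hasDerivAt
      have h1 := (((hq t).pow 2).div_const 2).sub (hWd.comp t (hv t))
      have h2 : derivWithin (fun t => (γ t).2 ^ 2 / 2 - W (γ t).1) (Icc 0 T) t = _ :=
        h1.hasDerivWithinAt.derivWithin (uniqueDiffOn_Icc hT0 t (Ico_subset_Icc_self ht))
      rw [h2, cutoffForce_eq ⟨by linarith [hpos t ht],
        by linarith [(hT1 t (Ico_subset_Icc_self ht)).1, hμ.2]⟩]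
      push_cast
      ring
  have h1 := hen T (right_mem_Icc.2 hT0.le)
  rw [hvT0, hv0, hq0] at h1
  have h2 : 2 * (W 0 - W μ) = (-(γ T).2) ^ 2 := by
    rw [neg_sq]
    linarith
  rw [h2, Real.sqrt_sq (by linarith [(hT1 T (right_mem_Icc.2 hT0.le)).2]), neg_neg]

theorem IsDoubleWell.isProfile_of_first_zero (hW : IsDoubleWell W) {γ : ℝ → ℝ × ℝ} {μ T p : ℝ}
    (hμ : μ ∈ Ioo (0 : ℝ) 1) (h0 : γ 0 = (μ, 0))
    (hγ : ∀ t, HasDerivAt γ (phaseField W (γ t)) t) (hT : 0 < T)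
    (hpos : ∀ t ∈ Ico 0 T, (γ t).1 ∈ Ioc 0 μ) (hT0 : (γ T).1 = 0) (hp : (γ T).2 = -p) :
    IsProfile W (fun t => (γ t).1) T p := by
  have hv : ∀ t, HasDerivAt (fun t => (γ t).1) (γ t).2 t := fun t => (hγ t).fst
  have hq : ∀ t, HasDerivAt (fun t => (γ t).2) (cutoffForce W (γ t).1) t := fun t => (hγ t).snd
  have hdv : deriv (fun t => (γ t).1) = fun t => (γ t).2 := funext fun t => (hv t).deriv
  obtain ⟨C, hC⟩ := hW.exists_lipschitzWith_phaseField
  -- The equation is invariant under time reversal, and so is the solution starting at rest.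
  have hsymm : γ = fun t => ((γ (-t)).1, -(γ (-t)).2) := by
    refine ODE_solution_unique_univ (v := fun _ => phaseField W) (s := fun _ => univ) (t₀ := 0)
      (fun _ => hC.lipschitzOnWith) (fun t => ⟨hγ t, mem_univ _⟩)
      (fun t => ⟨?_, mem_univ _⟩) (by simp [h0])
    have h1 : HasDerivAt (fun t => (γ (-t)).1) (-(γ (-t)).2) t := by
      have h := (hv (-t)).scomp t (hasDerivAt_neg t)
      rwa [neg_one_smul] at h
    have h2 : HasDerivAt (fun t => -(γ (-t)).2) (cutoffForce W (γ (-t)).1) t := by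
      have h := ((hq (-t)).scomp t (hasDerivAt_neg t)).neg
      rwa [neg_one_smul, neg_neg] at h
    exact h1.prodMk h2
  have hv' : ∀ t, (γ (-t)).1 = (γ t).1 := fun t => by
    conv_rhs => rw [hsymm]
  have hq' : ∀ t, (γ (-t)).2 = -(γ t).2 := fun t => by
    conv_rhs => rw [hsymm]
    simp
  have habs : ∀ t, (γ |t|).1 = (γ t).1 := fun t => by
    rcases abs_choice t with h | h <;> rw [h]
    exact hv' t
  have hmem : ∀ t ∈ Ioo (-T) T, (γ t).1 ∈ Ioo (0 : ℝ) 1 := by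
    intro t ht
    have h1 := hpos |t| ⟨abs_nonneg t, abs_lt.2 ht⟩
    rw [habs] at h1
    exact ⟨h1.1, h1.2.trans_lt hμ.2⟩
  refine ⟨contDiff_fst.comp (contDiff_of_hasDerivAt hW.contDiff_phaseField hγ), hT, hmem, hT0,
    by simp only [hv', hT0], by rw [hdv]; exact hp, by rw [hdv]; simp only [hq', hp, neg_neg], ?_⟩
  intro t ht
  rw [hdv, (hq t).deriv]
  refine cutoffForce_eq ?_
  rcases eq_or_lt_of_le ht.1 with h | h
  · simp [← h, hv', hT0]
  rcases eq_or_lt_of_le ht.2 with h' | h'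
  · simp [h', hT0]
  · have := hmem t ⟨h, h'⟩
    exact ⟨by linarith [this.1], this.2.le⟩

/-- For any height below `1` there is a profile attaining it at its centre. -/
theorem IsDoubleWell.exists_isProfile (hW : IsDoubleWell W) {μ : ℝ} (hμ : μ ∈ Ioo (0 : ℝ) 1) :
    ∃ V T p, IsProfile W V T p ∧ V 0 = μ := by
  obtain ⟨γ, hγ⟩ := hW.exists_flow
  obtain ⟨T, hT, h1, h2, h3⟩ := hW.exists_first_zero hμ (hγ μ).1 (hγ μ).2
  exact ⟨_, T, _, hW.isProfile_of_first_zero hμ (hγ μ).1 (hγ μ).2 hT h1 h2 h3, by simp [(hγ μ).1]⟩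

/-- For `A < B` with `B` not too small there are a profile longer than `A` and a profile shorter
than `B` such that the second is the steeper one at its ends. -/
theorem IsDoubleWell.exists_isProfile_pair (hW : IsDoubleWell W) :
    ∃ Λ : ℝ, 0 < Λ ∧ ∀ A B : ℝ, A < B → Λ ≤ B → ∃ V₁ T₁ p₁ V₂ T₂ p₂, IsProfile W V₁ T₁ p₁ ∧
      IsProfile W V₂ T₂ p₂ ∧ A < 2 * T₁ ∧ 2 * T₂ < B ∧ p₁ < p₂ := by
  obtain ⟨γ, hγ⟩ := hW.exists_flow
  obtain ⟨C, hC⟩ := hW.exists_lipschitzWith_phaseField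
  have hfz : ∀ μ : ℝ, ∃ T : ℝ, μ ∈ Ioo (0 : ℝ) 1 → 0 < T ∧ (∀ t ∈ Ico 0 T, (γ μ t).1 ∈ Ioc 0 μ) ∧
      (γ μ T).1 = 0 ∧ (γ μ T).2 = -√(2 * (W 0 - W μ)) := by
    intro μ
    by_cases hμ : μ ∈ Ioo (0 : ℝ) 1
    · obtain ⟨T, h⟩ := hW.exists_first_zero hμ (hγ μ).1 (hγ μ).2
      exact ⟨T, fun _ => h⟩
    · exact ⟨0, fun h => absurd h hμ⟩
  choose T hT using hfz
  have hgc : ∀ μ, Continuous (γ μ) := fun μ =>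
    continuous_iff_continuousAt.2 fun t => ((hγ μ).2 t).continuousAt
  have hgron : ∀ (f : ℝ → ℝ × ℝ) (ν s : ℝ), (∀ t, HasDerivAt f (phaseField W (f t)) t) →
      ∀ t ∈ Icc 0 s, |(f t).1 - (γ ν t).1| ≤ dist (f 0) (ν, 0) * Real.exp (C * s) := by
    intro f ν s hf t ht
    have h1 := dist_le_of_trajectories_ODE (v := fun _ => phaseField W) (fun _ => hC)
      (continuous_iff_continuousAt.2 fun t => (hf t).continuousAt).continuousOn
      (fun t _ => (hf t).hasDerivWithinAt) (hgc ν).continuousOn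
      (fun t _ => ((hγ ν).2 t).hasDerivWithinAt) (a := 0) (b := s)
      (δ := dist (f 0) (ν, 0)) (by rw [(hγ ν).1]) t ht
    have h2 : |(f t).1 - (γ ν t).1| ≤ dist (f t) (γ ν t) := by
      rw [← Real.dist_eq, Prod.dist_eq]
      exact le_max_left _ _
    refine h2.trans (h1.trans ?_)
    gcongr
    linarith [ht.2]
  have hdist : ∀ μ ν : ℝ, dist (γ μ 0) (ν, 0) = |ν - μ| := by
    intro μ ν
    rw [(hγ μ).1, Prod.dist_eq, dist_self, Real.dist_eq, abs_sub_comm]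
    exact max_eq_left (abs_nonneg _)
  have hgt : ∀ μ ∈ Ioo (0 : ℝ) 1, ∀ s, 0 ≤ s → (∀ t ∈ Icc 0 s, 0 < (γ μ t).1) → s < T μ := by
    intro μ hμ s hs h
    by_contra! h1
    exact (h (T μ) ⟨(hT μ hμ).1.le, h1⟩).ne' (hT μ hμ).2.2.1
  have hopen_gt : ∀ s, 0 ≤ s → IsOpen {μ | μ ∈ Ioo (0 : ℝ) 1 ∧ s < T μ} := by
    intro s hs
    refine isOpen_iff_mem_nhds.2 fun μ hμ => ?_
    obtain ⟨m, hm, hmv⟩ := (isCompact_Icc (a := 0) (b := s)).exists_forall_le'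
      (continuous_fst.comp (hgc μ)).continuousOn (a := 0)
      (fun t ht => ((hT μ hμ.1).2.1 t ⟨ht.1, ht.2.trans_lt hμ.2⟩).1)
    have hc : ContinuousAt (fun ν => |ν - μ| * Real.exp (C * s)) μ := by fun_prop
    have h1 : ∀ᶠ ν in 𝓝 μ, |ν - μ| * Real.exp (C * s) < m :=
      hc.eventually_lt continuousAt_const (by simpa using hm)
    filter_upwards [h1, isOpen_Ioo.mem_nhds hμ.1] with ν hν hν1
    refine ⟨hν1, hgt ν hν1 s hs fun t ht => ?_⟩
    have h2 := hgron (γ μ) ν s (hγ μ).2 t ht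
    rw [hdist] at h2
    have h3 := hmv t ht
    simp only [Function.comp_apply] at h3
    linarith [le_abs_self ((γ μ t).1 - (γ ν t).1)]
  have hopen_lt : ∀ s, IsOpen {μ | μ ∈ Ioo (0 : ℝ) 1 ∧ T μ < s} := by
    intro s
    refine isOpen_iff_mem_nhds.2 fun μ ⟨hμ, hs⟩ => ?_
    obtain ⟨hT0, hTpos, hTz, hTq⟩ := hT μ hμ
    -- The solution crosses zero with a negative slope.
    have hslope : (γ μ (T μ)).2 < 0 := by
      rw [hTq, neg_lt_zero, Real.sqrt_pos]
      linarith [hW.strictAntiOn (left_mem_Icc.2 zero_le_one) (Ioo_subset_Icc_self hμ) hμ.1]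
    have hd : HasDerivAt (fun t => (γ μ t).1) (γ μ (T μ)).2 (T μ) := ((hγ μ).2 (T μ)).fst
    have h1 : ∀ᶠ t in 𝓝[>] (T μ), (γ μ t).1 < 0 := by
      have h2 := (hasDerivAt_iff_tendsto_slope.1 hd).mono_left
        (nhdsWithin_mono (T μ) fun t (ht : T μ < t) => ht.ne')
      filter_upwards [h2.eventually_lt_const hslope, self_mem_nhdsWithin] with t ht1 ht2
      rw [slope_def_field, hTz, sub_zero, div_neg_iff] at ht1
      rcases ht1 with h3 | h3
      · exact absurd h3.2 (not_lt.2 (sub_nonneg.2 (le_of_lt ht2)))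
      · exact h3.1
    obtain ⟨s', hs'v, hs'⟩ := (h1.and (Ioo_mem_nhdsGT hs)).exists
    have hc : ContinuousAt (fun ν => |ν - μ| * Real.exp (C * s')) μ := by fun_prop
    have h2 : ∀ᶠ ν in 𝓝 μ, |ν - μ| * Real.exp (C * s') < -(γ μ s').1 :=
      hc.eventually_lt continuousAt_const (by simpa using hs'v)
    filter_upwards [h2, isOpen_Ioo.mem_nhds hμ] with ν hν hν1
    refine ⟨hν1, lt_of_le_of_lt ?_ hs'.2⟩
    by_contra! h3
    have h4 := hgron (γ μ) ν s' (hγ μ).2 s' ⟨(hT0.trans hs'.1).le, le_rfl⟩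
    rw [hdist] at h4
    have h5 := ((hT ν hν1).2.1 s' ⟨(hT0.trans hs'.1).le, h3⟩).1
    linarith [neg_abs_le ((γ μ s').1 - (γ ν s').1)]
  -- Solutions starting near the equilibrium `1` stay positive for a long time.
  have hunb : ∀ s, 0 ≤ s → ∃ μ ∈ Ioo (0 : ℝ) 1, s < T μ := by
    intro s hs
    have hconst : ∀ t : ℝ, HasDerivAt (fun _ : ℝ => ((1, 0) : ℝ × ℝ)) (phaseField W (1, 0)) t := by
      intro t
      have : phaseField W (1, 0) = 0 := by
        simp [phaseField, cutoffForce_eq, hW.deriv_one]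
      rw [this]
      exact hasDerivAt_const _ _
    have hc : ContinuousAt (fun ν => |ν - 1| * Real.exp (C * s)) 1 := by fun_prop
    have h1 : ∀ᶠ ν in 𝓝[<] (1 : ℝ), |ν - 1| * Real.exp (C * s) < 1 :=
      (hc.eventually_lt continuousAt_const (by simp)).filter_mono nhdsWithin_le_nhds
    obtain ⟨μ, hμ1, hμ⟩ := (h1.and (Ioo_mem_nhdsLT zero_lt_one)).exists
    refine ⟨μ, hμ, hgt μ hμ s hs fun t ht => ?_⟩
    have h2 := hgron (fun _ => (1, 0)) μ s hconst t ht
    have h3 : dist ((1, 0) : ℝ × ℝ) (μ, 0) = |μ - 1| := by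
      rw [Prod.dist_eq, dist_self, Real.dist_eq, abs_sub_comm]
      exact max_eq_left (abs_nonneg _)
    rw [h3] at h2
    simp only at h2
    linarith [le_abs_self (1 - (γ μ t).1)]
  have hhalf : (1 / 2 : ℝ) ∈ Ioo (0 : ℝ) 1 := by constructor <;> norm_num
  have hTh := (hT (1 / 2) hhalf).1
  refine ⟨2 * T (1 / 2) + 1, by linarith, fun A B hAB hB => ?_⟩
  set A' := max A 0 with hA'
  have hA'B : A' < B := max_lt hAB (by linarith)
  have hA'0 : 0 ≤ A' := le_max_right _ _
  obtain ⟨μ₀, hμ₀, hμ₀A⟩ := hunb (A' / 2) (by linarith)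
  -- Some profile has its length in the interval, by connectedness; any higher one is steeper.
  obtain ⟨μ₁, -, ⟨hμ₁, h1A⟩, -, h1B⟩ := isPreconnected_Ioo (a := (0 : ℝ)) (b := 1)
    {μ | μ ∈ Ioo (0 : ℝ) 1 ∧ A' / 2 < T μ} {μ | μ ∈ Ioo (0 : ℝ) 1 ∧ T μ < B / 2}
    (hopen_gt _ (by linarith)) (hopen_lt _)
    (fun μ hμ => by
      rcases lt_or_ge (A' / 2) (T μ) with h | h
      · exact Or.inl ⟨hμ, h⟩
      · exact Or.inr ⟨hμ, by linarith⟩)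
    ⟨μ₀, hμ₀, hμ₀, hμ₀A⟩ ⟨1 / 2, hhalf, hhalf, by linarith⟩
  have hev : ∀ᶠ μ in 𝓝[>] μ₁, μ ∈ Ioo (0 : ℝ) 1 ∧ T μ < B / 2 :=
    nhdsWithin_le_nhds ((hopen_lt (B / 2)).mem_nhds ⟨hμ₁, h1B⟩)
  obtain ⟨μ₂, ⟨hμ₂, h2B⟩, h12⟩ := (hev.and self_mem_nhdsWithin).exists
  have hprof : ∀ μ ∈ Ioo (0 : ℝ) 1,
      IsProfile W (fun t => (γ μ t).1) (T μ) (√(2 * (W 0 - W μ))) := fun μ hμ =>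
    hW.isProfile_of_first_zero hμ (hγ μ).1 (hγ μ).2 (hT μ hμ).1 (hT μ hμ).2.1 (hT μ hμ).2.2.1
      (hT μ hμ).2.2.2
  refine ⟨_, _, _, _, _, _, hprof μ₁ hμ₁, hprof μ₂ hμ₂, ?_, by linarith, ?_⟩
  · linarith [le_max_left A 0]
  · have h3 := hW.strictAntiOn (Ioo_subset_Icc_self hμ₁) (Ioo_subset_Icc_self hμ₂) h12
    have h4 := hW.strictAntiOn (left_mem_Icc.2 zero_le_one) (Ioo_subset_Icc_self hμ₁) hμ₁.1
    exact Real.sqrt_lt_sqrt (by linarith) (by linarith)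

end Profile

/-! ### Comparison with profiles -/

section OneSided

theorem HasDerivAt.nonneg_of_eventually_right {f : ℝ → ℝ} {d c : ℝ} (h : HasDerivAt f d c)
    (h0 : f c = 0) (hf : ∀ᶠ t in 𝓝[>] c, 0 ≤ f t) : 0 ≤ d := by
  have h1 := (hasDerivAt_iff_tendsto_slope.1 h).mono_left
    (nhdsWithin_mono c fun t (ht : t ∈ Ioi c) => ne_of_gt ht)
  refine ge_of_tendsto h1 ?_
  filter_upwards [hf, self_mem_nhdsWithin] with t ht htc
  rw [slope_def_field, h0, sub_zero]
  exact div_nonneg ht (sub_nonneg.2 (le_of_lt htc))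

theorem HasDerivAt.nonpos_of_eventually_left {f : ℝ → ℝ} {d c : ℝ} (h : HasDerivAt f d c)
    (h0 : f c = 0) (hf : ∀ᶠ t in 𝓝[<] c, 0 ≤ f t) : d ≤ 0 := by
  have h1 := (hasDerivAt_iff_tendsto_slope.1 h).mono_left
    (nhdsWithin_mono c fun t (ht : t ∈ Iio c) => ne_of_lt ht)
  refine le_of_tendsto h1 ?_
  filter_upwards [hf, self_mem_nhdsWithin] with t ht htc
  rw [slope_def_field, h0, sub_zero]
  exact div_nonpos_of_nonneg_of_nonpos ht (sub_nonpos.2 (le_of_lt htc))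

end OneSided

section Scaling

variable {V : ℝ → ℝ}

theorem hasDerivAt_scaled (hV : ContDiff ℝ ∞ V) (k c r d t : ℝ) :
    HasDerivAt (fun t => k * V ((t - c) / r + d)) (k / r * deriv V ((t - c) / r + d)) t := by
  have h1 : HasDerivAt (fun t : ℝ => (t - c) / r + d) (1 / r) t :=
    (((hasDerivAt_id t).sub_const c).div_const r).add_const d
  have h2 := (((hV.differentiable (by simp)) _).hasDerivAt.comp t h1).const_mul k
  refine h2.congr_deriv ?_
  ring

theorem contDiff_scaled (hV : ContDiff ℝ ∞ V) (k c r : ℝ) :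
    ContDiff ℝ ∞ (fun t => k * V ((t - c) / r)) :=
  contDiff_const.mul (hV.comp ((contDiff_id.sub contDiff_const).div_const r))

theorem deriv_deriv_scaled (hV : ContDiff ℝ ∞ V) (k c r t : ℝ) :
    deriv (deriv fun t => k * V ((t - c) / r)) t = k / r ^ 2 * deriv (deriv V) ((t - c) / r) := by
  have h1 : deriv (fun t => k * V ((t - c) / r)) = fun t => k / r * deriv V ((t - c) / r) := by
    funext s
    have := (hasDerivAt_scaled hV k c r 0 s).deriv
    simpa only [add_zero] using this
  have hV' : ContDiff ℝ ∞ (deriv V) := hV.iterate_deriv 1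
  have h2 := (hasDerivAt_scaled hV' (k / r) c r 0 t).deriv
  simp only [add_zero] at h2
  rw [h1, h2, div_div, sq]

end Scaling

section Comparison

variable {n : ℕ} {M : Type*} [EMetricSpace M] [ChartedSpace (EuclideanSpace ℝ (Fin n)) M]
  [RiemannianBundle (fun x : M => TangentSpace (𝓡 n) x)]

theorem gradNormSq_neg (f : M → ℝ) (x : M) : gradNormSq n (fun y => -f y) x = gradNormSq n f x := by
  have h : differential n (fun y => -f y) x = -differential n f x := mfderiv_neg
  unfold gradNormSq
  rw [h]
  exact congrArg (· ^ 2) (norm_neg (E := TangentSpace (𝓡 n) x →L[ℝ] ℝ) _)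

theorem prodGradNormSq_neg (f : Circle × M → ℝ) (p : Circle × M) :
    prodGradNormSq n (fun q => -f q) p = prodGradNormSq n f p := by
  unfold prodGradNormSq
  rw [gradNormSq_neg, deriv.fun_neg, neg_sq]

variable [MeasurableSpace M] {W : ℝ → ℝ} {ε : ℝ} {u : Circle × M → ℝ}

/-- The energy of an even potential does not see the sign of `u`. -/
theorem IsPhaseTransition.neg (hW : IsDoubleWell W) (hu : IsPhaseTransition n W ε u) :
    IsPhaseTransition n W ε (fun p => -u p) where
  smooth := hu.smooth.neg
  mem_Icc p := ⟨by linarith [(hu.mem_Icc p).2], by linarith [(hu.mem_Icc p).1]⟩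
  critical φ hφ := by
    have h := hu.critical (fun p => -φ p) hφ.neg
    refine h.congr_of_eventuallyEq (Eventually.of_forall fun t => ?_)
    have h1 : (fun p => -u p + t * φ p) = fun p => -(u p + t * -φ p) := by
      funext p
      ring
    simp only [h1, energy]
    refine integral_congr_ae (Eventually.of_forall fun p => ?_)
    simp only [prodGradNormSq_neg]
    rw [hW.even (-u p + t * φ p), neg_add, neg_neg, mul_neg]

theorem IsPhaseTransition.continuous_lift (hu : IsPhaseTransition n W ε u) :
    Continuous fun q : ℝ × M => u (Circle.exp q.1, q.2) :=
  hu.smooth.continuous.comp ((Circle.exp.continuous.comp continuous_fst).prodMk continuous_snd)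

variable [CompactSpace M] [BorelSpace M] [IsManifold (𝓡 n) ∞ M]
  [IsContinuousRiemannianBundle (EuclideanSpace ℝ (Fin n)) (fun x : M => TangentSpace (𝓡 n) x)]

/-- A profile stretched slightly more than `u` lies below `u` wherever `u` is positive on its
support: the multiples of the profile are subsolutions by monotonicity of `W' (x) / x`, so that the
largest multiple below `u` cannot touch `u`. -/
theorem IsPhaseTransition.profile_le (hW : IsDoubleWell W) (hε : 0 < ε)
    (hu : IsPhaseTransition n W ε u) {V : ℝ → ℝ} {T p : ℝ} (hV : IsProfile W V T p) {r : ℝ}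
    (hr : ε < r) {K : Set M} (hK : IsClopen K) {c : ℝ} (hlen : 2 * (r * T) < 2 * Real.pi)
    (hpos : ∀ t ∈ Icc (c - r * T) (c + r * T), ∀ x ∈ K, 0 < u (Circle.exp t, x)) :
    ∀ t ∈ Icc (c - r * T) (c + r * T), ∀ x ∈ K, V ((t - c) / r) ≤ u (Circle.exp t, x) := by
  have hr0 : 0 < r := hε.trans hr
  intro t₀ ht₀ x₀ hx₀
  by_contra! hlt
  have hS : IsCompact (Icc (c - r * T) (c + r * T) ×ˢ K) := isCompact_Icc.prod hK.isClosed.isCompact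
  have hcont : ContinuousOn (fun q : ℝ × M => V ((q.1 - c) / r) / u (Circle.exp q.1, q.2))
      (Icc (c - r * T) (c + r * T) ×ˢ K) := by
    refine ContinuousOn.div ?_ hu.continuous_lift.continuousOn fun q hq =>
      (hpos q.1 hq.1 q.2 hq.2).ne'
    have := hV.smooth.continuous
    fun_prop
  obtain ⟨⟨t₁, x₁⟩, ⟨ht₁, hx₁⟩, hmax⟩ := hS.exists_isMaxOn ⟨(t₀, x₀), ht₀, hx₀⟩ hcont
  set R := V ((t₁ - c) / r) / u (Circle.exp t₁, x₁) with hR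
  have hR1 : 1 < R := ((one_lt_div (hpos t₀ ht₀ x₀ hx₀)).2 hlt).trans_le
    (hmax (mk_mem_prod ht₀ hx₀))
  have hR0 : 0 < R := zero_lt_one.trans hR1
  have hend : ∀ x ∈ K, ∀ t, V ((t - c) / r) = 0 → t ∈ Icc (c - r * T) (c + r * T) →
      R⁻¹ * V ((t - c) / r) < u (Circle.exp t, x) := by
    intro x hx t ht htm
    rw [ht, mul_zero]
    exact hpos t htm x hx
  have hle : c - r * T ≤ c + r * T := by nlinarith [mul_pos hr0 hV.pos_length]
  refine hu.not_touch hW.smooth hε hK (a := c - r * T) (b := c + r * T) (by linarith)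
    (contDiff_scaled hV.smooth R⁻¹ c r) (fun t ht x hx => ?_)
    (fun x hx => hend x hx _ ?_ (left_mem_Icc.2 hle))
    (fun x hx => hend x hx _ ?_ (right_mem_Icc.2 hle)) (fun t ht x hx htx => ?_) ht₁ hx₁ ?_
  · have h1 : V ((t - c) / r) / u (Circle.exp t, x) ≤ R := hmax (mk_mem_prod ht hx)
    rw [div_le_iff₀ (hpos t ht x hx)] at h1
    rwa [inv_mul_le_iff₀ hR0]
  · rw [show (c - r * T - c) / r = -T by field_simp; ring]
    exact hV.left_end
  · rw [show (c + r * T - c) / r = T by field_simp; ring]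
    exact hV.right_end
  · have hsI : (t - c) / r ∈ Icc (-T) T := by
      rw [Set.mem_Icc, le_div_iff₀ hr0, div_le_iff₀ hr0]
      constructor <;> linarith [ht.1, ht.2]
    have hV0 : 0 < V ((t - c) / r) := by
      have := hpos t ht x hx
      rw [htx] at this
      exact pos_of_mul_pos_right this (inv_nonneg.2 hR0.le)
    have hv : V ((t - c) / r) ∈ Ioo (0 : ℝ) 1 := by
      refine hV.mem_Ioo _ ⟨lt_of_le_of_ne hsI.1 fun h => ?_, lt_of_le_of_ne hsI.2 fun h => ?_⟩
      · rw [← h, hV.left_end] at hV0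
        exact lt_irrefl _ hV0
      · rw [h, hV.right_end] at hV0
        exact lt_irrefl _ hV0
    rw [deriv_deriv_scaled hV.smooth, hV.equation _ hsI]
    have h1 := hW.deriv_mul_le (τ := R⁻¹) ⟨inv_pos.2 hR0, inv_le_one_of_one_le₀ hR1.le⟩ hv
    have h2 : R⁻¹ * deriv W (V ((t - c) / r)) < 0 :=
      mul_neg_of_pos_of_neg (inv_pos.2 hR0) (hW.deriv_lt_zero hv)
    have h3 : (ε / r) ^ 2 < 1 := by
      rw [sq_lt_one_iff₀ (div_nonneg hε.le hr0.le)]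
      exact (div_lt_one hr0).2 hr
    calc _ ≤ R⁻¹ * deriv W (V ((t - c) / r)) := h1
      _ < (ε / r) ^ 2 * (R⁻¹ * deriv W (V ((t - c) / r))) := by nlinarith
      _ = _ := by ring
  · have h1 := hpos t₁ ht₁ x₁ hx₁
    rw [eq_inv_mul_iff_mul_eq₀ hR0.ne', hR, div_mul_cancel₀ _ h1.ne']

/-- A profile stretched slightly less than `u` lies above `-u` on any interval in its support at
whose ends `u` is nonnegative: the smallest multiple of the profile that lies above `-u` cannot
touch it. -/
theorem IsPhaseTransition.neg_le_profile (hW : IsDoubleWell W) (hε : 0 < ε)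
    (hu : IsPhaseTransition n W ε u) {V : ℝ → ℝ} {T p : ℝ} (hV : IsProfile W V T p) {r : ℝ}
    (hr0 : 0 < r) (hr : r < ε) {K : Set M} (hK : IsClopen K) {a b c : ℝ}
    (hlen : b - a < 2 * Real.pi) (ha : c - r * T < a) (hb : b < c + r * T)
    (hua : ∀ x ∈ K, 0 ≤ u (Circle.exp a, x)) (hub : ∀ x ∈ K, 0 ≤ u (Circle.exp b, x)) :
    ∀ t ∈ Icc a b, ∀ x ∈ K, -u (Circle.exp t, x) ≤ V ((t - c) / r) := by
  intro t₀ ht₀ x₀ hx₀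
  by_contra! hlt
  have hmem : ∀ t ∈ Icc a b, (t - c) / r ∈ Ioo (-T) T := by
    intro t ht
    rw [mem_Ioo, lt_div_iff₀ hr0, div_lt_iff₀ hr0]
    constructor <;> linarith [ht.1, ht.2]
  have hv : ∀ t ∈ Icc a b, V ((t - c) / r) ∈ Ioo (0 : ℝ) 1 := fun t ht => hV.mem_Ioo _ (hmem t ht)
  have hS : IsCompact (Icc a b ×ˢ K) := isCompact_Icc.prod hK.isClosed.isCompact
  have hcont : ContinuousOn (fun q : ℝ × M => -u (Circle.exp q.1, q.2) / V ((q.1 - c) / r))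
      (Icc a b ×ˢ K) := by
    refine ContinuousOn.div hu.continuous_lift.neg.continuousOn ?_ fun q hq => (hv q.1 hq.1).1.ne'
    have := hV.smooth.continuous
    fun_prop
  obtain ⟨⟨t₁, x₁⟩, ⟨ht₁, hx₁⟩, hmax⟩ := hS.exists_isMaxOn ⟨(t₀, x₀), ht₀, hx₀⟩ hcont
  set R := -u (Circle.exp t₁, x₁) / V ((t₁ - c) / r) with hR
  have hR1 : 1 < R := ((one_lt_div (hv t₀ ht₀).1).2 hlt).trans_le
    (hmax (mk_mem_prod ht₀ hx₀))
  have hab : a ≤ b := ht₀.1.trans ht₀.2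
  have hneg : ∀ t ∈ Icc a b, -R * V ((t - c) / r) < 0 := fun t ht =>
    mul_neg_of_neg_of_pos (by linarith) (hv t ht).1
  refine hu.not_touch hW.smooth hε hK (a := a) (b := b) hlen
    (contDiff_scaled hV.smooth (-R) c r) (fun t ht x hx => ?_)
    (fun x hx => (hneg a (left_mem_Icc.2 hab)).trans_le (hua x hx))
    (fun x hx => (hneg b (right_mem_Icc.2 hab)).trans_le (hub x hx))
    (fun t ht x hx htx => ?_) ht₁ hx₁ ?_
  · have h1 : -u (Circle.exp t, x) / V ((t - c) / r) ≤ R := hmax (mk_mem_prod ht hx)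
    rw [div_le_iff₀ (hv t ht).1] at h1
    linarith
  · rw [deriv_deriv_scaled hV.smooth, hV.equation _ (Ioo_subset_Icc_self (hmem t ht)), neg_mul,
      hW.deriv_neg]
    have h1 := hW.mul_deriv_le hR1.le (hv t ht) (by linarith [(hu.mem_Icc (Circle.exp t, x)).1])
    have h2 : R * deriv W (V ((t - c) / r)) < 0 :=
      mul_neg_of_pos_of_neg (by linarith) (hW.deriv_lt_zero (hv t ht))
    have h3 : 1 < (ε / r) ^ 2 := by
      rw [one_lt_sq_iff₀ (div_nonneg hε.le hr0.le)]
      exact (one_lt_div hr0).2 hr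
    calc _ ≤ -(R * deriv W (V ((t - c) / r))) := neg_le_neg h1
      _ < (ε / r) ^ 2 * -(R * deriv W (V ((t - c) / r))) := by nlinarith
      _ = _ := by ring
  · rw [hR, neg_mul, div_mul_cancel₀ _ (hv t₁ ht₁).1.ne', neg_neg]

/-- A solution cannot be nonnegative at the ends of an interval, vanish at its right end, and be
positive on a longer interval to the right: the profile that fits into the longer interval bounds
its slope at the zero from below, and the one that covers the shorter interval bounds it from above
by a smaller number. -/
theorem IsPhaseTransition.exists_forall_slope_obstruction (hW : IsDoubleWell W) :
    ∃ Λ : ℝ, 0 < Λ ∧ ∀ (ε : ℝ) (u : Circle × M → ℝ), 0 < ε → IsPhaseTransition n W ε u →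
      ∀ (K : Set M) (a c b : ℝ) (x₀ : M), IsClopen K → x₀ ∈ K → a < c → c - a < b - c →
      b - c < 2 * Real.pi → Λ * ε ≤ b - c → (∀ x ∈ K, 0 ≤ u (Circle.exp a, x)) →
      (∀ x ∈ K, 0 ≤ u (Circle.exp c, x)) → u (Circle.exp c, x₀) = 0 →
      ¬ ∀ t ∈ Ioc c b, ∀ x ∈ K, 0 < u (Circle.exp t, x) := by
  obtain ⟨Λ, hΛ, H⟩ := hW.exists_isProfile_pair
  refine ⟨Λ, hΛ, fun ε u hε hu K a c b x₀ hK hx₀ hac hlen hbc hΛε hua huc hzero hpos => ?_⟩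
  obtain ⟨V₁, T₁, p₁, V₂, T₂, p₂, hV₁, hV₂, hT₁, hT₂, hp⟩ := H ((c - a) / ε) ((b - c) / ε)
    ((div_lt_div_iff_of_pos_right hε).2 hlen) ((le_div_iff₀ hε).2 hΛε)
  rw [div_lt_iff₀ hε] at hT₁
  rw [lt_div_iff₀ hε] at hT₂
  obtain ⟨r₁, r₂, hr₁, hr₁ε, hr₂ε, h₁, h₂, h₃⟩ : ∃ r₁ r₂, 0 < r₁ ∧ r₁ < ε ∧ ε < r₂ ∧
      c - a < 2 * T₁ * r₁ ∧ 2 * T₂ * r₂ < b - c ∧ p₁ / r₁ < p₂ / r₂ := by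
    have e0 : ∀ᶠ s in 𝓝 (0 : ℝ), 0 < ε - s :=
      (continuous_const.sub continuous_id).continuousAt.eventually_const_lt (by simpa using hε)
    have e1 : ∀ᶠ s in 𝓝 (0 : ℝ), c - a < 2 * T₁ * (ε - s) :=
      (Continuous.continuousAt (by fun_prop)).eventually_const_lt (by simpa using hT₁)
    have e2 : ∀ᶠ s in 𝓝 (0 : ℝ), 2 * T₂ * (ε + s) < b - c :=
      (Continuous.continuousAt (by fun_prop)).eventually_lt_const (by simpa using hT₂)
    have e3 : ∀ᶠ s in 𝓝 (0 : ℝ), p₁ / (ε - s) < p₂ / (ε + s) := by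
      refine ContinuousAt.eventually_lt ?_ ?_ ?_
      · exact continuousAt_const.div (by fun_prop) (by simpa using hε.ne')
      · exact continuousAt_const.div (by fun_prop) (by simpa using hε.ne')
      · simpa using (div_lt_div_iff_of_pos_right hε).2 hp
    obtain ⟨s, ⟨⟨⟨h0, h1⟩, h2⟩, h3⟩, hs⟩ := ((((e0.and e1).and e2).and e3).filter_mono
      nhdsWithin_le_nhds |>.and (self_mem_nhdsWithin (s := Ioi (0 : ℝ)))).exists
    have hs' : 0 < s := hs
    exact ⟨ε - s, ε + s, h0, by linarith, by linarith, h1, h2, h3⟩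
  have hr₂ : 0 < r₂ := hε.trans hr₂ε
  have hT₂0 := hV₂.pos_length
  -- The profiles are first shifted by `η > 0`, to keep them away from the zero of `u`.
  have hleft : ∀ t ∈ Icc a c, -u (Circle.exp t, x₀) ≤ V₁ ((t - c) / r₁ + T₁) := by
    intro t ht
    have hlim : Tendsto (fun η => V₁ ((t - (c + η - r₁ * T₁)) / r₁)) (𝓝[>] 0)
        (𝓝 (V₁ ((t - (c + 0 - r₁ * T₁)) / r₁))) := by
      refine Tendsto.mono_left (Continuous.tendsto ?_ 0) nhdsWithin_le_nhds
      have := hV₁.smooth.continuous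
      fun_prop
    rw [show (t - (c + 0 - r₁ * T₁)) / r₁ = (t - c) / r₁ + T₁ by field_simp; ring] at hlim
    refine ge_of_tendsto hlim ?_
    filter_upwards [Ioo_mem_nhdsGT (show (0 : ℝ) < 2 * T₁ * r₁ - (c - a) by linarith)] with η hη
    exact hu.neg_le_profile hW hε hV₁ hr₁ hr₁ε hK (by linarith) (by nlinarith [hη.2])
      (by linarith [hη.1]) hua huc t ht x₀ hx₀
  have hright : ∀ t ∈ Ioo c (c + 2 * T₂ * r₂), V₂ ((t - c) / r₂ + -T₂) ≤ u (Circle.exp t, x₀) := by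
    intro t ht
    have hlim : Tendsto (fun η => V₂ ((t - (c + η + r₂ * T₂)) / r₂)) (𝓝[>] 0)
        (𝓝 (V₂ ((t - (c + 0 + r₂ * T₂)) / r₂))) := by
      refine Tendsto.mono_left (Continuous.tendsto ?_ 0) nhdsWithin_le_nhds
      have := hV₂.smooth.continuous
      fun_prop
    rw [show (t - (c + 0 + r₂ * T₂)) / r₂ = (t - c) / r₂ + -T₂ by field_simp; ring] at hlim
    refine le_of_tendsto hlim ?_
    filter_upwards [Ioo_mem_nhdsGT (show (0 : ℝ) < min (t - c) (b - c - 2 * T₂ * r₂) from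
      lt_min (by linarith [ht.1]) (by linarith))] with η hη
    have hη1 := hη.2.trans_le (min_le_left _ _)
    have hη2 := hη.2.trans_le (min_le_right _ _)
    exact hu.profile_le hW hε hV₂ hr₂ε hK (by nlinarith)
      (fun s hs x hx => hpos s ⟨by linarith [hs.1, hη.1], by linarith [hs.2]⟩ x hx) t
      ⟨by linarith, by linarith [ht.2, hη.1]⟩ x₀ hx₀
  have hD := hasDerivAt_angDeriv hu.smooth c x₀
  have hd₁ := hasDerivAt_scaled hV₁.smooth 1 c r₁ T₁ c
  have hd₂ := hasDerivAt_scaled hV₂.smooth 1 c r₂ (-T₂) c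
  simp only [sub_self, zero_div, zero_add, one_mul, hV₁.deriv_right, hV₂.deriv_left] at hd₁ hd₂
  have hle₁ := (hD.add hd₁).nonpos_of_eventually_left
    (by simp [hzero, hV₁.right_end]) (by
      filter_upwards [Ioo_mem_nhdsLT hac] with t ht
      have := hleft t (Ioo_subset_Icc_self ht)
      simp only [Pi.add_apply]
      linarith)
  have hle₂ := (hD.sub hd₂).nonneg_of_eventually_right
    (by simp [hzero, hV₂.left_end]) (by
      filter_upwards [Ioo_mem_nhdsGT (show c < c + 2 * T₂ * r₂ by
        nlinarith [mul_pos hT₂0 hr₂])] with t ht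
      have := hright t ht
      simp only [Pi.sub_apply]
      linarith)
  have e1 : 1 / r₁ * -p₁ = -(p₁ / r₁) := by ring
  have e2 : 1 / r₂ * p₂ = p₂ / r₂ := by ring
  linarith

end Comparison

/-! ### Angles and nodal sets -/

section AngleSets

/-- A set of angles, thought of as a subset of the line that is invariant under translation by
`2π`, whose points are at distance at least `d > 0` from each other. -/
structure IsSeparatedAngleSet (P : Set ℝ) (d : ℝ) : Prop where
  pos : 0 < d
  periodic : ∀ t, t + 2 * Real.pi ∈ P ↔ t ∈ P
  sep : ∀ p ∈ P, ∀ q ∈ P, p < q → d ≤ q - p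

variable {P : Set ℝ} {d : ℝ}

namespace IsSeparatedAngleSet

theorem add_nat_mul (hP : IsSeparatedAngleSet P d) (t : ℝ) (k : ℕ) :
    t + k * (2 * Real.pi) ∈ P ↔ t ∈ P := by
  induction k with
  | zero => simp
  | succ k ih =>
    rw [← ih, ← hP.periodic (t + k * (2 * Real.pi))]
    push_cast
    ring_nf

theorem exists_next (hP : IsSeparatedAngleSet P d) (hPc : IsClosed P) {p : ℝ} (hp : p ∈ P) :
    ∃ q ∈ P, p < q ∧ q - p ≤ 2 * Real.pi ∧ ∀ r ∈ P, r ≤ p ∨ q ≤ r := by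
  have hpi := Real.pi_pos
  have hd := hP.pos
  have hmem : ∀ r ∈ P, p < r → r ∈ P ∩ Ici (p + d) := fun r hr hpr =>
    ⟨hr, by linarith [hP.sep p hp r hr hpr, mem_Ici.2 (le_refl (p + d))] |> mem_Ici.2⟩
  have hbdd : BddBelow (P ∩ Ici (p + d)) := ⟨p + d, fun r hr => hr.2⟩
  have h2 : p + 2 * Real.pi ∈ P ∩ Ici (p + d) :=
    hmem _ ((hP.periodic p).2 hp) (by linarith)
  have hq := (hPc.inter isClosed_Ici).csInf_mem ⟨_, h2⟩ hbdd
  refine ⟨_, hq.1, ?_, ?_, fun r hr => ?_⟩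
  · have : p + d ≤ _ := hq.2
    linarith
  · have := csInf_le hbdd h2
    linarith
  · exact (le_or_gt r p).imp_right fun h => csInf_le hbdd (hmem r hr h)

/-- If the minimal gap occurs, and is followed by another minimal gap wherever it occurs, then the
set is an arithmetic progression. -/
theorem eq_progression (hP : IsSeparatedAngleSet P d) {p₀ : ℝ} (hp₀ : p₀ ∈ P) (hp₁ : p₀ + d ∈ P)
    (hstep : ∀ p ∈ P, p + d ∈ P → p + 2 * d ∈ P) :
    ∃ N : ℕ, 0 < N ∧ N * d = 2 * Real.pi ∧ ∀ t, t ∈ P ↔ ∃ k : ℤ, t = p₀ + k * d := by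
  have hd := hP.pos
  have hpi := Real.two_pi_pos
  have hnat : ∀ k : ℕ, p₀ + k * d ∈ P ∧ p₀ + (k + 1) * d ∈ P := by
    intro k
    induction k with
    | zero => simpa using ⟨hp₀, hp₁⟩
    | succ k ih =>
      have h1 := hstep _ ih.1 (by convert ih.2 using 1; ring)
      push_cast
      refine ⟨ih.2, ?_⟩
      convert h1 using 1
      ring
  have hge : ∀ t ∈ P, p₀ ≤ t → ∃ k : ℕ, t = p₀ + k * d := by
    intro t ht hpt
    refine ⟨⌊(t - p₀) / d⌋₊, ?_⟩
    have h1 := Nat.floor_le (div_nonneg (sub_nonneg.2 hpt) hd.le)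
    have h2 := Nat.lt_floor_add_one ((t - p₀) / d)
    rw [le_div_iff₀ hd] at h1
    rw [div_lt_iff₀ hd] at h2
    refine le_antisymm ?_ (by linarith)
    by_contra! h
    have := hP.sep _ (hnat _).1 t ht h
    linarith
  obtain ⟨N, hN⟩ := hge _ ((hP.periodic p₀).2 hp₀) (by linarith)
  have hN' : N * d = 2 * Real.pi := by linarith
  refine ⟨N, ?_, hN', fun t => ⟨fun ht => ?_, ?_⟩⟩
  · rcases Nat.eq_zero_or_pos N with h | h
    · rw [h] at hN'
      simp at hN'
    · exact h
  · obtain ⟨j, hj⟩ := exists_nat_ge ((p₀ - t) / (2 * Real.pi))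
    rw [div_le_iff₀ hpi] at hj
    obtain ⟨k, hk⟩ := hge _ ((hP.add_nat_mul t j).2 ht) (by linarith)
    refine ⟨k - j * N, ?_⟩
    push_cast
    rw [← hN'] at hk
    linarith
  · rintro ⟨k, rfl⟩
    obtain ⟨j, hj⟩ : ∃ j : ℕ, -k ≤ j := ⟨(-k).toNat, Int.self_le_toNat _⟩
    rw [← hP.add_nat_mul _ j, ← hN']
    have h1 : 0 ≤ k + j * N := by
      have hN1 : 1 ≤ (N : ℤ) := by
        rcases Nat.eq_zero_or_pos N with h | h
        · rw [h] at hN'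
          simp at hN'
        · exact_mod_cast h
      nlinarith [Int.natCast_nonneg j]
    obtain ⟨l, hl⟩ := Int.eq_ofNat_of_zero_le h1
    have h2 : (k : ℝ) + j * N = l := by exact_mod_cast hl
    convert (hnat l).1 using 1
    rw [← h2]
    ring

end IsSeparatedAngleSet

theorem finite_angles_Icc {F : Set Circle} (hF : F.Finite) (a b : ℝ) :
    {t ∈ Icc a b | Circle.exp t ∈ F}.Finite := by
  have h : {t ∈ Icc a b | Circle.exp t ∈ F} = ⋃ z ∈ F, {t ∈ Icc a b | Circle.exp t = z} := by
    ext t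
    simp
  rw [h]
  refine hF.biUnion fun z _ => ?_
  have hfin : {t ∈ Icc a b | Circle.exp t = z} ⊆
      (fun k : ℤ => Complex.arg z + k * (2 * Real.pi)) ''
        Icc ⌊(a - Complex.arg z) / (2 * Real.pi)⌋ ⌈(b - Complex.arg z) / (2 * Real.pi)⌉ := by
    rintro t ⟨ht, hz⟩
    rw [← Circle.exp_arg z, Circle.exp_eq_exp] at hz
    obtain ⟨k, hk⟩ := hz
    have hpi := Real.two_pi_pos
    refine ⟨k, ⟨?_, ?_⟩, hk.symm⟩
    · have h1 : (a - Complex.arg z) / (2 * Real.pi) ≤ k := by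
        rw [div_le_iff₀ hpi]
        linarith [ht.1]
      exact_mod_cast (Int.floor_le _).trans h1
    · have h1 : (k : ℝ) ≤ (b - Complex.arg z) / (2 * Real.pi) := by
        rw [le_div_iff₀ hpi]
        linarith [ht.2]
      exact_mod_cast h1.trans (Int.le_ceil _)
  exact ((finite_Icc _ _).image _).subset hfin

/-- The angles of a finite nonempty subset of the circle are separated by their smallest gap, which
is attained. -/
theorem exists_isSeparatedAngleSet {F : Set Circle} (hF : F.Finite) (hne : F.Nonempty) :
    ∃ d p₀ : ℝ, IsSeparatedAngleSet {t | Circle.exp t ∈ F} d ∧ Circle.exp p₀ ∈ F ∧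
      Circle.exp (p₀ + d) ∈ F := by
  have hpi := Real.two_pi_pos
  have hper : ∀ t, Circle.exp (t + 2 * Real.pi) = Circle.exp t := Circle.periodic_exp
  -- Angles in two turns realize all the gaps that do not exceed a full turn.
  set A := {t ∈ Icc (-Real.pi) (3 * Real.pi) | Circle.exp t ∈ F} with hA
  have hAfin : A.Finite := finite_angles_Icc hF _ _
  set G := {g ∈ (fun q : ℝ × ℝ => q.2 - q.1) '' A ×ˢ A | 0 < g} with hG
  have hGfin : G.Finite := ((hAfin.prod hAfin).image _).subset (sep_subset _ _)
  have hshift : ∀ p g : ℝ, Circle.exp p ∈ F → Circle.exp (p + g) ∈ F → 0 < g →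
      g ≤ 2 * Real.pi → g ∈ G := by
    intro p g hp hpg hg hg'
    set s := Complex.arg (Circle.exp p) with hs
    have hsp : Circle.exp s = Circle.exp p := Circle.exp_arg _
    have h1 := Complex.neg_pi_lt_arg (Circle.exp p)
    have h2 := Complex.arg_le_pi (Circle.exp p)
    refine ⟨⟨(s, s + g), ⟨⟨⟨h1.le, by linarith⟩, by rwa [hsp]⟩,
      ⟨⟨by linarith, by linarith⟩, ?_⟩⟩, by simp⟩, hg⟩
    rwa [Circle.exp_add, hsp, ← Circle.exp_add]
  obtain ⟨z, hz⟩ := hne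
  have hz' : Circle.exp (Complex.arg z) ∈ F := by rwa [Circle.exp_arg]
  have h2pi : 2 * Real.pi ∈ G := hshift _ _ hz' (by rwa [hper]) hpi le_rfl
  obtain ⟨d, hd, hmin⟩ := exists_min_image G id hGfin ⟨_, h2pi⟩
  obtain ⟨⟨⟨p, q⟩, ⟨hp, hq⟩, rfl⟩, hd0⟩ := hd
  refine ⟨q - p, p, ⟨hd0, fun t => ?_, fun p' hp' q' hq' hlt => ?_⟩, hp.2, ?_⟩
  · simp only [mem_ofPred_eq, hper]
  · rcases le_or_gt (q' - p') (2 * Real.pi) with h | h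
    · exact hmin _ (hshift p' _ hp' (by rwa [add_sub_cancel]) (by linarith) h)
    · exact (hmin _ h2pi).trans h.le
  · rw [add_sub_cancel]
    exact hq.2

end AngleSets

section NodalSets

theorem mul_pos_of_forall_ne_zero {f : ℝ → ℝ} (hf : Continuous f) {a b : ℝ} (hab : a ≤ b)
    (h : ∀ t ∈ Icc a b, f t ≠ 0) : 0 < f a * f b := by
  have ha := h a (left_mem_Icc.2 hab)
  have hb := h b (right_mem_Icc.2 hab)
  rcases ha.lt_or_gt with ha | ha <;> rcases hb.lt_or_gt with hb | hb
  · exact mul_pos_of_neg_of_neg ha hb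
  · obtain ⟨t, ht, h0⟩ := intermediate_value_Icc hab hf.continuousOn ⟨ha.le, hb.le⟩
    exact absurd h0 (h t ht)
  · obtain ⟨t, ht, h0⟩ := intermediate_value_Icc' hab hf.continuousOn ⟨hb.le, ha.le⟩
    exact absurd h0 (h t ht)
  · exact mul_pos ha hb

theorem isClopen_setOf_pos {X : Type*} [TopologicalSpace X] {f : X → ℝ} (hf : Continuous f)
    (h : ∀ x, f x ≠ 0) : IsClopen {x | 0 < f x} := by
  refine ⟨?_, isOpen_lt continuous_const hf⟩
  convert isClosed_le continuous_const hf using 1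
  ext x
  exact ⟨fun hx : 0 < f x => hx.le, fun hx : 0 ≤ f x => lt_of_le_of_ne hx (h x).symm⟩

variable {M : Type*} [TopologicalSpace M]

/-- The nodal set of `u` is `δ`-close, in the direction of the circle, to the slices with angle in
`P`, and comes close to each slice in each clopen part of `M`. -/
structure NodalSetNear (P : Set ℝ) (δ : ℝ) (u : Circle × M → ℝ) : Prop where
  near : ∀ t x, u (Circle.exp t, x) = 0 → ∃ q ∈ P, |t - q| < δ
  meets : ∀ q ∈ P, ∀ K : Set M, IsClopen K → K.Nonempty →
    ∃ t, |t - q| < δ ∧ ∃ x ∈ K, u (Circle.exp t, x) = 0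

/-- The conclusion of the comparison of slopes at length scale `l`: on a clopen part of `M`, an
interval with `u ≥ 0` at its ends and a zero of `u` at the right end is never followed by a longer
interval, of length at least `l`, on which `u` is positive. -/
def HasSlopeObstruction (l : ℝ) (u : Circle × M → ℝ) : Prop :=
  ∀ (K : Set M) (a c b : ℝ) (x₀ : M), IsClopen K → x₀ ∈ K → a < c → c - a < b - c →
    b - c < 2 * Real.pi → l ≤ b - c → (∀ x ∈ K, 0 ≤ u (Circle.exp a, x)) →
    (∀ x ∈ K, 0 ≤ u (Circle.exp c, x)) → u (Circle.exp c, x₀) = 0 →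
    ¬ ∀ t ∈ Ioc c b, ∀ x ∈ K, 0 < u (Circle.exp t, x)

namespace NodalSetNear

variable {P : Set ℝ} {δ l d : ℝ} {u : Circle × M → ℝ}

theorem neg (h : NodalSetNear P δ u) : NodalSetNear P δ (fun p => -u p) where
  near t x htx := h.near t x (neg_eq_zero.1 htx)
  meets q hq K hK hne := by simpa only [neg_eq_zero] using h.meets q hq K hK hne

theorem ne_zero (h : NodalSetNear P δ u) {p q t : ℝ} (hpq : ∀ r ∈ P, r ≤ p ∨ q ≤ r)
    (ht : t ∈ Icc (p + δ) (q - δ)) (x : M) : u (Circle.exp t, x) ≠ 0 := by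
  intro h0
  obtain ⟨r, hr, hlt⟩ := h.near t x h0
  rw [abs_lt] at hlt
  rcases hpq r hr with h1 | h1 <;> linarith [ht.1, ht.2, hlt.1, hlt.2]

theorem mul_pos (h : NodalSetNear P δ u) (hu : Continuous u) {p q s t : ℝ}
    (hpq : ∀ r ∈ P, r ≤ p ∨ q ≤ r) (hs : p + δ ≤ s) (hst : s ≤ t) (ht : t ≤ q - δ) (x : M) :
    0 < u (Circle.exp s, x) * u (Circle.exp t, x) :=
  mul_pos_of_forall_ne_zero (f := fun t => u (Circle.exp t, x)) (by fun_prop) hst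
    fun r hr => h.ne_zero hpq ⟨hs.trans hr.1, hr.2.trans ht⟩ x

theorem ne_zero_sub (h : NodalSetNear P δ u) (hP : IsSeparatedAngleSet P d) (hδ : 0 < δ)
    (hδd : 6 * δ ≤ d) {p : ℝ} (hp : p ∈ P) (x : M) : u (Circle.exp (p - δ), x) ≠ 0 := by
  refine h.ne_zero (p := p - 2 * δ) (q := p) (fun r hr => ?_) ⟨by linarith, le_rfl⟩ x
  rcases lt_or_ge r p with h1 | h1
  · exact Or.inl (by linarith [hP.sep r hr p hp h1])
  · exact Or.inr h1

theorem ne_zero_add (h : NodalSetNear P δ u) (hP : IsSeparatedAngleSet P d) (hδ : 0 < δ)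
    (hδd : 6 * δ ≤ d) {p : ℝ} (hp : p ∈ P) (x : M) : u (Circle.exp (p + δ), x) ≠ 0 := by
  refine h.ne_zero (p := p) (q := p + 2 * δ) (fun r hr => ?_) ⟨le_rfl, by linarith⟩ x
  rcases le_or_gt r p with h1 | h1
  · exact Or.inl h1
  · exact Or.inr (by linarith [hP.sep p hp r hr h1])

variable [CompactSpace M]

/-- A gap of `P` on which `u > 0` is not preceded, across the point `p` of `P`, by a shorter
interval at whose beginning `u > 0`. -/
theorem false_of_pos (h : NodalSetNear P δ u) (hu : Continuous u) (hδ : 0 < δ)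
    (hl : HasSlopeObstruction l u) {p q a : ℝ} (hp : p ∈ P) (hpq : ∀ r ∈ P, r ≤ p ∨ q ≤ r)
    (hlen : q - p ≤ 2 * Real.pi) (hlq : l ≤ q - p - 3 * δ) (hap : a ≤ p - δ)
    (hcmp : p + δ - a < q - p - 3 * δ) {K : Set M} (hK : IsClopen K) (hKne : K.Nonempty)
    (ha : ∀ x ∈ K, 0 < u (Circle.exp a, x)) (hpos : ∀ x ∈ K, 0 < u (Circle.exp (p + δ), x)) :
    False := by
  have hcont : Continuous fun y : ℝ × M => u (Circle.exp y.1, y.2) := by fun_prop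
  have hZ : IsCompact ((Icc (p - δ) (p + δ) ×ˢ K) ∩ {y : ℝ × M | u (Circle.exp y.1, y.2) = 0}) :=
    (isCompact_Icc.prod hK.isClosed.isCompact).inter_right (isClosed_eq hcont continuous_const)
  obtain ⟨t₀, ht₀, y₀, hy₀, hz₀⟩ := h.meets p hp K hK hKne
  rw [abs_lt] at ht₀
  -- The last nodal point near `p`.
  obtain ⟨⟨c, x₀⟩, ⟨⟨hc, hx₀⟩, hzero⟩, hmax⟩ := hZ.exists_isMaxOn (f := Prod.fst)
    ⟨(t₀, y₀), ⟨⟨by linarith, by linarith⟩, hy₀⟩, hz₀⟩ continuous_fst.continuousOn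
  simp only [mem_ofPred_eq] at hzero hc hx₀
  have hca : c ≠ a := by
    rintro rfl
    exact (ha x₀ hx₀).ne' hzero
  have hcp : c ≠ p + δ := by
    rintro rfl
    exact (hpos x₀ hx₀).ne' hzero
  have hac : a < c := lt_of_le_of_ne (hap.trans hc.1) hca.symm
  have hcp' : c < p + δ := lt_of_le_of_ne hc.2 hcp
  have hne : ∀ t ∈ Ioc c (q - 2 * δ), ∀ x ∈ K, u (Circle.exp t, x) ≠ 0 := by
    intro t ht x hx
    rcases le_or_gt t (p + δ) with h1 | h1
    · intro h0
      have : t ≤ c := hmax (a := (t, x)) ⟨⟨⟨hc.1.trans ht.1.le, h1⟩, hx⟩, h0⟩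
      exact absurd ht.1 (not_lt.2 this)
    · exact h.ne_zero hpq ⟨h1.le, by linarith [ht.2]⟩ x
  have hb : ∀ t ∈ Ioc c (q - 2 * δ), ∀ x ∈ K, 0 < u (Circle.exp t, x) := by
    intro t ht x hx
    have hxc : Continuous fun t => u (Circle.exp t, x) := by fun_prop
    have h2 := hpos x hx
    rcases le_total t (p + δ) with h1 | h1
    · refine pos_of_mul_pos_left (mul_pos_of_forall_ne_zero hxc h1 fun s hs => ?_) h2.le
      exact hne s ⟨ht.1.trans_le hs.1, by linarith [hs.2]⟩ x hx
    · refine pos_of_mul_pos_right (mul_pos_of_forall_ne_zero hxc h1 fun s hs => ?_) h2.le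
      exact hne s ⟨hcp'.trans_le hs.1, hs.2.trans ht.2⟩ x hx
  refine hl K a c (q - 2 * δ) x₀ hK hx₀ hac (by linarith) (by linarith [hc.1]) (by linarith)
    (fun x hx => (ha x hx).le) (fun x hx => ?_) hzero hb
  have hlim : Tendsto (fun t => u (Circle.exp t, x)) (𝓝[>] c) (𝓝 (u (Circle.exp c, x))) :=
    Tendsto.mono_left (Continuous.tendsto (by fun_prop) c) nhdsWithin_le_nhds
  refine ge_of_tendsto hlim ?_
  filter_upwards [Ioo_mem_nhdsGT (show c < q - 2 * δ by linarith)] with t ht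
  exact (hb t (Ioo_subset_Ioc_self ht) x hx).le

/-- The sign of `u` alternates across each point of `P`. -/
theorem mul_neg (h : NodalSetNear P δ u) (hu : Continuous u) (hδ : 0 < δ)
    (hl : HasSlopeObstruction l u) (hl' : HasSlopeObstruction l fun p => -u p)
    (hP : IsSeparatedAngleSet P d) (hPc : IsClosed P) (hδd : 6 * δ ≤ d) (hld : 2 * l ≤ d) {p : ℝ}
    (hp : p ∈ P) (x : M) : u (Circle.exp (p - δ), x) * u (Circle.exp (p + δ), x) < 0 := by
  obtain ⟨q, hq, hpq, hlen, hnext⟩ := hP.exists_next hPc hp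
  have hsep := hP.sep p hp q hq hpq
  have key : ∀ v : Circle × M → ℝ, Continuous v → NodalSetNear P δ v → HasSlopeObstruction l v →
      0 < v (Circle.exp (p - δ), x) → ¬ 0 < v (Circle.exp (p + δ), x) := by
    intro v hv hN hl h1 h2
    have hK : IsClopen
        ({y | 0 < v (Circle.exp (p - δ), y)} ∩ {y | 0 < v (Circle.exp (p + δ), y)}) :=
      (isClopen_setOf_pos (by fun_prop) (hN.ne_zero_sub hP hδ hδd hp)).inter
        (isClopen_setOf_pos (by fun_prop) (hN.ne_zero_add hP hδ hδd hp))
    exact hN.false_of_pos hv hδ hl hp hnext hlen (by linarith) le_rfl (by linarith) hK ⟨x, h1, h2⟩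
      (fun y hy => hy.1) (fun y hy => hy.2)
  have h1 := h.ne_zero_sub hP hδ hδd hp x
  have h2 := h.ne_zero_add hP hδ hδd hp x
  rcases h1.lt_or_gt with h1 | h1 <;> rcases h2.lt_or_gt with h2 | h2
  · exact absurd (neg_pos.2 h2) (key _ hu.neg h.neg hl' (neg_pos.2 h1))
  · exact mul_neg_of_neg_of_pos h1 h2
  · exact mul_neg_of_pos_of_neg h1 h2
  · exact absurd h2 (key u hu h hl h1)

/-- A gap of `P` is not followed by a longer one. -/
theorem false_of_gap_lt [Nonempty M] (h : NodalSetNear P δ u) (hu : Continuous u) (hδ : 0 < δ)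
    (hl : HasSlopeObstruction l u) (hl' : HasSlopeObstruction l fun p => -u p)
    (hP : IsSeparatedAngleSet P d) (hPc : IsClosed P) (hδd : 6 * δ ≤ d) (hld : 2 * l ≤ d)
    {p₀ p₁ p₂ : ℝ} (h₀ : p₀ ∈ P) (h₁ : p₁ ∈ P) (h₂ : p₂ ∈ P) (h₀₁ : p₀ < p₁) (h₁₂ : p₁ < p₂)
    (hnext₀ : ∀ r ∈ P, r ≤ p₀ ∨ p₁ ≤ r) (hnext₁ : ∀ r ∈ P, r ≤ p₁ ∨ p₂ ≤ r)
    (hlen : p₂ - p₁ ≤ 2 * Real.pi) (hgap : p₁ - p₀ + 5 * δ < p₂ - p₁) : False := by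
  have hs₀ := hP.sep _ h₀ _ h₁ h₀₁
  have hs₁ := hP.sep _ h₁ _ h₂ h₁₂
  have key : ∀ v : Circle × M → ℝ, Continuous v → NodalSetNear P δ v → HasSlopeObstruction l v →
      ∀ x, 0 < v (Circle.exp (p₀ - δ), x) → ¬ 0 < v (Circle.exp (p₁ + δ), x) := by
    intro v hv hN hl x h1 h2
    have hK : IsClopen
        ({y | 0 < v (Circle.exp (p₀ - δ), y)} ∩ {y | 0 < v (Circle.exp (p₁ + δ), y)}) :=
      (isClopen_setOf_pos (by fun_prop) (hN.ne_zero_sub hP hδ hδd h₀)).inter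
        (isClopen_setOf_pos (by fun_prop) (hN.ne_zero_add hP hδ hδd h₁))
    exact hN.false_of_pos hv hδ hl h₁ hnext₁ hlen (a := p₀ - δ) (by linarith) (by linarith)
      (by linarith) hK ⟨x, h1, h2⟩ (fun y hy => hy.1) (fun y hy => hy.2)
  obtain ⟨x⟩ := ‹Nonempty M›
  have h1 := h.mul_neg hu hδ hl hl' hP hPc hδd hld h₀ x
  have h2 := h.mul_pos hu hnext₀ (le_refl (p₀ + δ)) (by linarith) (le_refl (p₁ - δ)) x
  have h3 := h.mul_neg hu hδ hl hl' hP hPc hδd hld h₁ x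
  rcases (h.ne_zero_sub hP hδ hδd h₀ x).lt_or_gt with h4 | h4
  · have h5 := pos_of_mul_neg_right h1 h4.le
    have h6 := (pos_iff_pos_of_mul_pos h2).1 h5
    have h7 := neg_of_mul_neg_right h3 h6.le
    exact key _ hu.neg h.neg hl' x (neg_pos.2 h4) (neg_pos.2 h7)
  · have h5 := neg_of_mul_neg_right h1 h4.le
    have h6 := (neg_iff_neg_of_mul_pos h2).1 h5
    have h7 := pos_of_mul_neg_right h3 h6.le
    exact key u hu h hl x h4 h7

end NodalSetNear

end NodalSets

/-! ### Hausdorff convergence, concentration and signs -/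

section Hausdorff

variable {M : Type*} [EMetricSpace M]

theorem lt_of_prodEDist_lt {p q : Circle × M} {δ : ℝ≥0∞} (h : prodEDist p q < δ) :
    ENNReal.ofReal (circleDist p.1 q.1) < δ ∧ edist p.2 q.2 < δ := by
  have key : ∀ x y : ℝ≥0∞, x ≤ (x ^ 2 + y ^ 2) ^ (1 / 2 : ℝ) ∧
      y ≤ (x ^ 2 + y ^ 2) ^ (1 / 2 : ℝ) := by
    intro x y
    have h1 : ∀ z : ℝ≥0∞, z = (z ^ 2) ^ (1 / 2 : ℝ) := by
      intro z
      rw [← ENNReal.rpow_natCast, ← ENNReal.rpow_mul]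
      norm_num
    constructor
    · conv_lhs => rw [h1 x]
      gcongr
      exact le_self_add
    · conv_lhs => rw [h1 y]
      gcongr
      exact le_add_self
  exact ⟨(key _ _).1.trans_lt h, (key _ _).2.trans_lt h⟩

/-- The Lebesgue number of the cover of a compact space by its connected components. -/
theorem exists_forall_isClopen_mem [CompactSpace M] [LocallyConnectedSpace M] :
    ∃ r : ℝ≥0∞, 0 < r ∧ ∀ K : Set M, IsClopen K → ∀ x ∈ K, ∀ y, edist y x < r → y ∈ K := by
  obtain ⟨r, hr, H⟩ := lebesgue_number_lemma_of_emetric (s := (univ : Set M))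
    (c := fun x : M => connectedComponent x) isCompact_univ (fun x => isOpen_connectedComponent)
    (fun x _ => mem_iUnion.2 ⟨x, mem_connectedComponent⟩)
  refine ⟨r, hr, fun K hK x hx y hxy => ?_⟩
  obtain ⟨z, hz⟩ := H x (mem_univ x)
  have hxz : x ∈ connectedComponent z := hz (Metric.mem_eball_self hr)
  have hyz : y ∈ connectedComponent z := hz hxy
  rw [connectedComponent_eq hxz] at hyz
  exact hK.connectedComponent_subset hx hyz

theorem HausdorffTendsto.eventually_nodalSetNear [CompactSpace M] [LocallyConnectedSpace M]
    {u : ℕ → Circle × M → ℝ} {m : ℕ} {θ : Fin m → Circle}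
    (hlim : HausdorffTendsto (fun i => {p | u i p = 0}) (slices θ M)) {δ : ℝ} (hδ : 0 < δ) :
    ∀ᶠ i in atTop, NodalSetNear {t | Circle.exp t ∈ range θ} δ (u i) := by
  obtain ⟨r, hr, hcomp⟩ := exists_forall_isClopen_mem (M := M)
  filter_upwards [hlim (min (ENNReal.ofReal δ) r) (lt_min (ENNReal.ofReal_pos.2 hδ) hr)] with i hi
  have hangle : ∀ p q : Circle × M, prodEDist p q < min (ENNReal.ofReal δ) r →
      |Complex.arg ((p.1 / q.1 : Circle) : ℂ)| < δ := fun p q h =>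
    (ENNReal.ofReal_lt_ofReal_iff hδ).1 ((lt_of_prodEDist_lt h).1.trans_le (min_le_left _ _))
  refine ⟨fun t x htx => ?_, fun q hq K hK hne => ?_⟩
  · obtain ⟨q, hq, hdist⟩ := hi.1 (Circle.exp t, x) htx
    set s := Complex.arg ((Circle.exp t / q.1 : Circle) : ℂ) with hs
    have hexp : Circle.exp s = Circle.exp t / q.1 := Circle.exp_arg _
    have hs_lt : |s| < δ := hangle (Circle.exp t, x) q hdist
    refine ⟨t - s, ?_, by rwa [sub_sub_cancel]⟩
    rw [mem_ofPred_eq, Circle.exp_sub, hexp, div_div_cancel]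
    exact hq.1
  · obtain ⟨x, hx⟩ := hne
    obtain ⟨p, hp, hdist⟩ := hi.2 (Circle.exp q, x) ⟨hq, mem_univ _⟩
    set s := Complex.arg ((p.1 / Circle.exp q : Circle) : ℂ) with hs
    have hexp : Circle.exp s = p.1 / Circle.exp q := Circle.exp_arg _
    have hs_lt : |s| < δ := hangle p (Circle.exp q, x) hdist
    have hpK : p.2 ∈ K :=
      hcomp K hK x hx _ ((lt_of_prodEDist_lt hdist).2.trans_le (min_le_right _ _))
    refine ⟨q + s, by rwa [add_sub_cancel_left], p.2, hpK, ?_⟩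
    rw [Circle.exp_add, hexp, mul_div_cancel]
    exact hp

end Hausdorff

section Concentration

variable {n : ℕ} {M : Type*} [EMetricSpace M] [CompactSpace M] [MeasurableSpace M] [BorelSpace M]
  [ChartedSpace (EuclideanSpace ℝ (Fin n)) M] [IsManifold (𝓡 n) ∞ M]
  [RiemannianBundle (fun x : M => TangentSpace (𝓡 n) x)]
  [IsContinuousRiemannianBundle (EuclideanSpace ℝ (Fin n)) (fun x : M => TangentSpace (𝓡 n) x)]
  {W : ℝ → ℝ}

theorem IsPhaseTransition.eventually_hasSlopeObstruction (hW : IsDoubleWell W) {ε : ℕ → ℝ}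
    (hε_pos : ∀ i, 0 < ε i) (hε : Tendsto ε atTop (𝓝 0)) {u : ℕ → Circle × M → ℝ}
    (hu : ∀ i, IsPhaseTransition n W (ε i) (u i)) {l : ℝ} (hl : 0 < l) :
    ∀ᶠ i in atTop, HasSlopeObstruction l (u i) ∧ HasSlopeObstruction l fun p => -u i p := by
  obtain ⟨Λ, hΛ, H⟩ := IsPhaseTransition.exists_forall_slope_obstruction (n := n) (M := M) hW
  filter_upwards [hε.eventually_lt_const (div_pos hl hΛ)] with i hi
  rw [lt_div_iff₀' hΛ] at hi
  have key : ∀ v, IsPhaseTransition n W (ε i) v → HasSlopeObstruction l v :=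
    fun v hv K a c b x₀ hK hx₀ hac hlen hbc hlb =>
      H (ε i) v (hε_pos i) hv K a c b x₀ hK hx₀ hac hlen hbc (hi.le.trans hlb)
  exact ⟨key _ (hu i), key _ ((hu i).neg hW)⟩

/-- For small `ε` the values of `u` are close to the wells at distance `η` from the nodal set,
by comparison with a fixed profile of maximum close to `1`. -/
theorem IsPhaseTransition.exists_lt_abs (hW : IsDoubleWell W) {κ η : ℝ} (hκ : 0 < κ) (hη : 0 < η) :
    ∃ ε₀ : ℝ, 0 < ε₀ ∧ ∀ (ε : ℝ) (u : Circle × M → ℝ), 0 < ε → ε < ε₀ →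
      IsPhaseTransition n W ε u → ∀ t, (∀ s ∈ Icc (t - η) (t + η), ∀ x, u (Circle.exp s, x) ≠ 0) →
      ∀ x, 1 - κ < |u (Circle.exp t, x)| := by
  obtain ⟨μ, hμ, hμ1⟩ := exists_between (max_lt zero_lt_one (sub_lt_self 1 hκ))
  obtain ⟨V, T, p, hV, hV0⟩ := hW.exists_isProfile ⟨(le_max_left _ _).trans_lt hμ, hμ1⟩
  have hT := hV.pos_length
  refine ⟨min η 1 / (2 * T), by positivity, fun ε u hε hε₀ hu t hne x => ?_⟩
  rw [lt_div_iff₀ (by positivity)] at hε₀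
  have h1 : 2 * ε * T < η := lt_of_lt_of_le (by linarith) (min_le_left _ _)
  have h2 : 2 * ε * T < 1 := lt_of_lt_of_le (by linarith) (min_le_right η 1)
  have hsub : Icc (t - 2 * ε * T) (t + 2 * ε * T) ⊆ Icc (t - η) (t + η) :=
    Icc_subset_Icc (by linarith) (by linarith)
  have htm : t ∈ Icc (t - η) (t + η) := ⟨by linarith, by linarith⟩
  have h3 : 0 < 2 * ε * T := by positivity
  have key : ∀ v : Circle × M → ℝ, IsPhaseTransition n W ε v →
      (∀ s ∈ Icc (t - η) (t + η), ∀ x, v (Circle.exp s, x) ≠ 0) → 0 < v (Circle.exp t, x) →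
      1 - κ < v (Circle.exp t, x) := by
    intro v hv hvne hx
    have hvc := hv.smooth.continuous
    have hK : IsClopen {y | 0 < v (Circle.exp t, y)} :=
      isClopen_setOf_pos (by fun_prop) (hvne t htm)
    have hle := hv.profile_le hW hε hV (r := 2 * ε) (by linarith) hK (c := t)
      (by linarith [Real.pi_gt_three]) (fun s hs y hy => ?_) t ⟨by linarith, by linarith⟩ x hx
    · rw [sub_self, zero_div, hV0] at hle
      exact ((le_max_right _ _).trans_lt hμ).trans_le hle
    · have hy : 0 < v (Circle.exp t, y) := hy
      have hyc : Continuous fun s => v (Circle.exp s, y) := by fun_prop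
      rcases le_total s t with hst | hst
      · exact pos_of_mul_pos_left (mul_pos_of_forall_ne_zero hyc hst fun r hr =>
          hvne r ⟨(hsub hs).1.trans hr.1, hr.2.trans htm.2⟩ y) hy.le
      · exact pos_of_mul_pos_right (mul_pos_of_forall_ne_zero hyc hst fun r hr =>
          hvne r ⟨htm.1.trans hr.1, hr.2.trans (hsub hs).2⟩ y) hy.le
  rcases (hne t htm x).lt_or_gt with h | h
  · rw [abs_of_neg h]
    exact key _ (hu.neg hW) (fun s hs y => neg_ne_zero.2 (hne s hs y)) (neg_pos.2 h)
  · rw [abs_of_pos h]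
    exact key u hu hne h

end Concentration

section Signs

theorem zpow_mul_pos_of_alternating {v : ℤ → ℝ} (h : ∀ k, v k * v (k + 1) < 0) (k : ℤ) :
    0 < (-1 : ℝ) ^ k * (v 0 * v k) := by
  have h0 : ∀ k, v k ≠ 0 := fun k hk => by simpa [hk] using h k
  have hsq : ∀ k, 0 < v k ^ 2 := fun k => by have := h0 k; positivity
  induction k using Int.induction_on with
  | zero => simpa using mul_self_pos.2 (h0 0)
  | succ k ih =>
    have h1 := mul_pos ih (neg_pos.2 (h k))
    have h2 : (-1 : ℝ) ^ (k : ℤ) * (v 0 * v k) * -(v k * v (k + 1)) =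
        (-1 : ℝ) ^ ((k : ℤ) + 1) * (v 0 * v (k + 1)) * v k ^ 2 := by
      rw [zpow_add_one₀ (by norm_num)]
      ring
    rw [h2] at h1
    exact pos_of_mul_pos_left h1 (hsq k).le
  | pred k ih =>
    have h3 := h (-k - 1)
    rw [sub_add_cancel] at h3
    have h1 := mul_pos ih (neg_pos.2 h3)
    have h2 : (-1 : ℝ) ^ (-k : ℤ) * (v 0 * v (-k)) * -(v (-k - 1) * v (-k)) =
        (-1 : ℝ) ^ (-(k : ℤ) - 1) * (v 0 * v (-k - 1)) * v (-k) ^ 2 := by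
      rw [zpow_sub_one₀ (by norm_num)]
      ring
    rw [h2] at h1
    exact pos_of_mul_pos_left h1 (hsq _).le

variable {M : Type*} [TopologicalSpace M]

/-- Convergence to a step function `h` of the angle, up to sign on each component, from the
knowledge that the sign of `u_i` relative to `h` does not depend on the angle and that `|u_i|` is
close to `1` away from the nodal set. -/
theorem exists_sign_tendstoLocallyUniformlyOn {F : Set Circle} (hF : F.Finite)
    {u : ℕ → Circle × M → ℝ} (hu : ∀ i, Continuous (u i)) (hu1 : ∀ i p, u i p ∈ Icc (-1 : ℝ) 1)
    {h : ℝ → ℝ} (hper : Function.Periodic h (2 * Real.pi)) (hh : ∀ t, h t = 1 ∨ h t = -1)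
    (hloc : ∀ t, Circle.exp t ∉ F → ∀ᶠ s in 𝓝 t, h s = h t) {b : ℝ}
    (hsign : ∀ δ > 0, ∀ᶠ i in atTop, ∀ t, (∀ r, Circle.exp r ∈ F → δ ≤ |t - r|) → ∀ x,
      0 < u i (Circle.exp b, x) * (u i (Circle.exp t, x) * h t))
    (habs : ∀ κ > 0, ∀ η > 0, ∀ᶠ i in atTop, ∀ t,
      (∀ s ∈ Icc (t - η) (t + η), ∀ x, u i (Circle.exp s, x) ≠ 0) →
      ∀ x, 1 - κ < |u i (Circle.exp t, x)|) :
    ∃ (s : ℕ → M → ℝ) (σ : Circle → ℝ), (∀ t, σ (Circle.exp t) = h t) ∧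
      (∀ i x, s i x = 1 ∨ s i x = -1) ∧ (∀ i, IsLocallyConstant (s i)) ∧
      (∀ z, z ∉ F → (σ z = 1 ∨ σ z = -1) ∧ ∀ᶠ w in 𝓝 z, σ w = σ z) ∧
      TendstoLocallyUniformlyOn (fun i p => s i p.2 * u i p) (fun p => σ p.1) atTop
        (F ×ˢ univ)ᶜ := by
  classical
  set σ : Circle → ℝ := fun z => h (Complex.arg z) with hσdef
  set s : ℕ → M → ℝ := fun i x =>
    if (∀ y, u i (Circle.exp b, y) ≠ 0) ∧ u i (Circle.exp b, x) < 0 then -1 else 1 with hsdef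
  have hσ : ∀ t, σ (Circle.exp t) = h t := by
    intro t
    obtain ⟨k, hk⟩ := Circle.exp_eq_exp.1 (Circle.exp_arg (Circle.exp t))
    simp only [hσdef, hk]
    exact hper.int_mul k t
  refine ⟨s, σ, hσ, fun i x => ?_, fun i => ?_, fun z hz => ?_, ?_⟩
  · simp only [hsdef]
    split_ifs <;> simp
  · rw [IsLocallyConstant.iff_eventually_eq]
    intro x
    have hc : Continuous fun y => u i (Circle.exp b, y) := by
      have := hu i
      fun_prop
    by_cases hne : ∀ y, u i (Circle.exp b, y) ≠ 0
    · rcases (hne x).lt_or_gt with hx | hx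
      · filter_upwards [hc.continuousAt.eventually_lt_const hx] with y hy
        simp only [hsdef, hne, hx, hy, ne_eq, not_false_eq_true, implies_true, and_self]
      · filter_upwards [hc.continuousAt.eventually_const_lt hx] with y hy
        simp only [hsdef, not_lt.2 hx.le, not_lt.2 hy.le, and_false]
    · exact Eventually.of_forall fun y => by simp only [hsdef, hne, false_and]
  · rw [← Circle.exp_arg z, hσ]
    refine ⟨hh _, ?_⟩
    rw [← isLocalHomeomorph_circleExp.map_nhds_eq, eventually_map]
    filter_upwards [hloc (Complex.arg z) (by rwa [Circle.exp_arg])] with t ht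
    rw [hσ, ht]
  · rw [Metric.tendstoLocallyUniformlyOn_iff]
    rintro κ hκ ⟨z, x₀⟩ hz
    have hzF : z ∉ F := fun h => hz ⟨h, mem_univ _⟩
    obtain ⟨t₁, rfl⟩ := Circle.exp_surjective z
    have hopen : IsOpen {t | Circle.exp t ∉ F} :=
      hF.isClosed.isOpen_compl.preimage Circle.exp.continuous
    obtain ⟨ρ, hρ, hball⟩ := Metric.isOpen_iff.1 hopen t₁ hzF
    have hη : 0 < ρ / 3 := by positivity
    refine ⟨(Circle.exp '' Metric.ball t₁ (ρ / 3)) ×ˢ univ, mem_nhdsWithin_of_mem_nhds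
      (prod_mem_nhds ?_ univ_mem), ?_⟩
    · rw [← isLocalHomeomorph_circleExp.map_nhds_eq]
      exact image_mem_map (Metric.ball_mem_nhds _ hη)
    filter_upwards [hsign _ hη, habs κ hκ _ hη] with i hi hi'
    rintro ⟨_, x⟩ ⟨⟨t, ht, rfl⟩, -⟩
    rw [Metric.mem_ball, Real.dist_eq, abs_lt] at ht
    have hfar : ∀ s ∈ Icc (t - ρ / 3) (t + ρ / 3), ∀ r, Circle.exp r ∈ F → ρ / 3 ≤ |s - r| := by
      intro s hs r hr
      by_contra! hlt
      rw [abs_lt] at hlt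
      refine hball (?_ : r ∈ _) hr
      rw [Metric.mem_ball, Real.dist_eq, abs_lt]
      constructor <;> linarith [hs.1, hs.2, ht.1, ht.2, hlt.1, hlt.2]
    have htm : t ∈ Icc (t - ρ / 3) (t + ρ / 3) := ⟨by linarith, by linarith⟩
    have hpos := hi t (hfar t htm) x
    have hbne : ∀ y, u i (Circle.exp b, y) ≠ 0 := fun y hy => by
      have := hi t (hfar t htm) y
      simp [hy] at this
    have hlt := hi' t (fun s hs y hy => by
      have := hi s (hfar s hs) y
      simp [hy] at this) x
    have hle := hu1 i (Circle.exp t, x)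
    have hs : 0 < s i x * (u i (Circle.exp t, x) * h t) := by
      rcases (hbne x).lt_or_gt with hx | hx
      · have h1 := neg_of_mul_pos_right hpos hx.le
        simp only [hsdef, hbne, hx, ne_eq, not_false_eq_true, implies_true, and_self, if_true]
        linarith
      · simp only [hsdef, not_lt.2 hx.le, and_false, if_false, one_mul]
        exact pos_of_mul_pos_right hpos hx.le
    have hs1 : s i x = 1 ∨ s i x = -1 := by
      simp only [hsdef]
      split_ifs <;> simp
    simp only [hσ]
    rw [Real.dist_eq]
    rcases hs1 with e1 | e1 <;> rcases hh t with e2 | e2 <;> rw [e1, e2] at hs ⊢ <;>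
      rw [abs_lt] <;> rcases lt_abs.1 hlt with h1 | h1 <;> constructor <;> linarith [hle.1, hle.2]

end Signs

/-! ### Arithmetic progressions of nodal angles -/

section Progressions

variable {p₀ d : ℝ} {N : ℕ}

theorem card_eq_of_progression {m : ℕ} {θ : Fin m → Circle} (hθ : Function.Injective θ)
    (hN : 0 < N) (hNd : N * d = 2 * Real.pi)
    (hP : ∀ t, Circle.exp t ∈ range θ ↔ ∃ k : ℤ, t = p₀ + k * d) : N = m := by
  have hd : d ≠ 0 := by
    rintro rfl
    linarith [Real.pi_pos, mul_zero (N : ℝ)]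
  set f : Fin N → Circle := fun k => Circle.exp (p₀ + k * d) with hf
  have hfinj : Function.Injective f := by
    intro k k' hkk
    obtain ⟨j, hj⟩ := Circle.exp_eq_exp.1 hkk
    rw [← hNd] at hj
    have h1 : ((k : ℕ) : ℝ) = (k' : ℕ) + j * N := by
      apply mul_right_cancel₀ hd
      linarith
    have h2 : ((k : ℕ) : ℤ) - ((k' : ℕ) : ℤ) = j * N := by
      have : ((k : ℕ) : ℤ) = ((k' : ℕ) : ℤ) + j * N := by exact_mod_cast h1
      linarith
    have h3 : ((k : ℕ) : ℤ) - ((k' : ℕ) : ℤ) = 0 := by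
      refine Int.eq_zero_of_abs_lt_dvd (Dvd.intro_left j h2.symm) ?_
      rw [abs_lt]
      have := k.2
      have := k'.2
      omega
    ext
    omega
  have hrange : range f = range θ := by
    ext z
    constructor
    · rintro ⟨k, rfl⟩
      exact (hP _).2 ⟨(k : ℕ), by push_cast; rfl⟩
    · intro hz
      obtain ⟨t, rfl⟩ := Circle.exp_surjective z
      obtain ⟨k, rfl⟩ := (hP t).1 hz
      have hN' : (0 : ℤ) < N := by exact_mod_cast hN
      obtain ⟨j, hj⟩ := Int.eq_ofNat_of_zero_le (Int.emod_nonneg k hN'.ne')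
      have hjN : j < N := by
        have := Int.emod_lt_of_pos k hN'
        omega
      refine ⟨⟨j, hjN⟩, Circle.exp_eq_exp.2 ⟨-(k / N), ?_⟩⟩
      have h1 := Int.emod_add_mul_ediv k N
      rw [hj] at h1
      have h2 : (j : ℝ) + N * ((k / N : ℤ) : ℝ) = k := by exact_mod_cast h1
      rw [← hNd, ← h2]
      push_cast
      ring
  have h1 := Nat.card_range_of_injective hfinj
  rw [hrange, Nat.card_range_of_injective hθ] at h1
  simpa using h1.symm

/-- The step function with values `(-1) ^ k` on the `k`-th gap of the progression `p₀ + ℤ d`. -/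
def alternatingStep (p₀ d t : ℝ) : ℝ := (-1) ^ ⌊(t - p₀) / d⌋

theorem alternatingStep_of_mem (hd : 0 < d) {k : ℤ} {t : ℝ}
    (ht : t ∈ Ico (p₀ + k * d) (p₀ + (k + 1) * d)) : alternatingStep p₀ d t = (-1) ^ k := by
  have : ⌊(t - p₀) / d⌋ = k := by
    rw [Int.floor_eq_iff, le_div_iff₀ hd, div_lt_iff₀ hd]
    constructor <;> linarith [ht.1, ht.2]
  rw [alternatingStep, this]

theorem exists_mem_gap (hd : 0 < d) (t : ℝ) :
    ∃ k : ℤ, t ∈ Ico (p₀ + k * d) (p₀ + (k + 1) * d) := by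
  have h1 := Int.floor_le ((t - p₀) / d)
  have h2 := Int.lt_floor_add_one ((t - p₀) / d)
  rw [le_div_iff₀ hd] at h1
  rw [div_lt_iff₀ hd] at h2
  exact ⟨⌊(t - p₀) / d⌋, by linarith, by linarith⟩

theorem alternatingStep_eq_or (t : ℝ) :
    alternatingStep p₀ d t = 1 ∨ alternatingStep p₀ d t = -1 := by
  rcases Int.even_or_odd ⌊(t - p₀) / d⌋ with h | h
  · exact Or.inl h.neg_one_zpow
  · exact Or.inr h.neg_one_zpow

theorem periodic_alternatingStep (hd : 0 < d) (hN : Even N) :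
    Function.Periodic (alternatingStep p₀ d) (N * d) := by
  intro t
  have h1 : (t + N * d - p₀) / d = (t - p₀) / d + N := by
    field_simp
    ring
  have h2 : Even (N : ℤ) := by exact_mod_cast hN
  rw [alternatingStep, h1, Int.floor_add_natCast, zpow_add₀ (by norm_num), h2.neg_one_zpow,
    mul_one, alternatingStep]

theorem eventually_alternatingStep_eq (hd : 0 < d) {t : ℝ} (ht : ∀ k : ℤ, t ≠ p₀ + k * d) :
    ∀ᶠ s in 𝓝 t, alternatingStep p₀ d s = alternatingStep p₀ d t := by
  obtain ⟨k, hk⟩ := exists_mem_gap (p₀ := p₀) hd t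
  have hk' : p₀ + k * d < t := lt_of_le_of_ne hk.1 (ht k).symm
  filter_upwards [Ioo_mem_nhds hk' hk.2] with s hs
  rw [alternatingStep_of_mem hd (Ioo_subset_Ico_self hs), alternatingStep_of_mem hd hk]

variable {M : Type*} [TopologicalSpace M] [CompactSpace M] {P : Set ℝ} {δ l : ℝ}
  {u : Circle × M → ℝ}

/-- Along a progression of nodal angles, the signs of `u` follow the alternating step function. -/
theorem NodalSetNear.mul_alternatingStep_pos (h : NodalSetNear P δ u) (hu : Continuous u)
    (hδ : 0 < δ) (hl : HasSlopeObstruction l u) (hl' : HasSlopeObstruction l fun p => -u p)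
    (hP : IsSeparatedAngleSet P d) (hPc : IsClosed P) (hδd : 6 * δ ≤ d) (hld : 2 * l ≤ d)
    (hprog : ∀ t, t ∈ P ↔ ∃ k : ℤ, t = p₀ + k * d) (x : M) :
    (∀ k : ℤ, 0 < (-1 : ℝ) ^ k *
      (u (Circle.exp (p₀ + d / 2), x) * u (Circle.exp (p₀ + k * d + d / 2), x))) ∧
    ∀ t, (∀ r ∈ P, δ ≤ |t - r|) →
      0 < u (Circle.exp (p₀ + d / 2), x) * (u (Circle.exp t, x) * alternatingStep p₀ d t) := by
  have hd := hP.pos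
  have hmem : ∀ k : ℤ, p₀ + k * d ∈ P := fun k => (hprog _).2 ⟨k, rfl⟩
  have hnext : ∀ k : ℤ, ∀ r ∈ P, r ≤ p₀ + k * d ∨ p₀ + k * d + d ≤ r := fun k r hr =>
    (le_or_gt r (p₀ + k * d)).imp_right fun hlt => by linarith [hP.sep _ (hmem k) r hr hlt]
  have hmid : ∀ k : ℤ, 0 < (-1 : ℝ) ^ k *
      (u (Circle.exp (p₀ + d / 2), x) * u (Circle.exp (p₀ + k * d + d / 2), x)) := by
    intro k
    have h1 := zpow_mul_pos_of_alternating
      (v := fun k : ℤ => u (Circle.exp (p₀ + k * d + d / 2), x)) (fun j => ?_) k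
    · simpa using h1
    -- From the middle of a gap to its end, across the nodal angle, and on to the next middle.
    have e : p₀ + ((j + 1 : ℤ) : ℝ) * d = p₀ + j * d + d := by
      push_cast
      ring
    have h1 := h.mul_pos hu (hnext j) (s := p₀ + j * d + d / 2) (t := p₀ + j * d + d - δ)
      (by linarith) (by linarith) le_rfl x
    have h2 := h.mul_neg hu hδ hl hl' hP hPc hδd hld (hmem (j + 1)) x
    have h3 := h.mul_pos hu (hnext (j + 1)) (s := p₀ + ((j + 1 : ℤ) : ℝ) * d + δ)
      (t := p₀ + ((j + 1 : ℤ) : ℝ) * d + d / 2) le_rfl (by linarith) (by linarith) x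
    rw [e] at h2 h3 ⊢
    have h4 := mul_neg_of_pos_of_neg (_root_.mul_pos h1 h3) h2
    have h5 := mul_self_nonneg (u (Circle.exp (p₀ + j * d + d - δ), x) *
      u (Circle.exp (p₀ + j * d + d + δ), x))
    by_contra! hcon
    linarith [mul_nonneg hcon h5]
  refine ⟨hmid, fun t ht => ?_⟩
  obtain ⟨k, hk⟩ := exists_mem_gap (p₀ := p₀) hd t
  have hk2 : t < p₀ + k * d + d := by linarith [hk.2]
  have h1 : p₀ + k * d + δ ≤ t := by
    have := ht _ (hmem k)
    rw [abs_of_nonneg (by linarith [hk.1])] at this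
    linarith
  have h2 : t ≤ p₀ + k * d + d - δ := by
    have := ht (p₀ + k * d + d) ((hprog _).2 ⟨k + 1, by push_cast; ring⟩)
    rw [abs_of_neg (by linarith)] at this
    linarith
  have h3 : 0 < u (Circle.exp (p₀ + k * d + d / 2), x) * u (Circle.exp t, x) := by
    rcases le_total t (p₀ + k * d + d / 2) with h | h'
    · rw [mul_comm]
      exact ‹NodalSetNear P δ u›.mul_pos hu (hnext k) h1 h (by linarith) x
    · exact h.mul_pos hu (hnext k) (by linarith) h' h2 x
  rw [alternatingStep_of_mem hd hk]
  have h4 := _root_.mul_pos (hmid k) h3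
  have h5 := mul_self_nonneg (u (Circle.exp (p₀ + k * d + d / 2), x))
  by_contra! hcon
  linarith [mul_nonneg (neg_nonneg.2 hcon) h5]

end Progressions

end

theorem theorem1 {n : ℕ} {M : Type*} [EMetricSpace M] [CompactSpace M] [Nonempty M]
    [MeasurableSpace M] [BorelSpace M]
    [ChartedSpace (EuclideanSpace ℝ (Fin n)) M] [IsManifold (𝓡 n) ∞ M]
    [RiemannianBundle (fun x : M => TangentSpace (𝓡 n) x)]
    [IsContMDiffRiemannianBundle (𝓡 n) ∞ (EuclideanSpace ℝ (Fin n))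
      (fun x : M => TangentSpace (𝓡 n) x)]
    [IsRiemannianManifold (𝓡 n) M]
    (W : ℝ → ℝ) (hW : IsDoubleWell W)
    (ε : ℕ → ℝ) (hε_pos : ∀ i, 0 < ε i) (hε : Tendsto ε atTop (𝓝 0))
    (u : ℕ → Circle × M → ℝ) (hu : ∀ i, IsPhaseTransition n W (ε i) (u i))
    (m : ℕ) (θ : Fin m → Circle) (hθ : Function.Injective θ)
    (hlim : HausdorffTendsto (fun i => {p | u i p = 0}) (slices θ M)) :
    (∃ (s : ℕ → M → ℝ) (σ : Circle → ℝ),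
      (∀ i x, s i x = 1 ∨ s i x = -1) ∧
      (∀ i, IsLocallyConstant (s i)) ∧
      (∀ z, z ∉ range θ → (σ z = 1 ∨ σ z = -1) ∧ ∀ᶠ w in 𝓝 z, σ w = σ z) ∧
      (∀ k, ∀ᶠ t in 𝓝[>] (0 : ℝ),
        σ (Circle.exp t * θ k) = -σ (Circle.exp (-t) * θ k)) ∧
      TendstoLocallyUniformlyOn (fun i p => s i p.2 * u i p) (fun p => σ p.1) atTop
        (slices θ M)ᶜ) ∧
    Even m ∧
    (fun p : Circle × M => (Circle.exp (2 * Real.pi / m) * p.1, p.2)) '' slices θ M =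
      slices θ M := by
  have : IsContinuousRiemannianBundle (EuclideanSpace ℝ (Fin n))
      (fun x : M => TangentSpace (𝓡 n) x) := by
    obtain ⟨g, hg, h⟩ := IsContMDiffRiemannianBundle.exists_contMDiff (IB := 𝓡 n) (n := ∞)
      (F := EuclideanSpace ℝ (Fin n)) (E := fun x : M => TangentSpace (𝓡 n) x)
    exact ⟨g, hg.continuous, h⟩
  have : LocallyConnectedSpace M :=
    ChartedSpace.locallyConnectedSpace (EuclideanSpace ℝ (Fin n)) M
  have huc : ∀ i, Continuous (u i) := fun i => (hu i).smooth.continuous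
  have habs : ∀ κ > 0, ∀ η > 0, ∀ᶠ i in atTop, ∀ t,
      (∀ s ∈ Icc (t - η) (t + η), ∀ x, u i (Circle.exp s, x) ≠ 0) →
      ∀ x, 1 - κ < |u i (Circle.exp t, x)| := by
    intro κ hκ η hη
    obtain ⟨ε₀, hε₀, H⟩ := IsPhaseTransition.exists_lt_abs (n := n) (M := M) hW hκ hη
    filter_upwards [hε.eventually_lt_const hε₀] with i hi
    exact H (ε i) (u i) (hε_pos i) hi (hu i)
  have hFfin : (range θ).Finite := finite_range θ
  rcases Nat.eq_zero_or_pos m with hm | hm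
  · subst hm
    have hempty : range θ = ∅ := range_eq_empty θ
    have hslices : slices θ M = ∅ := by rw [slices, hempty, empty_prod]
    refine ⟨?_, Even.zero, by rw [hslices, image_empty]⟩
    obtain ⟨s, σ, -, h1, h2, h3, h4⟩ := exists_sign_tendstoLocallyUniformlyOn hFfin huc
      (fun i p => (hu i).mem_Icc p) (h := fun _ => 1) (fun _ => rfl) (fun _ => Or.inl rfl)
      (fun _ _ => Eventually.of_forall fun _ => rfl) (b := 0) (fun δ hδ => by
        filter_upwards [hlim.eventually_nodalSetNear one_pos] with i hi t _ x
        have hne : ∀ t, u i (Circle.exp t, x) ≠ 0 := fun t h0 => by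
          obtain ⟨q, hq, -⟩ := hi.near t x h0
          rw [hempty] at hq
          exact hq
        have hc : Continuous fun t => u i (Circle.exp t, x) := by
          have := huc i
          fun_prop
        rw [mul_one]
        rcases le_total 0 t with h | h
        · exact mul_pos_of_forall_ne_zero hc h fun t _ => hne t
        · rw [mul_comm]
          exact mul_pos_of_forall_ne_zero hc h fun t _ => hne t) habs
    exact ⟨s, σ, h1, h2, h3, fun k => k.elim0, h4⟩
  -- The angles of the nodal slices form an arithmetic progression.
  obtain ⟨d, p₀, hP, hp₀, hp₁⟩ := exists_isSeparatedAngleSet hFfin ⟨θ ⟨0, hm⟩, mem_range_self _⟩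
  have hd := hP.pos
  have hPc : IsClosed {t | Circle.exp t ∈ range θ} :=
    hFfin.isClosed.preimage Circle.exp.continuous
  have hctrl : ∀ δ > 0, ∀ᶠ i in atTop, NodalSetNear {t | Circle.exp t ∈ range θ} δ (u i) ∧
      HasSlopeObstruction (d / 2) (u i) ∧ HasSlopeObstruction (d / 2) fun p => -u i p :=
    fun δ hδ => (hlim.eventually_nodalSetNear hδ).and
      (IsPhaseTransition.eventually_hasSlopeObstruction hW hε_pos hε hu (by positivity))
  have hstep : ∀ p, Circle.exp p ∈ range θ → Circle.exp (p + d) ∈ range θ →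
      Circle.exp (p + 2 * d) ∈ range θ := by
    intro p hp hpd
    obtain ⟨q, hq, hlt, hlen, hnext⟩ := hP.exists_next hPc hpd
    have h1 := hP.sep _ hpd q hq hlt
    rcases h1.eq_or_lt with h1 | h1
    · rwa [show p + 2 * d = q by linarith]
    exfalso
    have hδ : 0 < min (d / 6) ((q - (p + d) - d) / 6) := by
      refine lt_min (by positivity) ?_
      linarith
    obtain ⟨i, hi, hl, hl'⟩ := (hctrl _ hδ).exists
    have hm1 := min_le_left (d / 6) ((q - (p + d) - d) / 6)
    have hm2 := min_le_right (d / 6) ((q - (p + d) - d) / 6)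
    exact hi.false_of_gap_lt (huc i) hδ hl hl' hP hPc (by linarith) (by linarith) hp hpd hq
      (by linarith) hlt (fun r hr => (le_or_gt r p).imp_right fun h => by
        linarith [hP.sep p hp r hr h]) hnext hlen (by linarith)
  obtain ⟨N, hN, hNd, hprog⟩ := hP.eq_progression hp₀ hp₁ hstep
  have hNm : N = m := card_eq_of_progression hθ hN hNd hprog
  subst hNm
  have hsigns : ∀ δ > 0, ∀ᶠ i in atTop, ∀ x : M, (∀ k : ℤ, 0 < (-1 : ℝ) ^ k *
      (u i (Circle.exp (p₀ + d / 2), x) * u i (Circle.exp (p₀ + k * d + d / 2), x))) ∧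
      ∀ t, (∀ r, Circle.exp r ∈ range θ → δ ≤ |t - r|) →
        0 < u i (Circle.exp (p₀ + d / 2), x) *
          (u i (Circle.exp t, x) * alternatingStep p₀ d t) := by
    intro δ hδ
    have hδ' : 0 < min δ (d / 6) := lt_min hδ (by positivity)
    filter_upwards [hctrl _ hδ'] with i ⟨hi, hl, hl'⟩ x
    have hm2 := min_le_right δ (d / 6)
    have h1 := hi.mul_alternatingStep_pos (huc i) hδ' hl hl' hP hPc (by linarith) (by linarith)
      hprog x
    exact ⟨h1.1, fun t ht => h1.2 t fun r hr => (min_le_left _ _).trans (ht r hr)⟩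
  have heven : Even N := by
    obtain ⟨i, hi⟩ := (hsigns 1 one_pos).exists
    obtain ⟨x⟩ := ‹Nonempty M›
    have h1 := (hi x).1 N
    have h2 : Circle.exp (p₀ + (N : ℤ) * d + d / 2) = Circle.exp (p₀ + d / 2) := by
      refine Circle.exp_eq_exp.2 ⟨1, ?_⟩
      push_cast
      rw [hNd]
      ring
    rw [h2] at h1
    by_contra hodd
    rw [Nat.not_even_iff_odd] at hodd
    have h3 : Odd (N : ℤ) := by exact_mod_cast hodd
    rw [h3.neg_one_zpow] at h1
    nlinarith [mul_self_nonneg (u i (Circle.exp (p₀ + d / 2), x))]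
  have hrot : 2 * Real.pi / N = d := by
    rw [← hNd]
    field_simp
  refine ⟨?_, heven, ?_⟩
  · obtain ⟨s, σ, hσ, h1, h2, h3, h4⟩ := exists_sign_tendstoLocallyUniformlyOn hFfin huc
      (fun i p => (hu i).mem_Icc p) (h := alternatingStep p₀ d) (b := p₀ + d / 2)
      (hNd ▸ periodic_alternatingStep hd heven) alternatingStep_eq_or
      (fun t ht => eventually_alternatingStep_eq hd fun k hk => ht ((hprog t).2 ⟨k, hk⟩))
      (fun δ hδ => (hsigns δ hδ).mono fun i hi t ht x => (hi x).2 t ht) habs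
    refine ⟨s, σ, h1, h2, h3, fun k => ?_, h4⟩
    obtain ⟨t, ht⟩ := Circle.exp_surjective (θ k)
    obtain ⟨j, rfl⟩ := (hprog t).1 (by rw [mem_ofPred_eq, ht]; exact mem_range_self k)
    filter_upwards [Ioo_mem_nhdsGT hd] with s hs
    rw [← ht, ← Circle.exp_add, ← Circle.exp_add, hσ, hσ,
      alternatingStep_of_mem hd (k := j) ⟨by linarith [hs.1], by linarith [hs.2]⟩,
      alternatingStep_of_mem hd (k := j - 1) ⟨by push_cast; linarith [hs.2],
        by push_cast; linarith [hs.1]⟩, zpow_sub_one₀ (by norm_num)]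
    norm_num
  · have hinv : ∀ z, Circle.exp d * z ∈ range θ ↔ z ∈ range θ := by
      intro z
      obtain ⟨t, rfl⟩ := Circle.exp_surjective z
      rw [← Circle.exp_add]
      refine (hprog (d + t)).trans (Iff.trans ?_ (hprog t).symm)
      constructor
      · rintro ⟨k, hk⟩
        exact ⟨k - 1, by push_cast; linarith⟩
      · rintro ⟨k, hk⟩
        exact ⟨k + 1, by push_cast; linarith⟩
    rw [hrot]
    ext ⟨z, x⟩
    constructor
    · rintro ⟨⟨w, y⟩, ⟨hw, -⟩, h⟩
      obtain ⟨rfl, rfl⟩ := Prod.mk.inj h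
      exact ⟨(hinv w).2 hw, mem_univ _⟩
    · rintro ⟨hz, -⟩
      have e : Circle.exp d * ((Circle.exp d)⁻¹ * z) = z := mul_inv_cancel_left _ _
      exact ⟨((Circle.exp d)⁻¹ * z, x), ⟨(hinv _).1 (by rwa [e]), mem_univ _⟩, by simp only [e]⟩
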